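/- **Setting.** Let $\mathfrak g$ be of untwisted affine type $A_n^{(1)}$ ($n\ge1$), $B_n^{(1)}$ ($n\ge2$), $C_n^{(1)}$ ($n\ge3$), $D_n^{(1)}$ ($n\ge4$), $E_{6,7,8}^{(1)}$, $F_4^{(1)}$, $G_2^{(1)}$. Let $\triangle$ be the Dynkin diagram of type $A_n, A_{2n-1}, D_{n+1}, D_n, E_{6,7,8}, E_6, D_4$ respectively, with vertex set $I_{\mathfrak g}$ (Bourbaki numbering) and distance $d(\cdot,\cdot)$. Let $\sigma$ be the following automorphism of $\triangle$: the identity for $A^{(1)},D^{(1)},E^{(1)}$; $k\mapsto 2n-k$ for $B_n^{(1)}$; the exchange of $n$ and $n+1$ for $C_n^{(1)}$; $1\leftrightarrow6$, $3\leftrightarrow5$ for $F_4^{(1)}$; $1\mapsto3\mapsto4\mapsto1$ for $G_2^{(1)}$. Let $\mathsf d_\imath$ be the size of the $\sigma$-orbit of $\imath$, and let $\mathsf h^\vee = n+1,\,2n-1,\,n+1,\,2n-2,\,(12,18,30),\,9,\,4$ (for $A,B,C,D,E_{6,7,8},F_4,G_2$) be the dual Coxeter number. Let $\mathsf W$ be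 the Weyl group of $\triangle$ with simple reflections $s_\imath$, simple roots $\alpha_\imath$, fundamental weights $\Lambda_\imath$, set of positive roots $\Phi^+$, longest element $w_0$ of length $\ell$, and let $\alpha_{\imath^*}=-w_0\alpha_\imath$. A *height function* is $\xi\colon I_{\mathfrak g}\to\mathbb Z$ such that, whenever $d(\imath,\jmath)=1$: if $\mathsf d_\imath=\mathsf d_\jmath$ then $|\xi_\imath-\xi_\jmath|=\mathsf d_\imath$; if $1=\mathsf d_\imath<\mathsf d_\jmath=\mathrm{ord}(\sigma)$ there is a unique $\jmath^\circ$ in the $\sigma$-orbit of $\jmath$ with $|\xi_\imath-\xi_{\jmath^\circ}|=1$ and $\xi_{\sigma^k(\jmath^\circ)}=\xi_{\jmath^\circ}+2k$ for $0\le k<\mathrm{ord}(\sigma)$. A *Q-datum* is $\mathcal Q=(\triangle,\sigma,\xi)$ with $\xi$ a height function; write $\xi_\imath(\mathcal Q)=\xi_\imath$. A vertex $\imath$ is a *sink* (resp. *source*) of $\mathcal Q$ if $\xi_\imath<\xi_\jmath$ (resp. $\xi_\imath-2\mathsf d_\imath>\xi_\jmath-2\mathsf d_\jmath$) for all $\jmath$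 with $d(\imath,\jmath)=1$. If $\imath$ is a sink (resp. source), $s_\imath\mathcal Q$ (resp. $s_\imath^{-1}\mathcal Q$) is the Q-datum obtained by replacing $\xi_\imath$ by $\xi_\imath+2\mathsf d_\imath$ (resp. $\xi_\imath-2\mathsf d_\imath$). An expression $s_{\jmath_1}\cdots s_{\jmath_l}$ is *$\mathcal Q$-adapted* if $\jmath_k$ is a sink of $s_{\jmath_{k-1}}\cdots s_{\jmath_1}\mathcal Q$ for all $k$. Put $\widehat I_{\mathcal Q}=\{(\imath,p)\in I_{\mathfrak g}\times\mathbb Z\mid p-\xi_\imath\in2\mathsf d_\imath\mathbb Z\}$. The *Coxeter elements* $(\tau_{\mathcal Q})_{\mathcal Q}$ are the unique family of elements, indexed by all Q-data for $\mathfrak g$, such that: (α) if, for every $\sigma$-orbit with vertex $\imath^\circ$ of minimal height, $\xi_{\sigma^k(\imath^\circ)}=\xi_{\imath^\circ}+2k$ for $0\le k<\mathsf d_{\imath^\circ}$, then $\tau_{\mathcal Q}=s_{\imath_1^\circ}\cdots s_{\imath_n^\circ}\sigma$, where $\imath_1^\circ,\dots,\imath_n^\circ$ are these vertices, one for each orbit,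 in weakly increasing order of height; (β) $\tau_{s_\imath\mathcal Q}=s_\imath\tau_{\mathcal Q}s_\imath$ for every sink $\imath$ of $\mathcal Q$. The map $\phi_{\mathcal Q}$ on $\widehat I_{\mathcal Q}$ is defined by $\phi_{\mathcal Q}(\imath,\xi_\imath)=((1-\tau_{\mathcal Q}^{\mathsf d_\imath})\Lambda_\imath,0)$ and, if $\phi_{\mathcal Q}(\imath,p)=(\beta,m)$, then $\phi_{\mathcal Q}(\imath,p\pm2\mathsf d_\imath)=(\tau_{\mathcal Q}^{\pm\mathsf d_\imath}\beta,m)$ if $\tau_{\mathcal Q}^{\pm\mathsf d_\imath}\beta\in\Phi^+$ and $(-\tau_{\mathcal Q}^{\pm\mathsf d_\imath}\beta,m\pm1)$ otherwise. For a sequence $(\imath_k)_{k\in\mathbb Z}$ put $s^+=\min\{t>s\mid\imath_t=\imath_s\}$ and $s^-=\max\{t<s\mid\imath_t=\imath_s\}$. A sequence $(\imath_k,p_k)_{k\in\mathbb Z}$ in $I_{\mathfrak g}\times\mathbb Z$ is *admissible* if (a) $p_{s^+}=p_s+2\mathsf d_{\imath_s}$; (b) $p_t=p_s+\min(\mathsf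 d_{\imath_s},\mathsf d_{\imath_t})$ if $d(\imath_s,\imath_t)=1$ and $t^-<s<t<s^+$; (c) $p_t-(p_s+2)\in2\mathsf d_{\imath_s}\mathbb Z$ if $\imath_t=\sigma(\imath_s)$; (d) $s_{\imath_k}\cdots s_{\imath_{k+\ell-1}}=w_0$ for all $k\in\mathbb Z$. **Proposition.** The family $(\tau_{\mathcal Q})_{\mathcal Q}$ exists and is unique. Let $A$ be the set of pairs $(\mathcal Q,\underline w_0)$ of a Q-datum $\mathcal Q=(\triangle,\sigma,\xi)$ and a $\mathcal Q$-adapted reduced expression $\underline w_0$ of $w_0$, and let $B$ be the set of admissible sequences. There is a bijection $\varrho\colon A\to B$ given as follows. (1) For $\underline w_0=s_{\jmath_1}\cdots s_{\jmath_\ell}$, $\varrho(\mathcal Q,\underline w_0)=(\imath_k,p_k)_{k\in\mathbb Z}$ where, for $1\le s\le\ell$ and $m\in\mathbb Z$, $\imath_{s+m\ell}=\jmath_s$ if $m$ is even and $(\jmath_s)^*$ if $m$ is odd, and $p_k=\xi_{\imath_k}(s_{\imath_{k-1}}\cdots s_{\imath_1}\mathcal Q)$ if $k\ge1$, $p_k=\xi_{\imath_k}(s_{\imath_k}^{-1}s_{\imath_{k+1}}^{-1}\cdots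 s_{\imath_0}^{-1}\mathcal Q)$ if $k\le0$; here all reflections are applied at sinks (for $k\ge1$) or sources (for $k\le 0$), so they are defined. (2) Conversely, $\varrho^{-1}\big((\imath_k,p_k)_{k}\big)=(\mathcal Q,s_{\imath_1}\cdots s_{\imath_\ell})$ with $\xi_\imath=p_{\vartheta_\imath}$, $\vartheta_\imath=\min\{k\ge1\mid\imath_k=\imath\}$. Moreover, if $\varrho(\mathcal Q,\underline w_0)=(\imath_k,p_k)_{k\in\mathbb Z}$, then: (i) $s\mapsto(\imath_s,p_s)$ is a bijection $\mathbb Z\to\widehat I_{\mathcal Q}$. (ii) $\phi_{\mathcal Q}(\imath_k,p_k)=(s_{\imath_1}\cdots s_{\imath_{k-1}}\alpha_{\imath_k},0)$ for $1\le k\le\ell$. (iii) $\imath_{s+\ell}=(\imath_s)^*$ and $p_{s+\ell}=p_s+\mathrm{ord}(\sigma)\,\mathsf h^\vee$ for all $s\in\mathbb Z$. (iv) $\imath_1$ is a sink of $\mathcal Q$, $s_{\imath_2}\cdots s_{\imath_{\ell+1}}$ is an $s_{\imath_1}\mathcal Q$-adapted reduced expression of $w_0$, and $\varrho(s_{\imath_1}\mathcal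 Q,\,s_{\imath_2}\cdots s_{\imath_{\ell+1}})=(\imath_{k+1},p_{k+1})_{k\in\mathbb Z}$. (v) If $s^-<t<s$, $d(\imath_s,\imath_t)=1$ and $\mathsf d_{\imath_s}<\mathsf d_{\imath_t}$, then there is $t'$ with $s<t'<s^+$ and $\imath_{t'}=\sigma(\imath_t)$. -/

import Mathlib

namespace QData

/-- The untwisted affine types `X_n^{(1)}`. -/
inductive AffineType
  | A (n : ℕ) (hn : 1 ≤ n)
  | B (n : ℕ) (hn : 2 ≤ n)
  | C (n : ℕ) (hn : 3 ≤ n)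
  | D (n : ℕ) (hn : 4 ≤ n)
  | E6
  | E7
  | E8
  | F4
  | G2

/-- The rank of the simply-laced finite type `g_fin` attached to `g`:
`A_n, A_{2n-1}, D_{n+1}, D_n, E_6, E_7, E_8, E_6, D_4`. -/
abbrev rank : AffineType → ℕ
  | .A n _ => n
  | .B n _ => 2 * n - 1
  | .C n _ => n + 1
  | .D n _ => n
  | .E6 => 6
  | .E7 => 7
  | .E8 => 8
  | .F4 => 6
  | .G2 => 4

/-- The vertex set of the Dynkin diagram of `g_fin` (the vertex called `k` in the usual
numbering is `k - 1` here). -/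
abbrev Vertex (g : AffineType) : Type := Fin (rank g)

/-- The Cartan matrix of `g_fin`. -/
def cartan : (g : AffineType) → Matrix (Vertex g) (Vertex g) ℤ
  | .A n _ => CartanMatrix.A n
  | .B n _ => CartanMatrix.A (2 * n - 1)
  | .C n _ => CartanMatrix.D (n + 1)
  | .D n _ => CartanMatrix.D n
  | .E6 => CartanMatrix.E₆
  | .E7 => CartanMatrix.E₇
  | .E8 => CartanMatrix.E₈
  | .F4 => CartanMatrix.E₆
  | .G2 => CartanMatrix.D 4

theorem cartan_diag (g : AffineType) (i : Vertex g) : cartan g i i = 2 := by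
  cases g with
  | A n hn => exact congrFun (CartanMatrix.A_diag n) i
  | B n hn => exact congrFun (CartanMatrix.A_diag (2 * n - 1)) i
  | C n hn => exact CartanMatrix.D_diag (n + 1) i
  | D n hn => exact CartanMatrix.D_diag n i
  | E6 => exact CartanMatrix.E₆_diag i
  | E7 => exact CartanMatrix.E₇_diag i
  | E8 => exact CartanMatrix.E₈_diag i
  | F4 => exact CartanMatrix.E₆_diag i
  | G2 => exact CartanMatrix.D_diag 4 i

/-- The diagram automorphism `σ`: the identity in types `ADE`; `k ↦ 2n - k` on `A_{2n-1}` for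
`B_n`; the exchange of the last two vertices of `D_{n+1}` for `C_n`; the exchange `1 ↔ 6`, `3 ↔ 5`
of `E_6` for `F_4`; the rotation `1 ↦ 3 ↦ 4 ↦ 1` of `D_4` for `G_2`. -/
def sigma : (g : AffineType) → Equiv.Perm (Vertex g)
  | .A _ _ => 1
  | .B n _ => (Fin.revPerm : Equiv.Perm (Fin (2 * n - 1)))
  | .C n hn =>
      (Equiv.swap ⟨n - 1, by omega⟩ ⟨n, by omega⟩ : Equiv.Perm (Fin (n + 1)))
  | .D _ _ => 1
  | .E6 => 1
  | .E7 => 1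
  | .E8 => 1
  | .F4 => (Equiv.swap 0 5 * Equiv.swap 2 4 : Equiv.Perm (Fin 6))
  | .G2 => (Equiv.swap 0 2 * Equiv.swap 2 3 : Equiv.Perm (Fin 4))

/-- The dual Coxeter number `h^∨` of `g` (equivalently, of `g_0`). -/
def dualCoxeter : AffineType → ℕ
  | .A n _ => n + 1
  | .B n _ => 2 * n - 1
  | .C n _ => n + 1
  | .D n _ => 2 * n - 2
  | .E6 => 12
  | .E7 => 18
  | .E8 => 30
  | .F4 => 9
  | .G2 => 4

/-- `d(i, j) = 1`: the vertices `i` and `j` are joined by an edge of the Dynkin diagram. -/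
def Adj (g : AffineType) (i j : Vertex g) : Prop := i ≠ j ∧ cartan g i j ≠ 0

/-- `ord(σ)`. -/
noncomputable def ordSigma (g : AffineType) : ℕ := orderOf (sigma g)

/-- `d_i`, the size of the `σ`-orbit of `i`. -/
noncomputable def dd (g : AffineType) (i : Vertex g) : ℕ :=
  Nat.card {j : Vertex g // (sigma g).SameCycle i j}

/-! ### Weight lattice, Weyl group, roots -/

/-- The weight lattice of `g_fin`, in coordinates with respect to the fundamental weights. -/
abbrev Weight (g : AffineType) : Type := Vertex g → ℤ

/-- The fundamental weight `Λ_i`. -/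
def fundWeight (g : AffineType) (i : Vertex g) : Weight g := Pi.single i 1

/-- The simple root `α_i = ∑_j ⟨h_j, α_i⟩ Λ_j`. -/
def simpleRoot (g : AffineType) (i : Vertex g) : Weight g := fun j => cartan g j i

theorem proj_simpleRoot (g : AffineType) (i : Vertex g) :
    (LinearMap.proj i : Weight g →ₗ[ℤ] ℤ) (simpleRoot g i) = 2 :=
  cartan_diag g i

/-- The simple reflection `s_i λ = λ - ⟨h_i, λ⟩ α_i`. -/
def s (g : AffineType) (i : Vertex g) : Weight g ≃ₗ[ℤ] Weight g :=
  Module.reflection (proj_simpleRoot g i)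

/-- `σ` acting on the weight lattice by `Λ_i ↦ Λ_{σ i}`. -/
def sigmaP (g : AffineType) : Weight g ≃ₗ[ℤ] Weight g :=
  LinearEquiv.funCongrLeft ℤ ℤ (sigma g).symm

/-- The product `s_{i_1} ⋯ s_{i_l}` for the word `[i_1, …, i_l]`. -/
def wordProd (g : AffineType) (l : List (Vertex g)) : Weight g ≃ₗ[ℤ] Weight g :=
  (l.map (s g)).prod

/-- The Weyl group. -/
def weylGroup (g : AffineType) : Subgroup (Weight g ≃ₗ[ℤ] Weight g) :=
  Subgroup.closure (Set.range (s g))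

/-- The length of a Weyl group element. -/
noncomputable def len (g : AffineType) (w : Weight g ≃ₗ[ℤ] Weight g) : ℕ :=
  sInf {n | ∃ l : List (Vertex g), l.length = n ∧ wordProd g l = w}

/-- `l` is a reduced expression of `w`. -/
def IsReducedExpr (g : AffineType) (w : Weight g ≃ₗ[ℤ] Weight g) (l : List (Vertex g)) : Prop :=
  wordProd g l = w ∧ l.length = len g w

/-- The longest element `w_0` of the Weyl group. -/
noncomputable def w0 (g : AffineType) : Weight g ≃ₗ[ℤ] Weight g :=
  Classical.epsilon fun w => w ∈ weylGroup g ∧ ∀ v ∈ weylGroup g, len g v ≤ len g w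

/-- `ℓ`, the length of `w_0`. -/
noncomputable def ell (g : AffineType) : ℕ := len g (w0 g)

open Classical in
/-- The involution `i ↦ i^*` with `α_{i^*} = -w_0 α_i`. -/
noncomputable def star (g : AffineType) (i : Vertex g) : Vertex g :=
  if h : ∃ j, simpleRoot g j = -(w0 g (simpleRoot g i)) then h.choose else i

/-- Positive roots: Weyl group images of simple roots that are nonnegative integral combinations
of simple roots. -/
def IsPosRoot (g : AffineType) (b : Weight g) : Prop :=
  (∃ w ∈ weylGroup g, ∃ i, b = w (simpleRoot g i)) ∧
    ∃ c : Vertex g → ℕ, b = ∑ i, c i • simpleRoot g i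

/-! ### Q-data -/

/-- Height functions on `(Δ, σ)`. -/
structure IsHeight (g : AffineType) (ξ : Vertex g → ℤ) : Prop where
  eq_case : ∀ i j, Adj g i j → dd g i = dd g j → |ξ i - ξ j| = dd g i
  lt_case : ∀ i j, Adj g i j → 1 = dd g i → dd g i < dd g j → dd g j = ordSigma g →
    ∃! j₀, (sigma g).SameCycle j j₀ ∧ |ξ i - ξ j₀| = 1 ∧
      ∀ k : ℕ, k < ordSigma g → ξ ((sigma g ^ k) j₀) = ξ j₀ + 2 * k

/-- A Q-datum `(Δ, σ, ξ)` for `g`; the pair `(Δ, σ)` is determined by `g`. -/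
structure QDatum (g : AffineType) where
  ξ : Vertex g → ℤ
  isHeight : IsHeight g ξ

def IsSink (g : AffineType) (ξ : Vertex g → ℤ) (i : Vertex g) : Prop :=
  ∀ j, Adj g i j → ξ i < ξ j

def IsSource (g : AffineType) (ξ : Vertex g → ℤ) (i : Vertex g) : Prop :=
  ∀ j, Adj g i j → ξ i - 2 * dd g i > ξ j - 2 * dd g j

/-- The height function `s_i ξ` (meaningful when `i` is a sink). -/
noncomputable def reflect (g : AffineType) (i : Vertex g) (ξ : Vertex g → ℤ) : Vertex g → ℤ :=
  fun j => ξ j + if j = i then 2 * (dd g i : ℤ) else 0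

/-- The height function `s_i⁻¹ ξ` (meaningful when `i` is a source). -/
noncomputable def reflectInv (g : AffineType) (i : Vertex g) (ξ : Vertex g → ℤ) :
    Vertex g → ℤ :=
  fun j => ξ j - if j = i then 2 * (dd g i : ℤ) else 0

/-- The word `[i_1, …, i_l]` is adapted to `ξ`: `i_k` is a sink of `s_{i_{k-1}} ⋯ s_{i_1} ξ`
for all `k`. -/
def IsAdapted (g : AffineType) : (Vertex g → ℤ) → List (Vertex g) → Prop
  | _, [] => True
  | ξ, i :: l => IsSink g ξ i ∧ IsAdapted g (reflect g i ξ) l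

/-- `Î_Q`. -/
def IHat (g : AffineType) (ξ : Vertex g → ℤ) : Set (Vertex g × ℤ) :=
  {x | ∃ m : ℤ, x.2 - ξ x.1 = 2 * dd g x.1 * m}

/-! ### The Coxeter elements `τ_Q` and the map `φ_Q` -/

/-- `i` is a vertex of minimal height in its `σ`-orbit. -/
def IsOrbitMin (g : AffineType) (ξ : Vertex g → ℤ) (i : Vertex g) : Prop :=
  ∀ j, (sigma g).SameCycle i j → ξ i ≤ ξ j

/-- The characterization of the family `(τ_Q)_Q` of `Q`-adapted Coxeter elements in `W σ`.
If on every `σ`-orbit, with vertex `i°` of minimal height, the heights are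
`ξ_{σ^k(i°)} = ξ_{i°} + 2k` for `0 ≤ k < d_i`, then `τ_Q = s_{i°_1} ⋯ s_{i°_n} σ`, where
`i°_1, …, i°_n` are these vertices in an order of weakly increasing height. Moreover
`τ_{s_i Q} = s_i τ_Q s_i` for every sink `i` of `Q`. -/
structure IsCoxeterFamily (g : AffineType) (τ : QDatum g → (Weight g ≃ₗ[ℤ] Weight g)) :
    Prop where
  base : ∀ Q : QDatum g,
    (∀ i, IsOrbitMin g Q.ξ i → ∀ k : ℕ, k < dd g i → Q.ξ ((sigma g ^ k) i) = Q.ξ i + 2 * k) →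
    ∀ l : List (Vertex g), l.Nodup → (∀ i, i ∈ l ↔ IsOrbitMin g Q.ξ i) →
      l.Pairwise (fun i j => Q.ξ i ≤ Q.ξ j) → τ Q = wordProd g l * sigmaP g
  reflection : ∀ (Q Q' : QDatum g) (i : Vertex g), IsSink g Q.ξ i → Q'.ξ = reflect g i Q.ξ →
    τ Q' = s g i * τ Q * s g i

/-- The `Q`-adapted Coxeter element `τ_Q`. -/
noncomputable def coxeter (g : AffineType) : QDatum g → (Weight g ≃ₗ[ℤ] Weight g) :=
  Classical.epsilon (IsCoxeterFamily g)

/-- `γ_i^Q = (1 - τ_Q^{d_i}) Λ_i`. -/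
noncomputable def gam (g : AffineType) (Q : QDatum g) (i : Vertex g) : Weight g :=
  fundWeight g i - (coxeter g Q ^ dd g i) (fundWeight g i)

open Classical in
/-- The rule that gives `φ_Q(i, p + 2 d_i)` from `φ_Q(i, p)`. -/
noncomputable def stepUp (g : AffineType) (Q : QDatum g) (i : Vertex g)
    (x : Weight g × ℤ) : Weight g × ℤ :=
  if IsPosRoot g ((coxeter g Q ^ dd g i) x.1) then ((coxeter g Q ^ dd g i) x.1, x.2)
  else (-((coxeter g Q ^ dd g i) x.1), x.2 + 1)

open Classical in
/-- The rule that gives `φ_Q(i, p - 2 d_i)` from `φ_Q(i, p)`. -/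
noncomputable def stepDown (g : AffineType) (Q : QDatum g) (i : Vertex g)
    (x : Weight g × ℤ) : Weight g × ℤ :=
  if IsPosRoot g (((coxeter g Q)⁻¹ ^ dd g i) x.1) then (((coxeter g Q)⁻¹ ^ dd g i) x.1, x.2)
  else (-(((coxeter g Q)⁻¹ ^ dd g i) x.1), x.2 - 1)

/-- The map `φ_Q`, on `(i, p) ∈ Î_Q`: it starts from `φ_Q(i, ξ_i) = (γ_i^Q, 0)` and applies the
two rules as often as needed. -/
noncomputable def phi (g : AffineType) (Q : QDatum g) (x : Vertex g × ℤ) : Weight g × ℤ :=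
  let k : ℤ := (x.2 - Q.ξ x.1) / (2 * dd g x.1)
  if 0 ≤ k then (stepUp g Q x.1)^[k.toNat] (gam g Q x.1, 0)
  else (stepDown g Q x.1)^[(-k).toNat] (gam g Q x.1, 0)

/-! ### Admissible sequences -/

/-- `t < s^+`, where `s^+ = min ({u > s | i_u = i_s} ∪ {+∞})`. -/
def LtNext {I : Type} (i : ℤ → I) (t s : ℤ) : Prop := ∀ u, s < u → i u = i s → t < u

/-- `s^- < t`, where `s^- = max ({u < s | i_u = i_s} ∪ {-∞})`. -/
def PrevLt {I : Type} (i : ℤ → I) (s t : ℤ) : Prop := ∀ u, u < s → i u = i s → u < t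

/-- The word `[i_a, i_{a+1}, …, i_{a+n-1}]`. -/
def window {I : Type} (i : ℤ → I) (a : ℤ) (n : ℕ) : List I := List.ofFn fun j : Fin n => i (a + j)

/-- Admissibility of the sequence `(i_k, p_k)_{k ∈ ℤ}`. -/
structure IsAdmissible (g : AffineType) (i : ℤ → Vertex g) (p : ℤ → ℤ) : Prop where
  next : ∀ a b, IsLeast {u | a < u ∧ i u = i a} b → p b = p a + 2 * dd g (i a)
  adj : ∀ a b, Adj g (i a) (i b) → PrevLt i b a → a < b → LtNext i b a →
    p b = p a + min (dd g (i a) : ℤ) (dd g (i b))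
  sigma : ∀ a b, i b = sigma g (i a) → ∃ m : ℤ, p b - (p a + 2) = 2 * dd g (i a) * m
  longest : ∀ k, wordProd g (window i k (ell g)) = w0 g

/-- An admissible sequence `(i_k, p_k)_{k ∈ ℤ}`. -/
structure AdmissibleSeq (g : AffineType) where
  i : ℤ → Vertex g
  p : ℤ → ℤ
  admissible : IsAdmissible g i p

/-- A pair of a Q-datum `Q` and a `Q`-adapted reduced expression of `w_0`. -/
structure AdaptedPair (g : AffineType) where
  Q : QDatum g
  word : List (Vertex g)
  reduced : IsReducedExpr g (w0 g) word
  adapted : IsAdapted g Q.ξ word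

/-- The height function of `s_{i_n} ⋯ s_{i_1} Q`. -/
noncomputable def chainUp (g : AffineType) (ξ : Vertex g → ℤ) (i : ℤ → Vertex g) :
    ℕ → Vertex g → ℤ
  | 0 => ξ
  | n + 1 => reflect g (i (n + 1)) (chainUp g ξ i n)

/-- The height function of `(s_{i_{-(n-1)}})⁻¹ ⋯ (s_{i_{-1}})⁻¹ (s_{i_0})⁻¹ Q`. -/
noncomputable def chainDown (g : AffineType) (ξ : Vertex g → ℤ) (i : ℤ → Vertex g) :
    ℕ → Vertex g → ℤ
  | 0 => ξ
  | n + 1 => reflectInv g (i (-n)) (chainDown g ξ i n)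

end QData

/-! An admissible sequence is a bi-infinite chain of height functions, each obtained from the
previous one by reflecting at a sink. Both sides of the bijection are compared with such chains
(`IsChain`), and all listed properties are read off from the chain.

Transition elements. The conditions on a height function are inequalities and congruences (`HF`).
Inside a congruence class (`Compat`), height functions are closed under minima, any ξ ≤ ξ' are
joined by an adapted word, and two such words have the same product (`path_unique`). Hence there is
an element `tr g ξ ξ'` of W which is multiplicative in (ξ, ξ'), equivariant under diagram
automorphisms and shifts, and fixes Λ_i whenever ξ_i = ξ'_i. With `rot g ξ` = σξ + 2 the Coxeter
element is `tr g ξ (rot g ξ)` followed by σ (`cox`). The conjugation rule is multiplicativity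
(`tr_mul_cox`), the explicit product is an explicit adapted word (`IsAligned.path_rot`), and
uniqueness holds because every height function is reached from an aligned one.

The central fact is `tr_twist`: the transition from ξ to ξ^* + ord(σ) h^∨ is w_0. It is proved first
for aligned ξ, where τ is a word with one letter per σ-orbit. The roots γ_o = (1 - τ)Λ_o stay
positive under τ for `turn` steps, and then τ^turn Λ_o = -Λ_{o^*} (`pow_turn_orbitWeight`). The
functions t ↦ (u, τ^t Λ_o) with u dominant first decrease and then increase over a period, so their
increments have no smaller period (`dvd_of_periodic_sub`); therefore all orbits have one common
period. A commutation argument (`IsAligned.tr_eq_w0`) and an averaging argument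
(`IsAligned.exists_gap_eq`) show that the delay between Λ_i and -Λ_i is the same for all i. Since a
reduced word of w_0 has |Φ⁺| letters, the count `two_mul_card_posRoots` identifies this delay as
ord(σ) h^∨ (`HF.twist_fl`).

Reduced adapted words cannot pass ξ^* + ord(σ) h^∨ (`Path.le_twist`), so adapted reduced words of
w_0 end exactly there. Such a word continues to a chain by applying * and the shift
(`exists_isChain`). Conversely the windows of an admissible sequence are adapted reduced words of
w_0, so it is a chain too (`IsAdmissible.isChain`). The values of φ_Q are differences of the
consecutive weights `slot`.

The facts about roots and the Weyl group that are needed are derived from explicit lists of positive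
roots (`isPosSystem`). -/

namespace QData

/-! ### Explicit systems of positive roots -/

/-- A finite set of vectors with the formal properties of the set of positive roots attached to
the Cartan matrix `C`. -/
structure IsPosSystem {m : ℕ} (C : Matrix (Fin m) (Fin m) ℤ) (P : Finset (Fin m → ℤ)) : Prop where
  zero : 0 ∉ P
  simple : ∀ i, (fun j => C j i) ∈ P
  neg_simple : ∀ i, -(fun j => C j i) ∉ P
  cone : ∀ b ∈ P, ∃ c : Fin m → ℕ, b = ∑ i, c i • (fun j => C j i)
  refl : ∀ b ∈ P, ∀ i, b = (fun j => C j i) ∨ b - b i • (fun j => C j i) ∈ P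

/-- The `k`-th standard coordinate vector. -/
def stdVec (k : ℕ) : ℕ → ℤ := fun j => if j = k then 1 else 0

theorem cone_add {m : ℕ} {C : Matrix (Fin m) (Fin m) ℤ} {a b : Fin m → ℤ}
    (ha : ∃ c : Fin m → ℕ, a = ∑ i, c i • (fun j => C j i))
    (hb : ∃ c : Fin m → ℕ, b = ∑ i, c i • (fun j => C j i)) :
    ∃ c : Fin m → ℕ, a + b = ∑ i, c i • (fun j => C j i) := by
  obtain ⟨c, rfl⟩ := ha
  obtain ⟨d, rfl⟩ := hb
  exact ⟨c + d, by simp only [Pi.add_apply, add_smul, Finset.sum_add_distrib]⟩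

theorem cone_simple {m : ℕ} (C : Matrix (Fin m) (Fin m) ℤ) (k : Fin m) :
    ∃ c : Fin m → ℕ, (fun j => C j k) = ∑ i, c i • (fun j => C j i) :=
  ⟨Pi.single k 1, by
    rw [Finset.sum_eq_single k] <;> simp +contextual⟩

/-! #### Type `A` -/

/-- The coordinates `⟨h_k, x⟩ = x_k - x_{k+1}`. -/
def diffA (n : ℕ) (x : ℕ → ℤ) : Fin n → ℤ := fun k => x k - x (k + 1)

/-- The vector `e_a - e_b`. -/
def vecA (n : ℕ) (p : ℕ × ℕ) : Fin n → ℤ := diffA n (stdVec p.1 - stdVec p.2)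

def pairsLT (n : ℕ) : Finset (ℕ × ℕ) :=
  (Finset.range n ×ˢ Finset.range n).filter fun p => p.1 < p.2

theorem mem_pairsLT {n : ℕ} {p : ℕ × ℕ} : p ∈ pairsLT n ↔ p.1 < p.2 ∧ p.2 < n := by
  simp only [pairsLT, Finset.mem_filter, Finset.mem_product, Finset.mem_range]; omega

theorem two_mul_card_pairsLT (n : ℕ) : 2 * (pairsLT n).card = n * (n - 1) := by
  have h : (pairsLT n).card = ((Finset.range n).sigma fun b => Finset.range b).card :=
    Finset.card_nbij' (fun p => ⟨p.2, p.1⟩) (fun p => (p.2, p.1))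
      (fun p hp => by
        rw [Finset.mem_coe, mem_pairsLT] at hp
        simp only [Finset.coe_sigma, Set.mem_sigma_iff, Finset.mem_coe, Finset.mem_range]
        omega)
      (fun p hp => by
        simp only [Finset.coe_sigma, Set.mem_sigma_iff, Finset.mem_coe, Finset.mem_range] at hp
        rw [Finset.mem_coe, mem_pairsLT]
        exact ⟨hp.2, hp.1⟩)
      (fun _ _ => rfl) (fun _ _ => rfl)
  rw [h, Finset.card_sigma]
  simp only [Finset.card_range]
  rw [mul_comm, Finset.sum_range_id_mul_two]

def rootsA (n : ℕ) : Finset (Fin n → ℤ) := (pairsLT (n + 1)).image (vecA n)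

/-- The coordinates determine a vector on 0, …, n only up to a constant. The constant cancels in the
difference of the entries at a and b, which is 2; a vector e_c - e_d has entries in [-1, 1], so it
must take the values 1 and -1 there. -/
theorem diffA_inj {n : ℕ} {a b c d : ℕ} (hab : a ≠ b) (ha : a ≤ n) (hb : b ≤ n)
    (h : vecA n (a, b) = vecA n (c, d)) : a = c ∧ b = d := by
  set x : ℕ → ℤ := stdVec a - stdVec b with hx
  set y : ℕ → ℤ := stdVec c - stdVec d with hy
  have h1 : ∀ k, k ≤ n → x k - y k = x 0 - y 0 := by
    intro k hk
    induction k with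
    | zero => rfl
    | succ k ih =>
      have := congrFun h ⟨k, hk⟩
      simp only [vecA, diffA, ← hx, ← hy] at this
      have := ih (by omega)
      linarith
  have hv : ∀ k, (y k = 1 → k = c) ∧ (y k = -1 → k = d) ∧ y k ≤ 1 ∧ -1 ≤ y k := by
    intro k
    simp only [hy, Pi.sub_apply, stdVec]
    split_ifs <;> omega
  have ea := h1 a ha
  have eb := h1 b hb
  have xa : x a = 1 := by simp [hx, stdVec, hab]
  have xb : x b = -1 := by simp [hx, stdVec, hab.symm]
  obtain ⟨ha1, -, ha3, -⟩ := hv a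
  obtain ⟨-, hb2, -, hb4⟩ := hv b
  rw [xa] at ea
  rw [xb] at eb
  exact ⟨ha1 (by omega), hb2 (by omega)⟩

/-- In standard coordinates the k-th simple reflection is a transposition; stability of the roots
thereby becomes a statement about pairs of indices. -/
theorem diffA_swap (n : ℕ) (x : ℕ → ℤ) (k : Fin n) :
    diffA n x - diffA n x k • (fun j => CartanMatrix.A n j k) =
      diffA n (x ∘ Equiv.swap (k : ℕ) (k + 1)) := by
  ext j
  simp only [Pi.sub_apply, Pi.smul_apply, diffA, CartanMatrix.A, Matrix.of_apply, smul_eq_mul,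
    Function.comp, Equiv.swap_apply_def, Fin.ext_iff]
  split_ifs <;> first | omega | (simp_all; done) | (simp_all; ring)

theorem stdVec_comp (a : ℕ) (e : Equiv.Perm ℕ) : stdVec a ∘ e = stdVec (e.symm a) := by
  ext j
  simp only [stdVec, Function.comp, Equiv.eq_symm_apply]

theorem simple_A (n : ℕ) (i : Fin n) : (fun j => CartanMatrix.A n j i) = vecA n (i, i + 1) := by
  ext j
  simp only [vecA, diffA, stdVec, Pi.sub_apply, CartanMatrix.A, Matrix.of_apply, Fin.ext_iff]
  split_ifs <;> omega

theorem neg_vecA (n a b : ℕ) : -vecA n (a, b) = vecA n (b, a) := by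
  ext j; simp [vecA, diffA]; ring

theorem isPosSystem_A (n : ℕ) : IsPosSystem (CartanMatrix.A n) (rootsA n) where
  zero h := by
    rw [rootsA, Finset.mem_image] at h
    obtain ⟨⟨a, b⟩, hp, h⟩ := h
    rw [mem_pairsLT] at hp
    have := diffA_inj (by omega) (by omega) (by omega)
      (show vecA n (a, b) = vecA n (b, a) by rw [← neg_vecA n a b, h, neg_zero])
    omega
  simple i := by
    rw [simple_A]
    exact Finset.mem_image_of_mem _ (mem_pairsLT.2 ⟨by simp, by simp⟩)
  neg_simple i := by
    rw [simple_A, neg_vecA, rootsA, Finset.mem_image]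
    rintro ⟨⟨a, b⟩, hp, h⟩
    rw [mem_pairsLT] at hp
    have := diffA_inj (by omega) (by omega) (by omega) h
    omega
  cone b hb := by
    obtain ⟨⟨a, b⟩, hp, rfl⟩ := Finset.mem_image.1 hb
    rw [mem_pairsLT] at hp
    obtain ⟨h1, h2⟩ := hp
    clear hb
    induction b, h1 using Nat.le_induction with
    | base =>
      have := cone_simple (CartanMatrix.A n) ⟨a, by simpa using h2⟩
      rwa [simple_A] at this
    | succ b hb ih =>
      have h3 := cone_simple (CartanMatrix.A n) ⟨b, by simpa using h2⟩
      rw [simple_A] at h3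
      have h4 := cone_add (ih (Nat.lt_of_succ_lt h2)) h3
      have h5 : vecA n (a, b + 1) = vecA n (a, b) + vecA n (b, b + 1) := by
        ext j; simp [vecA, diffA]; ring
      rw [h5]
      exact h4
  refl b hb i := by
    obtain ⟨⟨a, b⟩, hp, rfl⟩ := Finset.mem_image.1 hb
    rw [mem_pairsLT] at hp
    by_cases hab : a = i ∧ b = i + 1
    · left; rw [simple_A, hab.1, hab.2]
    · right
      have hi := i.2
      rw [vecA, diffA_swap, Pi.sub_comp, stdVec_comp, stdVec_comp, rootsA, Finset.mem_image]
      refine ⟨(Equiv.swap (i : ℕ) (i + 1) a, Equiv.swap (i : ℕ) (i + 1) b), ?_, rfl⟩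
      rw [mem_pairsLT]
      simp only [Equiv.swap_apply_def] at hp ⊢
      split_ifs <;> omega

theorem card_rootsA (n : ℕ) : 2 * (rootsA n).card = (n + 1) * n := by
  rw [rootsA, Finset.card_image_of_injOn, two_mul_card_pairsLT, Nat.add_sub_cancel]
  rintro ⟨a, b⟩ hp ⟨c, d⟩ hq h
  rw [Finset.mem_coe, mem_pairsLT] at hp hq
  simp only at hp hq
  have := diffA_inj (by omega) (by omega) (by omega) h
  exact Prod.ext this.1 this.2

end QData

namespace QData

/-! #### Type `D` -/

/-- The coordinates `⟨h_k, x⟩ = x_k - x_{k+1}`, and `x_{n-2} + x_{n-1}` for the last one. -/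
def diffD (n : ℕ) (x : ℕ → ℤ) : Fin n → ℤ :=
  fun k => if (k : ℕ) + 1 < n then x k - x (k + 1) else x (n - 2) + x (n - 1)

/-- The vector `e_a ± e_b`. -/
def vecD (n : ℕ) (p : (ℕ × ℕ) × ℤ) : Fin n → ℤ :=
  diffD n (stdVec p.1.1 + p.2 • stdVec p.1.2)

def rootsD (n : ℕ) : Finset (Fin n → ℤ) :=
  (pairsLT n ×ˢ ({1, -1} : Finset ℤ)).image (vecD n)

theorem mem_rootsD {n : ℕ} {v : Fin n → ℤ} :
    v ∈ rootsD n ↔ ∃ a b ε, a < b ∧ b < n ∧ (ε = 1 ∨ ε = -1) ∧ vecD n ((a, b), ε) = v := by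
  rw [rootsD, Finset.mem_image]
  constructor
  · rintro ⟨⟨⟨a, b⟩, ε⟩, h, rfl⟩
    rw [Finset.mem_product, mem_pairsLT, Finset.mem_insert, Finset.mem_singleton] at h
    exact ⟨a, b, ε, h.1.1, h.1.2, h.2, rfl⟩
  · rintro ⟨a, b, ε, h1, h2, h3, rfl⟩
    refine ⟨((a, b), ε), ?_, rfl⟩
    rw [Finset.mem_product, mem_pairsLT, Finset.mem_insert, Finset.mem_singleton]
    exact ⟨⟨h1, h2⟩, h3⟩

/-- Unlike in type A nothing is lost: the last two coordinates give the difference and the sum of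
the last two entries, and the remaining entries follow downwards. -/
theorem diffD_inj {n : ℕ} (hn : 2 ≤ n) {x y : ℕ → ℤ} (h : diffD n x = diffD n y) :
    ∀ k < n, x k = y k := by
  have h0 := congrFun h ⟨n - 1, by omega⟩
  have h1 := congrFun h ⟨n - 2, by omega⟩
  simp only [diffD] at h0 h1
  rw [if_neg (by omega), if_neg (by omega)] at h0
  rw [if_pos (by omega), if_pos (by omega), show n - 2 + 1 = n - 1 by omega] at h1
  have key : ∀ j, j < n → x (n - 1 - j) = y (n - 1 - j) := by
    intro j hj
    induction j with
    | zero => rw [Nat.sub_zero]; omega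
    | succ j ih =>
      have h2 := congrFun h ⟨n - 1 - (j + 1), by omega⟩
      simp only [diffD] at h2
      rw [if_pos (by omega), if_pos (by omega),
        show n - 1 - (j + 1) + 1 = n - 1 - j by omega] at h2
      have := ih (by omega)
      omega
  intro k hk
  have := key (n - 1 - k) (by omega)
  rwa [show n - 1 - (n - 1 - k) = k by omega] at this

theorem diffD_swap (n : ℕ) (hn : 3 ≤ n) (x : ℕ → ℤ) (k : Fin n) (hk : (k : ℕ) + 1 < n) :
    diffD n x - diffD n x k • (fun j => CartanMatrix.D n j k) =
      diffD n (x ∘ Equiv.swap (k : ℕ) (k + 1)) := by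
  have h1 : diffD n x k = x k - x (k + 1) := by simp only [diffD, if_pos hk]
  rw [h1]
  ext j
  have hj := j.2
  simp only [Pi.sub_apply, Pi.smul_apply, diffD, smul_eq_mul,
    Function.comp, Equiv.swap_apply_def]
  rcases lt_trichotomy ((j : ℕ) + 1) n with h | h | h
  · rw [if_pos h, if_pos h]
    by_cases e1 : (j : ℕ) = k
    · obtain rfl := Fin.ext e1
      simp [CartanMatrix.D]; ring
    · have e1' : j ≠ k := fun h => e1 (congrArg _ h)
      simp only [CartanMatrix.D, Matrix.of_apply, if_neg e1', if_neg e1]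
      by_cases e2 : (j : ℕ) + 1 = k
      · rw [← e2]; split_ifs <;> omega
      · by_cases e3 : (k : ℕ) + 1 = j
        · rw [← e3]; split_ifs <;> omega
        · split_ifs <;> omega
  · rw [if_neg (by omega), if_neg (by omega)]
    have e1' : j ≠ k := fun e => by subst e; omega
    simp only [CartanMatrix.D, Matrix.of_apply, if_neg e1']
    by_cases e2 : (k : ℕ) + 2 = n
    · have : n - 2 = k := by omega
      have h3 : n - 1 = k + 1 := by omega
      rw [this, h3]
      split_ifs <;> omega
    · by_cases e3 : (k : ℕ) + 3 = n
      · have : n - 2 = k + 1 := by omega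
        rw [this]
        split_ifs <;> omega
      · split_ifs <;> omega
  · omega

/-- The last simple reflection of type `D`, in standard coordinates. -/
def swapNeg (n : ℕ) (x : ℕ → ℤ) : ℕ → ℤ :=
  fun j => if j = n - 2 then -x (n - 1) else if j = n - 1 then -x (n - 2) else x j

theorem diffD_swapNeg (n : ℕ) (hn : 3 ≤ n) (x : ℕ → ℤ) (k : Fin n) (hk : (k : ℕ) + 1 = n) :
    diffD n x - diffD n x k • (fun j => CartanMatrix.D n j k) = diffD n (swapNeg n x) := by
  have h1 : diffD n x k = x (n - 2) + x (n - 1) := by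
    simp only [diffD, if_neg (show ¬ (k : ℕ) + 1 < n by omega)]
  rw [h1]
  ext j
  have hj := j.2
  simp only [Pi.sub_apply, Pi.smul_apply, diffD, smul_eq_mul, swapNeg]
  rcases lt_trichotomy ((j : ℕ) + 1) n with h | h | h
  · rw [if_pos h, if_pos h]
    have e1' : j ≠ k := fun e => by subst e; omega
    simp only [CartanMatrix.D, Matrix.of_apply, if_neg e1']
    by_cases e2 : (j : ℕ) + 2 = n
    · have e3 : n - 2 = j := by omega
      have e4 : n - 1 = j + 1 := by omega
      rw [e3, e4]
      split_ifs <;> omega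
    · by_cases e3 : (j : ℕ) + 3 = n
      · have : n - 2 = j + 1 := by omega
        rw [this]
        split_ifs <;> omega
      · split_ifs <;> omega
  · rw [if_neg (by omega), if_neg (by omega)]
    have e1 : j = k := Fin.ext (by omega)
    subst e1
    simp only [CartanMatrix.D_diag]
    split_ifs <;> omega
  · omega

theorem simple_D (n : ℕ) (hn : 3 ≤ n) (i : Fin n) :
    (fun j => CartanMatrix.D n j i) =
      if (i : ℕ) + 1 < n then vecD n ((i, i + 1), -1) else vecD n ((n - 2, n - 1), 1) := by
  ext j
  have hj := j.2
  have hi := i.2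
  simp only [CartanMatrix.D, Matrix.of_apply, Fin.ext_iff]
  by_cases h : (i : ℕ) + 1 < n
  · simp only [if_pos h, vecD, diffD, stdVec, Pi.add_apply, Pi.smul_apply, smul_eq_mul]
    split_ifs <;> omega
  · simp only [if_neg h, vecD, diffD, stdVec, Pi.add_apply, Pi.smul_apply, smul_eq_mul]
    split_ifs <;> omega

theorem cone_D (n : ℕ) (hn : 3 ≤ n) (i : ℕ) (hi : i + 1 < n) :
    ∃ c : Fin n → ℕ, vecD n ((i, i + 1), -1) = ∑ i, c i • (fun j => CartanMatrix.D n j i) := by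
  have := cone_simple (CartanMatrix.D n) ⟨i, by omega⟩
  rwa [simple_D n hn, if_pos (by simpa using hi)] at this

theorem cone_D_sub (n : ℕ) (hn : 3 ≤ n) (a b : ℕ) (hab : a ≤ b) (hb : b < n) :
    ∃ c : Fin n → ℕ, vecD n ((a, b), -1) = ∑ i, c i • (fun j => CartanMatrix.D n j i) := by
  induction b, hab using Nat.le_induction with
  | base =>
    refine ⟨0, ?_⟩
    ext j; simp [vecD, diffD]
  | succ b hb' ih =>
    have h := cone_add (ih (by omega)) (cone_D n hn b hb)
    have h5 : vecD n ((a, b + 1), -1) = vecD n ((a, b), -1) + vecD n ((b, b + 1), -1) := by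
      ext j; simp only [vecD, diffD, Pi.add_apply, Pi.smul_apply]; split_ifs <;> simp <;> ring
    rw [h5]
    exact h

theorem isPosSystem_D (n : ℕ) (hn : 3 ≤ n) : IsPosSystem (CartanMatrix.D n) (rootsD n) where
  zero h := by
    obtain ⟨a, b, ε, h1, h2, h3, h⟩ := mem_rootsD.1 h
    have e : (0 : Fin n → ℤ) = diffD n 0 := by ext j; simp [diffD]
    rw [e] at h
    have ha := diffD_inj (by omega) h a (by omega)
    simp only [Pi.add_apply, Pi.smul_apply, Pi.zero_apply, stdVec, smul_eq_mul] at ha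
    split_ifs at ha <;> omega
  simple i := by
    rw [simple_D n hn, mem_rootsD]
    split_ifs with h
    · exact ⟨i, i + 1, -1, by omega, by omega, by omega, rfl⟩
    · exact ⟨n - 2, n - 1, 1, by omega, by omega, by omega, rfl⟩
  neg_simple i := by
    rw [simple_D n hn, mem_rootsD]
    rintro ⟨a, b, ε, h1, h2, h3, h⟩
    split_ifs at h with hi
    · have e : -vecD n ((i, i + 1), -1) = diffD n (-stdVec i + stdVec (i + 1)) := by
        ext j; simp only [vecD, diffD, Pi.add_apply, Pi.smul_apply, Pi.neg_apply]
        split_ifs <;> simp <;> ring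
      rw [e] at h
      have ha := diffD_inj (by omega) h a (by omega)
      have hi' := diffD_inj (by omega) h i (by omega)
      simp only [Pi.add_apply, Pi.smul_apply, Pi.neg_apply, stdVec, smul_eq_mul] at ha hi'
      split_ifs at ha hi' <;> omega
    · have e : -vecD n ((n - 2, n - 1), 1) = diffD n (-stdVec (n - 2) - stdVec (n - 1)) := by
        ext j; simp only [vecD, diffD, Pi.add_apply, Pi.sub_apply, Pi.smul_apply, Pi.neg_apply]
        split_ifs <;> simp <;> ring
      rw [e] at h
      have ha := diffD_inj (by omega) h a (by omega)
      simp only [Pi.add_apply, Pi.sub_apply, Pi.smul_apply, Pi.neg_apply, stdVec,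
        smul_eq_mul] at ha
      split_ifs at ha <;> omega
  cone v hv := by
    obtain ⟨a, b, ε, h1, h2, h3, rfl⟩ := mem_rootsD.1 hv
    rcases h3 with rfl | rfl
    -- Since a < b < n, both a ≤ n - 2 and b ≤ n - 1, so the first two summands are zero or sums of
    -- simple roots and the third is the last simple root.
    · have e : vecD n ((a, b), 1) = vecD n ((a, n - 2), -1) + vecD n ((b, n - 1), -1) +
          vecD n ((n - 2, n - 1), 1) := by
        ext j; simp only [vecD, diffD, Pi.add_apply, Pi.smul_apply]; split_ifs <;> simp <;> ring
      have h4 := cone_simple (CartanMatrix.D n) ⟨n - 1, by omega⟩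
      rw [simple_D n hn, if_neg (by simp only; omega)] at h4
      rw [e]
      exact cone_add (cone_add (cone_D_sub n hn a (n - 2) (by omega) (by omega))
        (cone_D_sub n hn b (n - 1) (by omega) (by omega))) h4
    · exact cone_D_sub n hn a b h1.le h2
  refl v hv i := by
    obtain ⟨a, b, ε, h1, h2, h3, rfl⟩ := mem_rootsD.1 hv
    have hi := i.2
    rcases lt_or_ge ((i : ℕ) + 1) n with h | h
    · by_cases hab : a = i ∧ b = i + 1 ∧ ε = -1
      · left; rw [simple_D n hn, if_pos h, hab.1, hab.2.1, hab.2.2]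
      · right
        rw [vecD, diffD_swap n hn _ _ h, Pi.add_comp, Pi.smul_comp, stdVec_comp, stdVec_comp,
          Equiv.symm_swap, mem_rootsD]
        simp only
        by_cases hab' : a = i ∧ b = i + 1
        · obtain ⟨rfl, rfl⟩ := hab'
          refine ⟨i, i + 1, ε, h1, h2, h3, ?_⟩
          have : ε = 1 := by tauto
          subst this
          simp [vecD, add_comm]
        · refine ⟨Equiv.swap (i : ℕ) (i + 1) a, Equiv.swap (i : ℕ) (i + 1) b, ε, ?_, ?_, h3, rfl⟩
          · simp only [Equiv.swap_apply_def]; split_ifs <;> omega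
          · simp only [Equiv.swap_apply_def]; split_ifs <;> omega
    · have e : ∀ w x, (∀ j, swapNeg n w j = x j) → swapNeg n w = x := fun w x h => funext h
      by_cases hab : a = n - 2 ∧ b = n - 1 ∧ ε = 1
      · left; rw [simple_D n hn, if_neg (by omega), hab.1, hab.2.1, hab.2.2]
      · right
        rw [vecD, diffD_swapNeg n hn _ _ (by omega), mem_rootsD]
        simp only
        by_cases hb1 : b < n - 2
        · refine ⟨a, b, ε, h1, h2, h3, ?_⟩
          rw [vecD, e _ _ fun j => ?_]
          simp only [swapNeg, stdVec, Pi.add_apply, Pi.smul_apply, smul_eq_mul]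
          split_ifs <;> omega
        · by_cases ha1 : a = n - 2
          · refine ⟨a, b, ε, h1, h2, h3, ?_⟩
            rw [vecD, e _ _ fun j => ?_]
            simp only [swapNeg, stdVec, Pi.add_apply, Pi.smul_apply, smul_eq_mul]
            split_ifs <;> omega
          -- Here b is n - 2 or n - 1 and a < n - 2; `2 * n - 3 - b` is the other of the two
          -- indices, and the last reflection exchanges e_{n-2} with -e_{n-1}.
          · refine ⟨a, 2 * n - 3 - b, -ε, by omega, by omega, by omega, ?_⟩
            rw [vecD, e _ _ fun j => ?_]
            simp only [swapNeg, stdVec, Pi.add_apply, Pi.smul_apply, smul_eq_mul]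
            split_ifs <;> omega

theorem card_rootsD (n : ℕ) (hn : 3 ≤ n) : (rootsD n).card = n * (n - 1) := by
  rw [rootsD, Finset.card_image_of_injOn, Finset.card_product, mul_comm, ← two_mul_card_pairsLT]
  · rfl
  · rintro ⟨⟨a, b⟩, ε⟩ hp ⟨⟨c, d⟩, δ⟩ hq h
    rw [Finset.mem_coe, Finset.mem_product, mem_pairsLT, Finset.mem_insert,
      Finset.mem_singleton] at hp hq
    simp only at hp hq
    have h1 := diffD_inj (by omega) h a (by omega)
    have h2 := diffD_inj (by omega) h b (by omega)
    have h3 := diffD_inj (by omega) h c (by omega)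
    simp only [Pi.add_apply, Pi.smul_apply, stdVec, smul_eq_mul] at h1 h2 h3
    have : a = c ∧ b = d ∧ ε = δ := by split_ifs at h1 h2 h3 <;> omega
    rw [this.1, this.2.1, this.2.2]

end QData

namespace QData

/-! #### Type `E` -/

/-- The positive roots of type `E_8`; the decimal digits are the coefficients of the simple
roots. Those of `E_7` and `E_6` are the ones that end in one resp. two zeros. -/
def codesE : List ℕ :=
  [1, 10, 11, 100, 110, 111, 1000, 1100, 1110, 1111, 10000, 11000, 11100, 11110, 11111,
   100000, 110000, 111000, 111100, 111110, 111111, 1000000, 1010000, 1011000, 1011100,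
   1011110, 1011111, 1110000, 1111000, 1111100, 1111110, 1111111, 1121000, 1121100, 1121110,
   1121111, 1122100, 1122110, 1122111, 1122210, 1122211, 1122221, 10000000, 10100000,
   10110000, 10111000, 10111100, 10111110, 10111111, 11110000, 11111000, 11111100, 11111110,
   11111111, 11121000, 11121100, 11121110, 11121111, 11122100, 11122110, 11122111, 11122210,
   11122211, 11122221, 11221000, 11221100, 11221110, 11221111, 11222100, 11222110, 11222111,
   11222210, 11222211, 11222221, 11232100, 11232110, 11232111, 11232210, 11232211, 11232221,
   11233210, 11233211, 11233221, 11233321, 12232100, 12232110, 12232111, 12232210, 12232211,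
   12232221, 12233210, 12233211, 12233221, 12233321, 12243210, 12243211, 12243221, 12243321,
   12244321, 12343210, 12343211, 12343221, 12343321, 12344321, 12354321, 13354321, 22343210,
   22343211, 22343221, 22343321, 22344321, 22354321, 22454321, 23354321, 23454321, 23464321,
   23465321, 23465421, 23465431, 23465432]

/-- The coefficient of the `i`-th simple root. -/
def digitE (c i : ℕ) : ℕ := c / 10 ^ (7 - i) % 10

/-- The codes of the positive roots supported on the first `m` vertices. -/
def subCodesE (m : ℕ) : List ℕ := codesE.filter fun c => c % 10 ^ (8 - m) = 0

def vecE {m : ℕ} (C : Matrix (Fin m) (Fin m) ℤ) (c : ℕ) : Fin m → ℤ :=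
  ∑ i : Fin m, digitE c i • (fun j => C j i)

def rootsE {m : ℕ} (C : Matrix (Fin m) (Fin m) ℤ) : Finset (Fin m → ℤ) :=
  (subCodesE m).toFinset.image (vecE C)

/-- The value of the `i`-th coroot on the root with code `c`. -/
def pairE {m : ℕ} (C : Matrix (Fin m) (Fin m) ℤ) (c : ℕ) (i : Fin m) : ℤ :=
  ∑ j : Fin m, digitE c j * C i j

/-- The code of the image of the root with code `c` under the `i`-th simple reflection. -/
def reflE {m : ℕ} (C : Matrix (Fin m) (Fin m) ℤ) (c : ℕ) (i : Fin m) : ℕ :=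
  (c - pairE C c i * 10 ^ (7 - (i : ℕ))).toNat

/-- The list of codes is closed under the simple reflections, up to sign. -/
def ClosedE {m : ℕ} (C : Matrix (Fin m) (Fin m) ℤ) : Prop :=
  (∀ i : Fin m, 10 ^ (7 - (i : ℕ)) ∈ subCodesE m ∧
    ∀ j : Fin m, digitE (10 ^ (7 - (i : ℕ))) j = if j = i then 1 else 0) ∧
  (0 ∉ subCodesE m ∧ ∀ c ∈ subCodesE m, c = ∑ j : Fin m, digitE c j * 10 ^ (7 - (j : ℕ))) ∧
  ∀ c ∈ subCodesE m, ∀ i : Fin m, c = 10 ^ (7 - (i : ℕ)) ∨ reflE C c i ∈ subCodesE m ∧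
    ∀ j : Fin m, (digitE (reflE C c i) j : ℤ) = digitE c j - if j = i then pairE C c i else 0

instance {m : ℕ} (C : Matrix (Fin m) (Fin m) ℤ) : Decidable (ClosedE C) :=
  inferInstanceAs (Decidable (_ ∧ _))

theorem closedE_6 : ClosedE CartanMatrix.E₆ := by decide +kernel
theorem closedE_7 : ClosedE CartanMatrix.E₇ := by decide +kernel
theorem closedE_8 : ClosedE CartanMatrix.E₈ := by decide +kernel

/-- Pairing with x, the coefficient vector of the sum of the positive roots, gives twice the height
of a root. Nonnegative digits thus give a nonnegative height, which vanishes only for the zero code,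
while a negative simple root has pairing -2. All else is the finite check `ClosedE`. -/
theorem isPosSystem_E {m : ℕ} (C : Matrix (Fin m) (Fin m) ℤ) (h : ClosedE C) (x : Fin m → ℤ)
    (hx : ∀ i, ∑ j, x j * C j i = 2) : IsPosSystem C (rootsE C) := by
  have hs : ∀ i : Fin m, vecE C (10 ^ (7 - (i : ℕ))) = fun j => C j i := by
    intro i
    simp only [vecE, (h.1 i).2, ite_smul, one_smul, zero_smul, Finset.sum_ite_eq',
      Finset.mem_univ, if_true]
  have hm : ∀ {v}, v ∈ rootsE C ↔ ∃ c ∈ subCodesE m, vecE C c = v := by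
    intro v
    simp only [rootsE, Finset.mem_image, List.mem_toFinset]
  have hsum : ∀ c : Fin m → ℕ, ∑ j, x j * (∑ i, c i • (fun j => C j i) : Fin m → ℤ) j =
      ∑ i, (c i : ℤ) * 2 := by
    intro c
    simp only [Finset.sum_apply, Pi.smul_apply]
    simp only [nsmul_eq_mul, Finset.mul_sum]
    rw [Finset.sum_comm]
    refine Finset.sum_congr rfl fun i _ => ?_
    rw [← hx i, Finset.mul_sum]
    exact Finset.sum_congr rfl fun j _ => by ring
  refine ⟨fun h0 => ?_, fun i => hm.2 ⟨_, (h.1 i).1, hs i⟩, fun i hi => ?_, fun b hb => ?_, fun b hb i => ?_⟩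
  · obtain ⟨c, hc, hc0⟩ := hm.1 h0
    have h1 := hsum fun i => digitE c i
    rw [← vecE, hc0] at h1
    simp only [Pi.zero_apply, mul_zero, Finset.sum_const_zero] at h1
    have h2 : ∀ i : Fin m, digitE c i = 0 := fun i => by
      have := (Finset.sum_eq_zero_iff_of_nonneg (fun i _ => by positivity)).1 h1.symm i
        (Finset.mem_univ i)
      omega
    have h3 := h.2.1.2 c hc
    simp only [h2, zero_mul, Finset.sum_const_zero] at h3
    exact h.2.1.1 (h3 ▸ hc)
  · obtain ⟨c, -, hc⟩ := hm.1 hi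
    have h1 := hsum fun i => digitE c i
    have h2 : ∑ j, x j * vecE C c j = -2 := by
      rw [hc, ← hx i, ← Finset.sum_neg_distrib]
      exact Finset.sum_congr rfl fun j _ => by simp
    rw [← vecE, h2] at h1
    have h3 : 0 ≤ ∑ i : Fin m, (digitE c i : ℤ) * 2 := Finset.sum_nonneg fun i _ => by positivity
    omega
  · obtain ⟨c, -, rfl⟩ := hm.1 hb
    exact ⟨_, rfl⟩
  · obtain ⟨c, hc, rfl⟩ := hm.1 hb
    rcases h.2.2 c hc i with h1 | ⟨h1, h2⟩
    · left; rw [h1, hs]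
    · right
      refine hm.2 ⟨_, h1, ?_⟩
      have hp : vecE C c i = pairE C c i := by
        simp only [vecE, pairE, Finset.sum_apply, Pi.smul_apply]
        simp only [nsmul_eq_mul]
      have e : ∀ c, vecE C c = ∑ j : Fin m, (digitE c j : ℤ) • (fun k => C k j) := fun c => by
        simp only [vecE, natCast_zsmul]
      rw [hp, e, e]
      simp only [h2, sub_smul, Finset.sum_sub_distrib, ite_smul, zero_smul, Finset.sum_ite_eq',
        Finset.mem_univ, if_true]

/-- The Cartan matrix is invertible, so a root determines its digits, and the digits determine the
code. -/
theorem card_rootsE {m : ℕ} (C : Matrix (Fin m) (Fin m) ℤ) (h : ClosedE C) (hC : C.det ≠ 0) :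
    (rootsE C).card = (subCodesE m).toFinset.card := by
  refine Finset.card_image_of_injOn fun c hc d hd hcd => ?_
  rw [Finset.mem_coe, List.mem_toFinset] at hc hd
  have e : ∀ c, vecE C c = C.mulVec fun j => (digitE c j : ℤ) := fun c => by
    ext k
    simp only [vecE, Matrix.mulVec, dotProduct, Finset.sum_apply, Pi.smul_apply]
    simp only [nsmul_eq_mul, mul_comm]
  have h1 : C.mulVec ((fun j : Fin m => (digitE c j : ℤ)) - fun j : Fin m => (digitE d j : ℤ)) = 0 := by
    rw [Matrix.mulVec_sub, ← e, ← e, hcd, sub_self]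
  have h2 := Matrix.eq_zero_of_mulVec_eq_zero hC h1
  rw [h.2.1.2 c hc, h.2.1.2 d hd]
  refine Finset.sum_congr rfl fun j _ => ?_
  have := congrFun h2 j
  simp only [Pi.sub_apply, Pi.zero_apply] at this
  rw [show digitE c j = digitE d j by omega]

/-! ### The positive roots of `g_fin` -/

/-- The set of positive roots of `g_fin`. -/
def posRoots : (g : AffineType) → Finset (Weight g)
  | .A n _ => rootsA n
  | .B n _ => rootsA (2 * n - 1)
  | .C n _ => rootsD (n + 1)
  | .D n _ => rootsD n
  | .E6 => rootsE CartanMatrix.E₆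
  | .E7 => rootsE CartanMatrix.E₇
  | .E8 => rootsE CartanMatrix.E₈
  | .F4 => rootsE CartanMatrix.E₆
  | .G2 => rootsD 4

theorem isPosSystem : ∀ g : AffineType, IsPosSystem (cartan g) (posRoots g)
  | .A n _ => isPosSystem_A n
  | .B n _ => isPosSystem_A (2 * n - 1)
  | .C n _ => isPosSystem_D (n + 1) (by omega)
  | .D n _ => isPosSystem_D n (by omega)
  | .E6 => isPosSystem_E _ closedE_6 ![16, 22, 30, 42, 30, 16] (by decide)
  | .E7 => isPosSystem_E _ closedE_7 ![34, 49, 66, 96, 75, 52, 27] (by decide)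
  | .E8 => isPosSystem_E _ closedE_8 ![92, 136, 182, 270, 220, 168, 114, 58] (by decide)
  | .F4 => isPosSystem_E _ closedE_6 ![16, 22, 30, 42, 30, 16] (by decide)
  | .G2 => isPosSystem_D 4 (by omega)

theorem card_rootsE_6 : (rootsE CartanMatrix.E₆).card = 36 := by
  rw [card_rootsE _ closedE_6 (by rw [CartanMatrix.E₆_det]; norm_num)]
  decide +kernel

theorem card_rootsE_7 : (rootsE CartanMatrix.E₇).card = 63 := by
  rw [card_rootsE _ closedE_7 (by rw [CartanMatrix.E₇_det]; norm_num)]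
  decide +kernel

theorem card_rootsE_8 : (rootsE CartanMatrix.E₈).card = 120 := by
  rw [card_rootsE _ closedE_8 (by rw [CartanMatrix.E₈_det]; norm_num)]
  decide +kernel

end QData

namespace QData

/-! ### The Dynkin diagram and its automorphism -/

theorem cartan_symm (g : AffineType) (i j : Vertex g) : cartan g i j = cartan g j i := by
  cases g with
  | A n hn => exact (CartanMatrix.A_isSymm n).apply j i
  | B n hn => exact (CartanMatrix.A_isSymm _).apply j i
  | C n hn => exact (CartanMatrix.D_isSymm _).apply j i
  | D n hn => exact (CartanMatrix.D_isSymm n).apply j i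
  | E6 => exact CartanMatrix.E₆_isSymm.apply j i
  | E7 => exact CartanMatrix.E₇_isSymm.apply j i
  | E8 => exact CartanMatrix.E₈_isSymm.apply j i
  | F4 => exact CartanMatrix.E₆_isSymm.apply j i
  | G2 => exact (CartanMatrix.D_isSymm 4).apply j i

theorem cartan_offdiag (g : AffineType) {i j : Vertex g} (h : i ≠ j) :
    cartan g i j = 0 ∨ cartan g i j = -1 := by
  cases g with
  | A n hn => exact CartanMatrix.isSimplyLaced_A n h
  | B n hn => exact CartanMatrix.isSimplyLaced_A _ h
  | C n hn => exact CartanMatrix.isSimplyLaced_D _ h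
  | D n hn => exact CartanMatrix.isSimplyLaced_D n h
  | E6 => exact CartanMatrix.isSimplyLaced_E₆ h
  | E7 => exact CartanMatrix.isSimplyLaced_E₇ h
  | E8 => exact CartanMatrix.isSimplyLaced_E₈ h
  | F4 => exact CartanMatrix.isSimplyLaced_E₆ h
  | G2 => exact CartanMatrix.isSimplyLaced_D 4 h

theorem D_apply {n : ℕ} (hn : 3 ≤ n) (i j : Fin n) :
    CartanMatrix.D n i j = if (i : ℕ) = j then 2 else
      if (i : ℕ) + 1 = j ∧ (j : ℕ) + 2 < n ∨ (j : ℕ) + 1 = i ∧ (i : ℕ) + 2 < n ∨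
        (i : ℕ) + 3 = n ∧ ((j : ℕ) + 2 = n ∨ (j : ℕ) + 1 = n) ∨
        (j : ℕ) + 3 = n ∧ ((i : ℕ) + 2 = n ∨ (i : ℕ) + 1 = n) then -1 else 0 := by
  simp only [CartanMatrix.D, Matrix.of_apply, Fin.ext_iff]
  split_ifs <;> omega

theorem cartan_D_swap (n : ℕ) (hn : 3 ≤ n) (i j : Fin (n + 1)) :
    CartanMatrix.D (n + 1) (Equiv.swap ⟨n - 1, by omega⟩ ⟨n, by omega⟩ i)
      (Equiv.swap ⟨n - 1, by omega⟩ ⟨n, by omega⟩ j) = CartanMatrix.D (n + 1) i j := by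
  have hv : ∀ k : Fin (n + 1), ∃ a : ℕ, ((Equiv.swap (⟨n - 1, by omega⟩ : Fin (n + 1))
      ⟨n, by omega⟩ k : Fin (n + 1)) : ℕ) = a ∧ ((k : ℕ) < n - 1 ∧ a = k ∨
        (k : ℕ) = n - 1 ∧ a = n ∨ (k : ℕ) = n ∧ a = n - 1) := by
    intro k
    rw [Equiv.swap_apply_def]
    simp only [Fin.ext_iff]
    refine ⟨_, rfl, ?_⟩
    have hk := k.2
    split_ifs with h1 h2
    · exact Or.inr (Or.inl ⟨h1, rfl⟩)
    · exact Or.inr (Or.inr ⟨h2, rfl⟩)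
    · exact Or.inl ⟨by omega, rfl⟩
  obtain ⟨a, ha, ha'⟩ := hv i
  obtain ⟨b, hb, hb'⟩ := hv j
  rw [D_apply (by omega), D_apply (by omega), ha, hb]
  congr 1
  · exact propext (by omega)
  · congr 1
    exact propext (by omega)

theorem cartan_sigma (g : AffineType) (i j : Vertex g) :
    cartan g (sigma g i) (sigma g j) = cartan g i j := by
  cases g with
  | A n hn => rfl
  | B n hn =>
    have hi := i.2
    have hj := j.2
    simp only [rank] at hi hj
    simp only [cartan, sigma, CartanMatrix.A, Matrix.of_apply, Fin.revPerm_apply, Fin.ext_iff,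
      Fin.val_rev]
    split_ifs <;> omega
  | C n hn => exact cartan_D_swap n hn i j
  | D n hn => rfl
  | E6 => rfl
  | E7 => rfl
  | E8 => rfl
  | F4 =>
    have h : CartanMatrix.E₆.submatrix (Equiv.swap 0 5 * Equiv.swap 2 4 : Equiv.Perm (Fin 6))
      (Equiv.swap 0 5 * Equiv.swap 2 4 : Equiv.Perm (Fin 6)) = CartanMatrix.E₆ := by decide
    exact congrFun (congrFun h i) j
  | G2 =>
    have h : (CartanMatrix.D 4).submatrix (Equiv.swap 0 2 * Equiv.swap 2 3 : Equiv.Perm (Fin 4))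
      (Equiv.swap 0 2 * Equiv.swap 2 3 : Equiv.Perm (Fin 4)) = CartanMatrix.D 4 := by decide
    exact congrFun (congrFun h i) j

/-- The automorphism is trivial or of prime order, so every orbit has size 1 or ord(σ); this
dichotomy replaces most distinctions by type later on. -/
theorem exists_prime_pow_sigma (g : AffineType) : ∃ p : ℕ, p.Prime ∧ sigma g ^ p = 1 := by
  cases g with
  | A n hn => exact ⟨2, Nat.prime_two, one_pow _⟩
  | B n hn =>
    refine ⟨2, Nat.prime_two, ?_⟩
    ext i
    simp [sigma, pow_two]
  | C n hn =>
    refine ⟨2, Nat.prime_two, ?_⟩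
    rw [pow_two]
    exact Equiv.swap_mul_self _ _
  | D n hn => exact ⟨2, Nat.prime_two, one_pow _⟩
  | E6 => exact ⟨2, Nat.prime_two, one_pow _⟩
  | E7 => exact ⟨2, Nat.prime_two, one_pow _⟩
  | E8 => exact ⟨2, Nat.prime_two, one_pow _⟩
  | F4 => exact ⟨2, Nat.prime_two, by decide⟩
  | G2 => exact ⟨3, Nat.prime_three, by decide⟩

theorem exists_sigma_fixed (g : AffineType) : ∃ i, sigma g i = i := by
  cases g with
  | A n hn => exact ⟨⟨0, hn⟩, rfl⟩
  | B n hn =>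
    refine ⟨⟨n - 1, show n - 1 < 2 * n - 1 by omega⟩, ?_⟩
    apply Fin.ext
    simp only [sigma, Fin.revPerm_apply, Fin.val_rev, rank]
    omega
  | C n hn =>
    refine ⟨⟨0, show 0 < n + 1 by omega⟩, Equiv.swap_apply_of_ne_of_ne ?_ ?_⟩
    all_goals exact fun h => by have := congrArg Fin.val h; simp only at this; omega
  | D n hn => exact ⟨⟨0, show 0 < n by omega⟩, rfl⟩
  | E6 => exact ⟨0, rfl⟩
  | E7 => exact ⟨0, rfl⟩
  | E8 => exact ⟨0, rfl⟩
  | F4 => exact ⟨1, by decide⟩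
  | G2 => exact ⟨1, by decide⟩

/-- `d_i` is the period of `i` under `σ`. -/
theorem dd_eq_minimalPeriod (g : AffineType) (i : Vertex g) :
    dd g i = Function.minimalPeriod (sigma g) i := by
  have hper : i ∈ Function.periodicPts (sigma g) :=
    (sigma g).injective.mem_periodicPts i
  have hpos := Function.minimalPeriod_pos_of_mem_periodicPts hper
  have h : Function.Bijective (fun k : Fin (Function.minimalPeriod (sigma g) i) =>
      (⟨(sigma g)^[k] i, ⟨k, by rw [zpow_natCast, Equiv.Perm.iterate_eq_pow]⟩⟩ :
        {j : Vertex g // (sigma g).SameCycle i j})) := by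
    constructor
    · intro a b hab
      have := Function.iterate_injOn_Iio_minimalPeriod (f := sigma g) (x := i) a.2 b.2
        (congrArg Subtype.val hab)
      exact Fin.ext this
    · rintro ⟨j, hj⟩
      obtain ⟨k, -, hk⟩ := hj.exists_pow_eq'
      refine ⟨⟨k % _, Nat.mod_lt _ hpos⟩, Subtype.ext ?_⟩
      simp only [Function.iterate_mod_minimalPeriod_eq]
      rw [← hk, Equiv.Perm.iterate_eq_pow]
  rw [dd, ← Nat.card_eq_of_bijective _ h, Nat.card_fin]

theorem dd_pos (g : AffineType) (i : Vertex g) : 0 < dd g i := by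
  rw [dd_eq_minimalPeriod]
  exact Function.minimalPeriod_pos_of_mem_periodicPts ((sigma g).injective.mem_periodicPts i)

theorem sigma_pow_eq_self_iff (g : AffineType) (i : Vertex g) (k : ℕ) :
    (sigma g ^ k) i = i ↔ dd g i ∣ k := by
  rw [dd_eq_minimalPeriod, ← Function.isPeriodicPt_iff_minimalPeriod_dvd, Function.IsPeriodicPt,
    Function.IsFixedPt, Equiv.Perm.iterate_eq_pow]

theorem sigma_pow_dd (g : AffineType) (i : Vertex g) : (sigma g ^ dd g i) i = i :=
  (sigma_pow_eq_self_iff g i _).2 dvd_rfl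

theorem dd_of_fixed (g : AffineType) {i : Vertex g} (h : sigma g i = i) : dd g i = 1 :=
  Nat.dvd_one.1 ((sigma_pow_eq_self_iff g i 1).1 (by rwa [pow_one]))

theorem dd_of_not_fixed (g : AffineType) {i : Vertex g} (h : sigma g i ≠ i) :
    dd g i = ordSigma g := by
  obtain ⟨p, hp, h1⟩ := exists_prime_pow_sigma g
  have h2 : dd g i = p := by
    refine ((Nat.dvd_prime hp).1 ((sigma_pow_eq_self_iff g i p).1 (by rw [h1]; rfl))).resolve_left
      fun h2 => h ?_
    rw [← pow_one (sigma g), sigma_pow_eq_self_iff, h2]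
  have : Fact p.Prime := ⟨hp⟩
  rw [h2, ordSigma, orderOf_eq_prime h1]
  intro h3
  exact h (by rw [h3]; rfl)

theorem ordSigma_pos (g : AffineType) : 0 < ordSigma g := orderOf_pos _

theorem dd_eq_one_or (g : AffineType) (i : Vertex g) : dd g i = 1 ∨ dd g i = ordSigma g := by
  by_cases h : sigma g i = i
  · exact Or.inl (dd_of_fixed g h)
  · exact Or.inr (dd_of_not_fixed g h)

theorem sigma_eq_of_dd (g : AffineType) {i : Vertex g} (h : dd g i = 1) : sigma g i = i := by
  have := sigma_pow_dd g i
  rwa [h, pow_one] at this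

theorem dd_dvd_ordSigma (g : AffineType) (i : Vertex g) : dd g i ∣ ordSigma g := by
  rcases dd_eq_one_or g i with h | h
  · rw [h]; exact one_dvd _
  · rw [h]

theorem dd_le_ordSigma (g : AffineType) (i : Vertex g) : dd g i ≤ ordSigma g :=
  Nat.le_of_dvd (ordSigma_pos g) (dd_dvd_ordSigma g i)

theorem sameCycle_iff (g : AffineType) {i j : Vertex g} :
    (sigma g).SameCycle i j ↔ ∃ k < dd g i, (sigma g ^ k) i = j := by
  constructor
  · intro h
    obtain ⟨k, -, hk⟩ := h.exists_pow_eq'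
    refine ⟨k % dd g i, Nat.mod_lt _ (dd_pos g i), ?_⟩
    rw [← hk, dd_eq_minimalPeriod, ← Equiv.Perm.iterate_eq_pow, ← Equiv.Perm.iterate_eq_pow,
      Function.iterate_mod_minimalPeriod_eq]
  · rintro ⟨k, -, rfl⟩
    exact ⟨k, by rw [zpow_natCast]⟩

theorem dd_of_sameCycle (g : AffineType) {i j : Vertex g} (h : (sigma g).SameCycle i j) :
    dd g j = dd g i := by
  exact Nat.card_congr (Equiv.subtypeEquivRight fun k =>
    ⟨fun h' => h.trans h', fun h' => h.symm.trans h'⟩)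

theorem dd_sigma (g : AffineType) (i : Vertex g) : dd g (sigma g i) = dd g i :=
  dd_of_sameCycle g ⟨1, by simp⟩

theorem adj_symm (g : AffineType) {i j : Vertex g} (h : Adj g i j) : Adj g j i :=
  ⟨h.1.symm, by rw [cartan_symm]; exact h.2⟩

theorem adj_sigma (g : AffineType) {i j : Vertex g} :
    Adj g (sigma g i) (sigma g j) ↔ Adj g i j := by
  simp only [Adj, cartan_sigma, ne_eq, (sigma g).injective.eq_iff]

theorem cartan_of_adj (g : AffineType) {i j : Vertex g} (h : Adj g i j) : cartan g i j = -1 :=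
  (cartan_offdiag g h.1).resolve_left h.2

/-! ### Connectedness -/

theorem chain_induction {n : ℕ} {p : Fin n → Prop} (i₀ : Fin n) (h0 : p i₀)
    (up : ∀ i j : Fin n, (i : ℕ) + 1 = j → i₀ ≤ i → p i → p j)
    (down : ∀ i j : Fin n, (j : ℕ) + 1 = i → i ≤ i₀ → p i → p j) : ∀ i, p i := by
  have hup : ∀ (k : ℕ) (hk : (i₀ : ℕ) + k < n), p ⟨i₀ + k, hk⟩ := by
    intro k
    induction k with
    | zero => exact fun _ => h0
    | succ k ih => exact fun hk => up _ _ rfl (by simp [Fin.le_def]) (ih (by omega))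
  have hdown : ∀ (k : ℕ) (_ : k ≤ (i₀ : ℕ)), p ⟨i₀ - k, by omega⟩ := by
    intro k
    induction k with
    | zero => exact fun _ => h0
    | succ k ih =>
      exact fun hk => down ⟨i₀ - k, by omega⟩ _ (by simp only; omega) (by simp [Fin.le_def])
        (ih (by omega))
  intro i
  rcases le_total i₀ i with h | h
  · have := hup (i - i₀) (by omega)
    rwa [show (⟨(i₀ : ℕ) + (i - i₀), by omega⟩ : Fin n) = i from Fin.ext (by
      simp only; rw [Fin.le_def] at h; omega)] at this
  · have := hdown (i₀ - i) (by omega)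
    rwa [show (⟨(i₀ : ℕ) - (i₀ - i), by omega⟩ : Fin n) = i from Fin.ext (by
      simp only; rw [Fin.le_def] at h; omega)] at this

theorem adj_A {n : ℕ} {i j : Fin n} (h : (i : ℕ) + 1 = j ∨ (j : ℕ) + 1 = i) :
    i ≠ j ∧ CartanMatrix.A n i j ≠ 0 := by
  have h1 : i ≠ j := fun e => by subst e; omega
  refine ⟨h1, ?_⟩
  simp [CartanMatrix.A, h1, h]

theorem adj_D {n : ℕ} (hn : 3 ≤ n) {i j : Fin n} (h : (i : ℕ) + 1 = j ∧ (j : ℕ) + 2 < n ∨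
    (j : ℕ) + 1 = i ∧ (i : ℕ) + 2 < n ∨ (i : ℕ) + 3 = n ∧ ((j : ℕ) + 2 = n ∨ (j : ℕ) + 1 = n) ∨
    (j : ℕ) + 3 = n ∧ ((i : ℕ) + 2 = n ∨ (i : ℕ) + 1 = n)) :
    i ≠ j ∧ CartanMatrix.D n i j ≠ 0 := by
  have h1 : i ≠ j := fun e => by subst e; omega
  refine ⟨h1, ?_⟩
  rw [D_apply hn, if_neg (Fin.val_ne_of_ne h1), if_pos h]
  norm_num

/-- Everything is routed through the branch vertex n - 3: the property is first carried there and
then outwards. -/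
theorem D_induction {n : ℕ} (hn : 3 ≤ n) {p : Fin n → Prop} (i₀ : Fin n) (h0 : p i₀)
    (step : ∀ i j : Fin n, (i ≠ j ∧ CartanMatrix.D n i j ≠ 0) → p i → p j) : ∀ i, p i := by
  have h1 : p ⟨n - 3, by omega⟩ := by
    by_cases hi : (i₀ : ℕ) + 2 < n
    · have : ∀ k, ∀ hk : (i₀ : ℕ) + k + 2 < n, p ⟨i₀ + k, by omega⟩ := by
        intro k
        induction k with
        | zero => exact fun _ => h0
        | succ k ih =>
          exact fun hk => step _ _ (adj_D hn (by simp only; omega)) (ih (by omega))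
      convert this (n - 3 - i₀) (by omega) using 2
      omega
    · exact step _ _ (adj_D hn (by simp only; omega)) h0
  have h2 : ∀ k, ∀ hk : k ≤ n - 3, p ⟨n - 3 - k, by omega⟩ := by
    intro k
    induction k with
    | zero => exact fun _ => h1
    | succ k ih =>
      exact fun hk => step _ _ (adj_D hn (by simp only; omega)) (ih (by omega))
  intro i
  by_cases hi : (i : ℕ) + 2 < n
  · convert h2 (n - 3 - i) (by omega) using 1
    exact Fin.ext (by simp only; omega)
  · exact step _ _ (adj_D hn (by simp only; omega)) h1

theorem iff_induction {α : Type*} {p : α → Prop} {R : α → α → Prop} (hR : ∀ i j, R i j → R j i)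
    (step : ∀ i j, R i j → p i → p j) {i j : α} (h : R i j) : p i ↔ p j :=
  ⟨step i j h, step j i (hR i j h)⟩

theorem connected_induction (g : AffineType) {p : Vertex g → Prop} (i₀ : Vertex g) (h0 : p i₀)
    (step : ∀ i j, Adj g i j → p i → p j) : ∀ i, p i := by
  have e : ∀ {i j}, Adj g i j → (p i ↔ p j) := iff_induction (fun _ _ => adj_symm g) step
  have main : ∀ j, (∀ i, p i ↔ p j) → ∀ i, p i := fun j h i => (h i).2 ((h i₀).1 h0)
  cases g with
  | A n hn =>
    exact chain_induction i₀ h0 (fun i j h _ => step i j (adj_A (Or.inl h)))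
      (fun i j h _ => step i j (adj_A (Or.inr h)))
  | B n hn =>
    exact chain_induction i₀ h0 (fun i j h _ => step i j (adj_A (Or.inl h)))
      (fun i j h _ => step i j (adj_A (Or.inr h)))
  | C n hn => exact D_induction (n := n + 1) (by omega) i₀ h0 step
  | D n hn => exact D_induction (n := n) (by omega) i₀ h0 step
  | G2 => exact D_induction (n := 4) (by omega) i₀ h0 step
  | E6 =>
    have e1 := e (i := (0 : Fin 6)) (j := (2 : Fin 6)) (by unfold Adj; decide)
    have e2 := e (i := (2 : Fin 6)) (j := (3 : Fin 6)) (by unfold Adj; decide)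
    have e3 := e (i := (1 : Fin 6)) (j := (3 : Fin 6)) (by unfold Adj; decide)
    have e4 := e (i := (4 : Fin 6)) (j := (3 : Fin 6)) (by unfold Adj; decide)
    have e5 := e (i := (5 : Fin 6)) (j := (4 : Fin 6)) (by unfold Adj; decide)
    exact main (3 : Fin 6) (Fin.forall_fin_succ.2 ⟨e1.trans e2, Fin.forall_fin_succ.2 ⟨e3,
      Fin.forall_fin_succ.2 ⟨e2, Fin.forall_fin_succ.2 ⟨Iff.rfl, Fin.forall_fin_succ.2 ⟨e4,
      Fin.forall_fin_succ.2 ⟨e5.trans e4, fun i => i.elim0⟩⟩⟩⟩⟩⟩)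
  | F4 =>
    have e1 := e (i := (0 : Fin 6)) (j := (2 : Fin 6)) (by unfold Adj; decide)
    have e2 := e (i := (2 : Fin 6)) (j := (3 : Fin 6)) (by unfold Adj; decide)
    have e3 := e (i := (1 : Fin 6)) (j := (3 : Fin 6)) (by unfold Adj; decide)
    have e4 := e (i := (4 : Fin 6)) (j := (3 : Fin 6)) (by unfold Adj; decide)
    have e5 := e (i := (5 : Fin 6)) (j := (4 : Fin 6)) (by unfold Adj; decide)
    exact main (3 : Fin 6) (Fin.forall_fin_succ.2 ⟨e1.trans e2, Fin.forall_fin_succ.2 ⟨e3,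
      Fin.forall_fin_succ.2 ⟨e2, Fin.forall_fin_succ.2 ⟨Iff.rfl, Fin.forall_fin_succ.2 ⟨e4,
      Fin.forall_fin_succ.2 ⟨e5.trans e4, fun i => i.elim0⟩⟩⟩⟩⟩⟩)
  | E7 =>
    have e1 := e (i := (0 : Fin 7)) (j := (2 : Fin 7)) (by unfold Adj; decide)
    have e2 := e (i := (2 : Fin 7)) (j := (3 : Fin 7)) (by unfold Adj; decide)
    have e3 := e (i := (1 : Fin 7)) (j := (3 : Fin 7)) (by unfold Adj; decide)
    have e4 := e (i := (4 : Fin 7)) (j := (3 : Fin 7)) (by unfold Adj; decide)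
    have e5 := e (i := (5 : Fin 7)) (j := (4 : Fin 7)) (by unfold Adj; decide)
    have e6 := e (i := (6 : Fin 7)) (j := (5 : Fin 7)) (by unfold Adj; decide)
    exact main (3 : Fin 7) (Fin.forall_fin_succ.2 ⟨e1.trans e2, Fin.forall_fin_succ.2 ⟨e3,
      Fin.forall_fin_succ.2 ⟨e2, Fin.forall_fin_succ.2 ⟨Iff.rfl, Fin.forall_fin_succ.2 ⟨e4,
      Fin.forall_fin_succ.2 ⟨e5.trans e4, Fin.forall_fin_succ.2 ⟨e6.trans (e5.trans e4),
      fun i => i.elim0⟩⟩⟩⟩⟩⟩⟩)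
  | E8 =>
    have e1 := e (i := (0 : Fin 8)) (j := (2 : Fin 8)) (by unfold Adj; decide)
    have e2 := e (i := (2 : Fin 8)) (j := (3 : Fin 8)) (by unfold Adj; decide)
    have e3 := e (i := (1 : Fin 8)) (j := (3 : Fin 8)) (by unfold Adj; decide)
    have e4 := e (i := (4 : Fin 8)) (j := (3 : Fin 8)) (by unfold Adj; decide)
    have e5 := e (i := (5 : Fin 8)) (j := (4 : Fin 8)) (by unfold Adj; decide)
    have e6 := e (i := (6 : Fin 8)) (j := (5 : Fin 8)) (by unfold Adj; decide)
    have e7 := e (i := (7 : Fin 8)) (j := (6 : Fin 8)) (by unfold Adj; decide)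
    exact main (3 : Fin 8) (Fin.forall_fin_succ.2 ⟨e1.trans e2, Fin.forall_fin_succ.2 ⟨e3,
      Fin.forall_fin_succ.2 ⟨e2, Fin.forall_fin_succ.2 ⟨Iff.rfl, Fin.forall_fin_succ.2 ⟨e4,
      Fin.forall_fin_succ.2 ⟨e5.trans e4, Fin.forall_fin_succ.2 ⟨e6.trans (e5.trans e4),
      Fin.forall_fin_succ.2 ⟨e7.trans (e6.trans (e5.trans e4)), fun i => i.elim0⟩⟩⟩⟩⟩⟩⟩⟩)

/-- Some vertex `i₀` with `d_{i₀} = ord σ` generates the diagram under `σ` and the steps to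
neighbours along which `d` does not increase. -/
theorem exists_reach (g : AffineType) : ∃ i₀, dd g i₀ = ordSigma g ∧ ∀ p : Vertex g → Prop,
    p i₀ → (∀ i, p i → p (sigma g i)) → (∀ i j, Adj g i j → dd g j ≤ dd g i → p i → p j) →
    ∀ i, p i := by
  have h1 : sigma g = 1 → ∃ i₀, dd g i₀ = ordSigma g ∧ ∀ p : Vertex g → Prop,
    p i₀ → (∀ i, p i → p (sigma g i)) → (∀ i j, Adj g i j → dd g j ≤ dd g i → p i → p j) →
    ∀ i, p i := by
    intro h
    have hd : ∀ i, dd g i = 1 := fun i => dd_of_fixed g (by rw [h]; rfl)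
    obtain ⟨i₀, -⟩ := exists_sigma_fixed g
    exact ⟨i₀, by rw [hd, ordSigma, h, orderOf_one], fun p h0 _ h2 =>
      connected_induction g i₀ h0 fun i j hij => h2 i j hij (by rw [hd, hd])⟩
  cases g with
  | A n hn => exact h1 rfl
  | B n hn =>
    have hs : ∀ i : Vertex (.B n hn), ((sigma (.B n hn) i : Vertex (.B n hn)) : ℕ) =
        2 * n - 2 - i := by
      intro i
      simp only [sigma, Fin.revPerm_apply, Fin.val_rev, rank]
      omega
    have hd : ∀ i : Vertex (.B n hn), (i : ℕ) ≠ n - 1 → dd _ i = ordSigma (.B n hn) := by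
      intro i hi
      refine dd_of_not_fixed _ fun h => hi ?_
      have := hs i
      rw [h] at this
      omega
    have hr : rank (.B n hn) = 2 * n - 1 := rfl
    refine ⟨⟨0, by rw [hr]; omega⟩, hd _ (by simp only; omega), fun p h0 hσ hstep => ?_⟩
    have hl : ∀ k (hk : k < n), p ⟨k, by rw [hr]; omega⟩ := by
      intro k
      induction k with
      | zero => exact fun _ => h0
      | succ k ih =>
        intro hk
        refine hstep ⟨k, by rw [hr]; omega⟩ _ (adj_A (Or.inl rfl)) ?_ (ih (by omega))
        rw [hd ⟨k, _⟩ (by simp only; omega)]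
        exact dd_le_ordSigma _ _
    intro i
    by_cases hi : (i : ℕ) < n
    · exact hl i hi
    · have := hσ _ (hl (2 * n - 2 - i) (by omega))
      convert this using 1
      apply Fin.ext
      rw [hs]
      have hi2 : (i : ℕ) < 2 * n - 1 := i.2
      simp only
      omega
  | C n hn =>
    have hsig : ∀ i : Fin (n + 1), sigma (.C n hn) i =
      Equiv.swap (⟨n - 1, by omega⟩ : Fin (n + 1)) ⟨n, by omega⟩ i := fun _ => rfl
    have hlast : sigma (.C n hn) (⟨n, by omega⟩ : Fin (n + 1)) =
        (⟨n - 1, by omega⟩ : Fin (n + 1)) := by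
      rw [hsig, Equiv.swap_apply_right]
    have hd1 : ∀ i : Fin (n + 1), (i : ℕ) + 1 < n → dd (.C n hn) i = 1 := by
      intro i hi
      refine dd_of_fixed _ ?_
      rw [hsig]
      refine Equiv.swap_apply_of_ne_of_ne ?_ ?_
      all_goals exact fun h => by have := congrArg Fin.val h; simp only at this; omega
    refine ⟨(⟨n, by omega⟩ : Fin (n + 1)), dd_of_not_fixed _ ?_, fun p h0 hσ hstep => ?_⟩
    · rw [hlast]
      exact fun h => by have := congrArg Fin.val h; simp only at this; omega
    · have h2 : p (⟨n - 1, by omega⟩ : Fin (n + 1)) := by rw [← hlast]; exact hσ _ h0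
      have h3 : ∀ k, k + 2 ≤ n → p (⟨n - 2 - k, by omega⟩ : Fin (n + 1)) := by
        intro k
        induction k with
        | zero =>
          exact fun _ => hstep _ _ (adj_D (n := n + 1) (by omega)
            (Or.inr (Or.inr (Or.inr ⟨by simp only; omega, Or.inr rfl⟩))))
            (by rw [hd1 _ (by simp only; omega)]; exact dd_pos _ _) h0
        | succ k ih =>
          exact fun hk => hstep _ _ (adj_D (n := n + 1) (by omega) (by simp only; omega))
            (by rw [hd1 _ (by simp only; omega)]; exact dd_pos _ _) (ih (by omega))
      intro i
      change Fin (n + 1) at i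
      by_cases hi : (i : ℕ) + 2 ≤ n
      · convert h3 (n - 2 - i) (by omega) using 1
        exact Fin.ext (by simp only; omega)
      · by_cases hi2 : (i : ℕ) = n
        · convert h0
        · convert h2 using 1
          exact Fin.ext (by simp only; omega)
  | D n hn => exact h1 rfl
  | E6 => exact h1 rfl
  | E7 => exact h1 rfl
  | E8 => exact h1 rfl
  | F4 =>
    have d0 : dd .F4 (0 : Fin 6) = ordSigma .F4 := dd_of_not_fixed _ (by decide)
    have d2 : dd .F4 (2 : Fin 6) = ordSigma .F4 := dd_of_not_fixed _ (by decide)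
    have d1 : dd .F4 (1 : Fin 6) = 1 := dd_of_fixed _ (by decide)
    have d3 : dd .F4 (3 : Fin 6) = 1 := dd_of_fixed _ (by decide)
    refine ⟨(0 : Fin 6), d0, fun p h0 hσ hstep => ?_⟩
    have h2 := hstep _ (2 : Fin 6) (by unfold Adj; decide) (by rw [d0]; exact dd_le_ordSigma _ _) h0
    have h3 := hstep _ (3 : Fin 6) (by unfold Adj; decide) (by rw [d2]; exact dd_le_ordSigma _ _) h2
    have h1' := hstep _ (1 : Fin 6) (by unfold Adj; decide)
      (by rw [d3, d1]) h3
    have h5 : p (5 : Fin 6) := hσ _ h0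
    have h4 : p (4 : Fin 6) := hσ _ h2
    exact Fin.forall_fin_succ.2 ⟨h0, Fin.forall_fin_succ.2 ⟨h1', Fin.forall_fin_succ.2 ⟨h2,
      Fin.forall_fin_succ.2 ⟨h3, Fin.forall_fin_succ.2 ⟨h4, Fin.forall_fin_succ.2
      ⟨h5, fun i => i.elim0⟩⟩⟩⟩⟩⟩
  | G2 =>
    have d0 : dd .G2 (0 : Fin 4) = ordSigma .G2 := dd_of_not_fixed _ (by decide)
    refine ⟨(0 : Fin 4), d0, fun p h0 hσ hstep => ?_⟩
    have h1' := hstep _ (1 : Fin 4) (by unfold Adj; decide) (by rw [d0]; exact dd_le_ordSigma _ _) h0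
    have h2 : p (2 : Fin 4) := hσ _ h0
    have h3 : p (3 : Fin 4) := hσ _ h2
    exact Fin.forall_fin_succ.2 ⟨h0, Fin.forall_fin_succ.2 ⟨h1', Fin.forall_fin_succ.2 ⟨h2,
      Fin.forall_fin_succ.2 ⟨h3, fun i => i.elim0⟩⟩⟩⟩

/-- The number of positive roots in terms of the dual Coxeter number. -/
theorem two_mul_card_posRoots (g : AffineType) :
    2 * (posRoots g).card = dualCoxeter g * ∑ i, if sigma g i = i then ordSigma g else 1 := by
  have h1 : sigma g = 1 → (∑ i, if sigma g i = i then ordSigma g else 1) = rank g := by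
    intro h
    simp [h, ordSigma]
  -- After this splitting only the number of σ-fixed vertices is needed: 1 for B, n - 1 for C, 2 for
  -- F_4 and 1 for G_2.
  have hsplit : (∑ i, if sigma g i = i then ordSigma g else 1) =
      rank g + (ordSigma g - 1) * (Finset.univ.filter fun i => sigma g i = i).card := by
    have : ∀ i, (if sigma g i = i then ordSigma g else 1) =
        1 + if sigma g i = i then ordSigma g - 1 else 0 := by
      intro i
      have := ordSigma_pos g
      split_ifs <;> omega
    simp only [this, Finset.sum_add_distrib, Finset.sum_const, Finset.card_univ, Fintype.card_fin,
      smul_eq_mul, mul_one, ← Finset.sum_filter]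
    rw [mul_comm]
  have hord : ∀ p : ℕ, p.Prime → sigma g ^ p = 1 → sigma g ≠ 1 → ordSigma g = p := by
    intro p hp hp1 hp2
    have : Fact p.Prime := ⟨hp⟩
    exact orderOf_eq_prime hp1 hp2
  cases g with
  | A n hn => rw [h1 rfl]; exact card_rootsA n
  | B n hn =>
    have hs : ∀ i : Vertex (.B n hn), ((sigma (.B n hn) i : Vertex (.B n hn)) : ℕ) =
        2 * n - 2 - i := by
      intro i
      simp only [sigma, Fin.revPerm_apply, Fin.val_rev, rank]
      omega
    have hr : rank (.B n hn) = 2 * n - 1 := rfl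
    have ho := hord 2 Nat.prime_two (by ext i; simp [sigma, pow_two]) fun h => by
      have h2 := hs ⟨0, by rw [hr]; omega⟩
      rw [h] at h2
      simp only [Equiv.Perm.coe_one, id_eq] at h2
      omega
    have hf : (Finset.univ.filter fun i => sigma (.B n hn) i = i) =
        {(⟨n - 1, by rw [hr]; omega⟩ : Vertex (.B n hn))} := by
      ext i
      have hi : (i : ℕ) < 2 * n - 1 := i.2
      simp only [Finset.mem_filter, Finset.mem_univ, true_and, Finset.mem_singleton, Fin.ext_iff,
        hs]
      omega
    rw [hsplit, ho, hf, Finset.card_singleton, hr]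
    have := card_rootsA (2 * n - 1)
    simp only [posRoots, dualCoxeter]
    rw [this, show 2 * n - 1 + (2 - 1) * 1 = 2 * n - 1 + 1 by omega, mul_comm]
  | C n hn =>
    have hsig : ∀ i : Fin (n + 1), sigma (.C n hn) i =
      Equiv.swap (⟨n - 1, by omega⟩ : Fin (n + 1)) ⟨n, by omega⟩ i := fun _ => rfl
    have hne : (⟨n - 1, by omega⟩ : Fin (n + 1)) ≠ ⟨n, by omega⟩ := fun h => by
      have := congrArg Fin.val h; simp only at this; omega
    have ho := hord 2 Nat.prime_two (by rw [pow_two]; exact Equiv.swap_mul_self _ _) fun h => by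
      have h2 := hsig ⟨n, by omega⟩
      rw [h, Equiv.swap_apply_right] at h2
      exact hne h2.symm
    have hf : (Finset.univ.filter fun i => sigma (.C n hn) i = i) =
        (Finset.univ \ {(⟨n - 1, by omega⟩ : Fin (n + 1)), ⟨n, by omega⟩} :
          Finset (Fin (n + 1))) := by
      ext i
      change Fin (n + 1) at i
      simp only [Finset.mem_filter, Finset.mem_univ, true_and, Finset.mem_sdiff,
        Finset.mem_insert, Finset.mem_singleton]
      rw [hsig]
      constructor
      · rintro h (rfl | rfl)
        · rw [Equiv.swap_apply_left] at h; exact hne h.symm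
        · rw [Equiv.swap_apply_right] at h; exact hne h
      · exact fun h => Equiv.swap_apply_of_ne_of_ne (fun e => h (Or.inl e)) fun e => h (Or.inr e)
    have hc : (Finset.univ \ {(⟨n - 1, by omega⟩ : Fin (n + 1)), ⟨n, by omega⟩} :
        Finset (Fin (n + 1))).card = n - 1 := by
      rw [Finset.card_sdiff_of_subset (Finset.subset_univ _), Finset.card_pair hne,
        Finset.card_univ, Fintype.card_fin]
      omega
    rw [hsplit, ho, hf, hc]
    simp only [posRoots, dualCoxeter, card_rootsD (n + 1) (by omega), rank]
    rw [show n + 1 + (2 - 1) * (n - 1) = 2 * n by omega, Nat.add_sub_cancel]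
    ring
  | D n hn =>
    rw [h1 rfl]
    simp only [posRoots, card_rootsD n (by omega), dualCoxeter, rank]
    rw [show 2 * n - 2 = 2 * (n - 1) by omega]
    ring
  | E6 => rw [h1 rfl]; simp only [posRoots, card_rootsE_6, dualCoxeter, rank]
  | E7 => rw [h1 rfl]; simp only [posRoots, card_rootsE_7, dualCoxeter, rank]
  | E8 => rw [h1 rfl]; simp only [posRoots, card_rootsE_8, dualCoxeter, rank]
  | F4 =>
    have hf : (Finset.univ.filter fun i : Fin 6 => (Equiv.swap 0 5 * Equiv.swap 2 4 :
      Equiv.Perm (Fin 6)) i = i).card = 2 := by decide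
    rw [hsplit, hord 2 Nat.prime_two (by decide) (by decide)]
    simp only [posRoots, card_rootsE_6, dualCoxeter, rank]
    exact (congrArg (fun k => 9 * (6 + (2 - 1) * k)) hf).symm
  | G2 =>
    have hf : (Finset.univ.filter fun i : Fin 4 => (Equiv.swap 0 2 * Equiv.swap 2 3 :
      Equiv.Perm (Fin 4)) i = i).card = 1 := by decide
    rw [hsplit, hord 3 Nat.prime_three (by decide) (by decide)]
    simp only [posRoots, card_rootsD 4 (by omega), dualCoxeter, rank]
    exact (congrArg (fun k => 4 * (4 + (3 - 1) * k)) hf).symm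

end QData

namespace QData

variable {g : AffineType}

/-! ### The invariant form -/

theorem s_apply (i : Vertex g) (v : Weight g) : s g i v = v - v i • simpleRoot g i := by
  rw [s, Module.reflection_apply]
  rfl

theorem s_mul_self (i : Vertex g) : s g i * s g i = 1 := by
  ext1 v
  exact Module.involutive_reflection (proj_simpleRoot g i) v

theorem s_inv (i : Vertex g) : (s g i)⁻¹ = s g i := Module.reflection_inv _

theorem s_s (i : Vertex g) (v : Weight g) : s g i (s g i v) = v :=
  Module.involutive_reflection (proj_simpleRoot g i) v

theorem s_simpleRoot (i : Vertex g) : s g i (simpleRoot g i) = -simpleRoot g i :=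
  Module.reflection_apply_self _

theorem simpleRoot_mem (i : Vertex g) : simpleRoot g i ∈ posRoots g := (isPosSystem g).simple i

theorem neg_simpleRoot_notMem (i : Vertex g) : -simpleRoot g i ∉ posRoots g :=
  (isPosSystem g).neg_simple i

theorem s_mem_posRoots {b : Weight g} (hb : b ∈ posRoots g) {i : Vertex g}
    (hi : b ≠ simpleRoot g i) : s g i b ∈ posRoots g := by
  rw [s_apply]
  exact ((isPosSystem g).refl b hb i).resolve_left hi

theorem s_ne_simpleRoot {b : Weight g} (hb : b ∈ posRoots g) {i : Vertex g} :
    s g i b ≠ simpleRoot g i := by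
  intro h
  have h2 : b = -simpleRoot g i := by rw [← s_simpleRoot, ← h, s_s]
  exact neg_simpleRoot_notMem i (h2 ▸ hb)

/-- Nonnegative integral combinations of simple roots. -/
def InCone (g : AffineType) (v : Weight g) : Prop :=
  ∃ c : Vertex g → ℕ, v = ∑ i, c i • simpleRoot g i

theorem inCone_of_mem {b : Weight g} (hb : b ∈ posRoots g) : InCone g b :=
  (isPosSystem g).cone b hb

theorem inCone_zero : InCone g 0 := ⟨0, by simp⟩

theorem InCone.add {v w : Weight g} (hv : InCone g v) (hw : InCone g w) : InCone g (v + w) :=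
  cone_add hv hw

theorem InCone.nsmul {v : Weight g} (hv : InCone g v) (n : ℕ) : InCone g (n • v) := by
  induction n with
  | zero => rw [zero_smul]; exact inCone_zero
  | succ n ih => rw [succ_nsmul]; exact ih.add hv

theorem inCone_sum {ι : Type*} (t : Finset ι) {f : ι → Weight g} (h : ∀ i ∈ t, InCone g (f i)) :
    InCone g (∑ i ∈ t, f i) := by
  classical
  induction t using Finset.induction_on with
  | empty => exact inCone_zero
  | insert a t ha ih =>
    rw [Finset.sum_insert ha]
    exact (h a (Finset.mem_insert_self _ _)).add
      (ih fun i hi => h i (Finset.mem_insert_of_mem hi))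

/-- The reflection s_i permutes the positive roots other than α_i, so their sum is fixed by s_i and
has i-th coordinate 0. Only α_i contributes. -/
theorem sum_posRoots_apply (i : Vertex g) : (∑ b ∈ posRoots g, b) i = 2 := by
  rw [← Finset.add_sum_erase _ _ (simpleRoot_mem i)]
  have h : ∑ b ∈ (posRoots g).erase (simpleRoot g i), s g i b =
      ∑ b ∈ (posRoots g).erase (simpleRoot g i), b := by
    refine Finset.sum_nbij' (s g i) (s g i) ?_ ?_ (fun b _ => s_s i b) (fun b _ => s_s i b)
      (fun _ _ => rfl)
    all_goals
      intro b hb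
      rw [Finset.mem_erase] at hb ⊢
      exact ⟨s_ne_simpleRoot hb.2, s_mem_posRoots hb.2 hb.1⟩
  have h2 := congrFun (congrArg (s g i) h) i
  rw [← map_sum] at h
  rw [s_apply] at h
  have h3 := congrFun h i
  simp only [Pi.sub_apply, Pi.smul_apply, smul_eq_mul, simpleRoot, cartan_diag] at h3
  rw [Pi.add_apply, simpleRoot, cartan_diag]
  omega

theorem cartan_nonpos {i j : Vertex g} (h : i ≠ j) : cartan g i j ≤ 0 := by
  rcases cartan_offdiag g h with h | h <;> omega

/-- The vector consists of the coefficients of the sum of all positive roots. A zero coefficient at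
i would make the i-th row sum a sum of nonpositive terms, whereas it equals 2. -/
theorem exists_pos_cartan (g : AffineType) : ∃ x : Vertex g → ℤ, (∀ i, 0 < x i) ∧
    ∀ i, ∑ j, cartan g i j * x j = 2 := by
  obtain ⟨c, hc⟩ := inCone_sum (posRoots g) (f := fun b => b) fun b hb => inCone_of_mem hb
  have h1 : ∀ i, ∑ j, cartan g i j * (c j : ℤ) = 2 := by
    intro i
    rw [← sum_posRoots_apply i, hc]
    simp only [Finset.sum_apply, Pi.smul_apply, simpleRoot]
    exact Finset.sum_congr rfl fun j _ => by rw [nsmul_eq_mul, mul_comm]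
  refine ⟨fun i => c i, fun i => ?_, h1⟩
  by_contra h
  have h0 : (c i : ℤ) = 0 := by simp only at h; omega
  have h2 := h1 i
  rw [← Finset.add_sum_erase _ _ (Finset.mem_univ i), h0, mul_zero, zero_add] at h2
  have h3 : ∑ j ∈ Finset.univ.erase i, cartan g i j * (c j : ℤ) ≤ 0 :=
    Finset.sum_nonpos fun j hj => mul_nonpos_of_nonpos_of_nonneg
      (cartan_nonpos (Finset.ne_of_mem_erase hj).symm) (by positivity)
  omega

/-- A maximum principle. Take i with |v_i| / x_i maximal; the i-th equation gives 2|v_i| x_i ≤ |v_i|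
(2x_i - 2), hence v_i = 0, and by maximality v = 0. This yields invertibility of all Cartan matrices
at once. -/
theorem cartan_mulVec_eq_zero {v : Vertex g → ℤ} (h : ∀ i, ∑ j, cartan g i j * v j = 0) :
    v = 0 := by
  obtain ⟨x, hx, hx2⟩ := exists_pos_cartan g
  obtain ⟨i₀, -⟩ := exists_sigma_fixed g
  obtain ⟨i, -, hi⟩ := Finset.exists_max_image Finset.univ (fun i => (|v i| : ℚ) / x i)
    ⟨i₀, Finset.mem_univ _⟩
  have hi' : ∀ j, |v j| * x i ≤ |v i| * x j := by
    intro j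
    have h1 := hi j (Finset.mem_univ j)
    have hxi : (0 : ℚ) < x i := by exact_mod_cast hx i
    have hxj : (0 : ℚ) < x j := by exact_mod_cast hx j
    rw [div_le_div_iff₀ hxj hxi] at h1
    exact_mod_cast h1
  have h1 := h i
  have h2 := hx2 i
  rw [← Finset.add_sum_erase _ _ (Finset.mem_univ i), cartan_diag] at h1 h2
  have h3 : |v i| * x i * 2 ≤ ∑ j ∈ Finset.univ.erase i, -cartan g i j * (|v i| * x j) := by
    have e : |v i| * 2 = |∑ j ∈ Finset.univ.erase i, cartan g i j * v j| := by
      rw [show ∑ j ∈ Finset.univ.erase i, cartan g i j * v j = -(2 * v i) by omega, abs_neg,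
        abs_mul]
      simp [mul_comm]
    calc |v i| * x i * 2 = |v i| * 2 * x i := by ring
      _ ≤ (∑ j ∈ Finset.univ.erase i, |cartan g i j * v j|) * x i := by
          rw [e]
          exact mul_le_mul_of_nonneg_right (Finset.abs_sum_le_sum_abs _ _) (hx i).le
      _ = ∑ j ∈ Finset.univ.erase i, -cartan g i j * (|v j| * x i) := by
          rw [Finset.sum_mul]
          refine Finset.sum_congr rfl fun j hj => ?_
          rw [abs_mul, abs_of_nonpos (cartan_nonpos (Finset.ne_of_mem_erase hj).symm)]
          ring
      _ ≤ _ := Finset.sum_le_sum fun j hj => mul_le_mul_of_nonneg_left (hi' j)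
          (by have := cartan_nonpos (Finset.ne_of_mem_erase hj).symm; omega)
  have h4 : ∑ j ∈ Finset.univ.erase i, -cartan g i j * (|v i| * x j) =
      -(|v i| * ∑ j ∈ Finset.univ.erase i, cartan g i j * x j) := by
    rw [Finset.mul_sum, ← Finset.sum_neg_distrib]
    exact Finset.sum_congr rfl fun j _ => by ring
  rw [h4, show ∑ j ∈ Finset.univ.erase i, cartan g i j * x j = 2 - 2 * x i by omega] at h3
  have h5 : |v i| = 0 := le_antisymm (by nlinarith) (abs_nonneg _)
  ext j
  have h6 := hi' j
  rw [h5, zero_mul] at h6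
  have h7 := abs_nonneg (v j)
  have h8 := hx i
  have : |v j| = 0 := le_antisymm (by nlinarith) h7
  simpa using this

theorem cartan_det_ne_zero (g : AffineType) : (cartan g).det ≠ 0 := by
  intro h
  obtain ⟨v, hv, h⟩ := Matrix.exists_mulVec_eq_zero_iff.2 h
  exact hv (cartan_mulVec_eq_zero fun i => congrFun h i)

/-- The rational Cartan matrix. -/
def cartanQ (g : AffineType) : Matrix (Vertex g) (Vertex g) ℚ := (cartan g).map (Int.cast : ℤ → ℚ)

theorem isUnit_det_cartanQ (g : AffineType) : IsUnit (cartanQ g).det := by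
  have h : (cartanQ g).det = ((cartan g).det : ℚ) := by
    rw [cartanQ]
    exact ((Int.castRingHom ℚ).map_det (cartan g)).symm
  rw [h, isUnit_iff_ne_zero]
  exact_mod_cast cartan_det_ne_zero g

/-- The `W`-invariant bilinear form on the weight lattice with `(λ, α_i) = ⟨h_i, λ⟩`. -/
noncomputable def form (g : AffineType) : Weight g →ₗ[ℤ] Weight g →ₗ[ℤ] ℚ :=
  LinearMap.mk₂ ℤ (fun v w => ∑ i, ∑ j, (v i : ℚ) * (cartanQ g)⁻¹ i j * w j)
    (fun a b c => by simp [add_mul, Finset.sum_add_distrib])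
    (fun a b c => by simp [Finset.mul_sum, mul_assoc])
    (fun a b c => by simp [mul_add, Finset.sum_add_distrib])
    (fun a b c => by
      simp only [Pi.smul_apply, smul_eq_mul, zsmul_eq_mul, Finset.mul_sum, Int.cast_mul]
      exact Finset.sum_congr rfl fun i _ => Finset.sum_congr rfl fun j _ => by ring)

theorem form_apply (v w : Weight g) :
    form g v w = ∑ i, ∑ j, (v i : ℚ) * (cartanQ g)⁻¹ i j * w j := rfl

theorem form_symm (v w : Weight g) : form g v w = form g w v := by
  have h : ((cartanQ g)⁻¹).transpose = (cartanQ g)⁻¹ := by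
    rw [Matrix.transpose_nonsing_inv]
    congr 1
    ext i j
    simp [cartanQ, cartan_symm g i j]
  rw [form_apply, form_apply, Finset.sum_comm]
  refine Finset.sum_congr rfl fun i _ => Finset.sum_congr rfl fun j _ => ?_
  rw [← congrFun (congrFun h i) j, Matrix.transpose_apply]
  ring

theorem form_simpleRoot (v : Weight g) (i : Vertex g) : form g v (simpleRoot g i) = v i := by
  have h : ∀ k, ∑ j, (cartanQ g)⁻¹ k j * (cartan g j i : ℚ) = if k = i then 1 else 0 := by
    intro k
    have := congrFun (congrFun (Matrix.nonsing_inv_mul (cartanQ g) (isUnit_det_cartanQ g)) k) i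
    rw [Matrix.mul_apply, Matrix.one_apply] at this
    simpa [cartanQ] using this
  simp only [form_apply, simpleRoot, mul_assoc, ← Finset.mul_sum, h, mul_ite, mul_one, mul_zero,
    Finset.sum_ite_eq', Finset.mem_univ, if_true]

theorem simpleRoot_form (v : Weight g) (i : Vertex g) : form g (simpleRoot g i) v = v i := by
  rw [form_symm, form_simpleRoot]

theorem form_s (i : Vertex g) (v w : Weight g) : form g (s g i v) (s g i w) = form g v w := by
  simp only [s_apply, map_sub, map_smul, LinearMap.sub_apply, LinearMap.smul_apply,
    form_simpleRoot, simpleRoot_form]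
  simp only [simpleRoot, cartan_diag, zsmul_eq_mul]
  push_cast
  ring

theorem weight_ext {v w : Weight g} (h : ∀ i, form g v (simpleRoot g i) =
    form g w (simpleRoot g i)) : v = w := by
  ext i
  have := h i
  rw [form_simpleRoot, form_simpleRoot] at this
  exact_mod_cast this

/-- The adjugate matrix puts a nonzero multiple of each weight in the root lattice, so the simple
roots suffice to compare linear maps into torsion-free modules. -/
theorem exists_det_smul (x : Weight g) :
    ∃ a : Vertex g → ℤ, (cartan g).det • x = ∑ i, a i • simpleRoot g i := by
  refine ⟨(cartan g).adjugate.mulVec x, ?_⟩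
  have h1 : (cartan g).mulVec ((cartan g).adjugate.mulVec x) = (cartan g).det • x := by
    rw [Matrix.mulVec_mulVec, Matrix.mul_adjugate, Matrix.smul_mulVec, Matrix.one_mulVec]
  rw [← h1]
  ext j
  simp only [Matrix.mulVec, dotProduct, Finset.sum_apply, Pi.smul_apply, smul_eq_mul,
    simpleRoot]
  exact Finset.sum_congr rfl fun i _ => by ring

/-- Linear maps that agree on the simple roots are equal. -/
theorem linearMap_ext {M : Type*} [AddCommGroup M] [Module.IsTorsionFree ℤ M]
    {u v : Weight g →ₗ[ℤ] M}
    (h : ∀ i, u (simpleRoot g i) = v (simpleRoot g i)) : u = v := by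
  refine LinearMap.ext fun x => ?_
  obtain ⟨a, key⟩ := exists_det_smul x
  have h2 : (cartan g).det • u x = (cartan g).det • v x := by
    rw [← map_smul, ← map_smul, key, map_sum, map_sum]
    exact Finset.sum_congr rfl fun i _ => by rw [map_smul, map_smul, h]
  exact smul_right_injective _ (cartan_det_ne_zero g) h2

/-- The half sum of positive roots: the sum of the fundamental weights. -/
def rho (g : AffineType) : Weight g := fun _ => 1

theorem form_rho_nonneg {v : Weight g} (hv : InCone g v) : 0 ≤ form g v (rho g) := by
  obtain ⟨c, rfl⟩ := hv
  rw [map_sum, LinearMap.sum_apply]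
  refine Finset.sum_nonneg fun i _ => ?_
  rw [map_nsmul, LinearMap.smul_apply, simpleRoot_form]
  simp [rho]

theorem InCone.eq_zero {v : Weight g} (hv : InCone g v) (h : form g v (rho g) ≤ 0) : v = 0 := by
  obtain ⟨c, rfl⟩ := hv
  have h1 : form g (∑ i, c i • simpleRoot g i) (rho g) = ∑ i, (c i : ℚ) := by
    rw [map_sum, LinearMap.sum_apply]
    refine Finset.sum_congr rfl fun i _ => ?_
    rw [map_nsmul, LinearMap.smul_apply, simpleRoot_form]
    simp [rho]
  rw [h1] at h
  have h2 := (Finset.sum_eq_zero_iff_of_nonneg (fun i _ => by positivity)).1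
    (le_antisymm h (Finset.sum_nonneg fun i _ => by positivity))
  refine Finset.sum_eq_zero fun i hi => ?_
  have := h2 i hi
  rw [Nat.cast_eq_zero] at this
  rw [this, zero_smul]

theorem InCone.eq_zero_of_neg {v : Weight g} (hv : InCone g v) (h : InCone g (-v)) : v = 0 := by
  refine hv.eq_zero ?_
  have := form_rho_nonneg h
  rw [map_neg, LinearMap.neg_apply] at this
  linarith

theorem zero_notMem_posRoots : (0 : Weight g) ∉ posRoots g := (isPosSystem g).zero

theorem form_rho_pos {b : Weight g} (hb : b ∈ posRoots g) : 0 < form g b (rho g) := by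
  refine lt_of_le_of_ne (form_rho_nonneg (inCone_of_mem hb)) fun h => ?_
  exact zero_notMem_posRoots ((inCone_of_mem hb).eq_zero h.ge ▸ hb)

theorem neg_notMem {b : Weight g} (hb : b ∈ posRoots g) : -b ∉ posRoots g := by
  intro h
  exact zero_notMem_posRoots ((inCone_of_mem hb).eq_zero_of_neg (inCone_of_mem h) ▸ hb)

end QData

namespace QData

variable {g : AffineType}

/-! ### The Weyl group and its length function -/

theorem wordProd_nil : wordProd g [] = 1 := rfl

theorem wordProd_cons (i : Vertex g) (l : List (Vertex g)) :
    wordProd g (i :: l) = s g i * wordProd g l := by simp [wordProd]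

theorem wordProd_append (l m : List (Vertex g)) :
    wordProd g (l ++ m) = wordProd g l * wordProd g m := by simp [wordProd]

theorem wordProd_singleton (i : Vertex g) : wordProd g [i] = s g i := by simp [wordProd]

theorem wordProd_mem (l : List (Vertex g)) : wordProd g l ∈ weylGroup g := by
  refine Subgroup.list_prod_mem _ fun x hx => ?_
  obtain ⟨i, -, rfl⟩ := List.mem_map.1 hx
  exact Subgroup.subset_closure ⟨i, rfl⟩

theorem s_mem_weylGroup (i : Vertex g) : s g i ∈ weylGroup g := Subgroup.subset_closure ⟨i, rfl⟩

theorem wordProd_reverse (l : List (Vertex g)) : wordProd g l.reverse = (wordProd g l)⁻¹ := by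
  induction l with
  | nil => simp [wordProd]
  | cons i l ih =>
    rw [List.reverse_cons, wordProd_append, ih, wordProd_singleton, wordProd_cons, mul_inv_rev,
      s_inv]

theorem exists_word {w : Weight g ≃ₗ[ℤ] Weight g} (hw : w ∈ weylGroup g) :
    ∃ l, wordProd g l = w := by
  induction hw using Subgroup.closure_induction with
  | mem x hx => obtain ⟨i, rfl⟩ := hx; exact ⟨[i], wordProd_singleton i⟩
  | one => exact ⟨[], rfl⟩
  | mul x y _ _ hx hy =>
    obtain ⟨l, rfl⟩ := hx
    obtain ⟨m, rfl⟩ := hy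
    exact ⟨l ++ m, wordProd_append l m⟩
  | inv x _ hx =>
    obtain ⟨l, rfl⟩ := hx
    exact ⟨l.reverse, wordProd_reverse l⟩

theorem form_weyl {w : Weight g ≃ₗ[ℤ] Weight g} (hw : w ∈ weylGroup g) (u v : Weight g) :
    form g (w u) (w v) = form g u v := by
  obtain ⟨l, rfl⟩ := exists_word hw
  induction l with
  | nil => rfl
  | cons i l ih =>
    rw [wordProd_cons, LinearEquiv.mul_apply, LinearEquiv.mul_apply, form_s, ih (wordProd_mem l)]

theorem s_pos_or_neg {b : Weight g} (hb : b ∈ posRoots g) (i : Vertex g) :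
    s g i b ∈ posRoots g ∨ -s g i b ∈ posRoots g := by
  by_cases h : b = simpleRoot g i
  · right; rw [h, s_simpleRoot, neg_neg]; exact simpleRoot_mem i
  · exact Or.inl (s_mem_posRoots hb h)

theorem weyl_pos_or_neg {w : Weight g ≃ₗ[ℤ] Weight g} (hw : w ∈ weylGroup g) {b : Weight g}
    (hb : b ∈ posRoots g) : w b ∈ posRoots g ∨ -w b ∈ posRoots g := by
  obtain ⟨l, rfl⟩ := exists_word hw
  induction l with
  | nil => exact Or.inl hb
  | cons i l ih =>
    rw [wordProd_cons, LinearEquiv.mul_apply]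
    rcases ih (wordProd_mem l) with h | h
    · exact s_pos_or_neg h i
    · have := s_pos_or_neg h i
      rw [map_neg, neg_neg] at this
      exact this.symm

theorem weyl_notMem_iff {w : Weight g ≃ₗ[ℤ] Weight g} (hw : w ∈ weylGroup g) {b : Weight g}
    (hb : b ∈ posRoots g) : w b ∉ posRoots g ↔ -w b ∈ posRoots g :=
  ⟨(weyl_pos_or_neg hw hb).resolve_left, fun h => by
    have := neg_notMem h
    rwa [neg_neg] at this⟩

/-- A positive root that is made negative by a word becomes simple on the way. -/
theorem exists_split_of_notMem {b : Weight g} (hb : b ∈ posRoots g) {l : List (Vertex g)}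
    (h : wordProd g l b ∉ posRoots g) :
    ∃ a j c, l = a ++ j :: c ∧ wordProd g c b = simpleRoot g j := by
  induction l with
  | nil => exact absurd hb h
  | cons i l ih =>
    by_cases h1 : wordProd g l b ∈ posRoots g
    · by_cases h2 : wordProd g l b = simpleRoot g i
      · exact ⟨[], i, l, rfl, h2⟩
      · rw [wordProd_cons, LinearEquiv.mul_apply] at h
        exact absurd (s_mem_posRoots h1 h2) h
    · obtain ⟨a, j, c, rfl, hc⟩ := ih h1
      exact ⟨i :: a, j, c, rfl, hc⟩

/-- `w s_i = s_j w` if `w α_i = α_j`. -/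
theorem mul_s_of_simpleRoot {w : Weight g ≃ₗ[ℤ] Weight g} (hw : w ∈ weylGroup g)
    {i j : Vertex g} (h : w (simpleRoot g i) = simpleRoot g j) : w * s g i = s g j * w := by
  ext1 v
  have h1 : (w v) j = v i := by
    have := form_weyl hw v (simpleRoot g i)
    rw [h, form_simpleRoot, form_simpleRoot] at this
    exact_mod_cast this
  rw [LinearEquiv.mul_apply, LinearEquiv.mul_apply, s_apply, s_apply, map_sub, map_smul, h, h1]

/-- The number of inversions. -/
def inv (g : AffineType) (w : Weight g ≃ₗ[ℤ] Weight g) : ℕ :=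
  ((posRoots g).filter fun b => w b ∉ posRoots g).card

/-- The reflection s_i permutes the positive roots other than α_i and carries the inversions of w
s_i among them to those of w; only α_i itself can change the count. -/
theorem inv_erase (w : Weight g ≃ₗ[ℤ] Weight g) (i : Vertex g) :
    (((posRoots g).erase (simpleRoot g i)).filter fun b => (w * s g i) b ∉ posRoots g).card =
      (((posRoots g).erase (simpleRoot g i)).filter fun b => w b ∉ posRoots g).card := by
  refine Finset.card_nbij' (s g i) (s g i) ?_ ?_ (fun b _ => s_s i b) (fun b _ => s_s i b)
  all_goals
    intro b hb
    rw [Finset.mem_coe, Finset.mem_filter, Finset.mem_erase] at hb ⊢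
    refine ⟨⟨s_ne_simpleRoot hb.1.2, s_mem_posRoots hb.1.2 hb.1.1⟩, ?_⟩
    simpa only [LinearEquiv.mul_apply, s_s] using hb.2

theorem inv_eq (w : Weight g ≃ₗ[ℤ] Weight g) (i : Vertex g) :
    inv g w = (if w (simpleRoot g i) ∉ posRoots g then 1 else 0) +
      (((posRoots g).erase (simpleRoot g i)).filter fun b => w b ∉ posRoots g).card := by
  have key (p : Weight g → Prop) [DecidablePred p] : ((posRoots g).filter p).card =
      (if p (simpleRoot g i) then 1 else 0) +
        (((posRoots g).erase (simpleRoot g i)).filter p).card := by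
    conv_lhs => rw [← Finset.insert_erase (simpleRoot_mem i), Finset.filter_insert]
    split_ifs with h
    · rw [Finset.card_insert_of_notMem (by simp), add_comm]
    · rw [zero_add]
  exact key _

theorem inv_mul_s_of_mem {w : Weight g ≃ₗ[ℤ] Weight g} {i : Vertex g}
    (h : w (simpleRoot g i) ∈ posRoots g) : inv g (w * s g i) = inv g w + 1 := by
  rw [inv_eq w i, inv_eq (w * s g i) i, inv_erase, LinearEquiv.mul_apply, s_simpleRoot, map_neg,
    if_pos (neg_notMem h), if_neg (not_not.2 h)]
  omega

theorem inv_mul_s_of_notMem {w : Weight g ≃ₗ[ℤ] Weight g} (hw : w ∈ weylGroup g) {i : Vertex g}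
    (h : w (simpleRoot g i) ∉ posRoots g) : inv g (w * s g i) + 1 = inv g w := by
  rw [inv_eq w i, inv_eq (w * s g i) i, inv_erase, LinearEquiv.mul_apply, s_simpleRoot, map_neg,
    if_pos h, if_neg (not_not.2 ((weyl_notMem_iff hw (simpleRoot_mem i)).1 h))]
  omega

theorem inv_one : inv g 1 = 0 := by
  rw [inv, Finset.card_eq_zero, Finset.filter_eq_empty_iff]
  exact fun b hb h => h hb

theorem inv_wordProd_le (l : List (Vertex g)) : inv g (wordProd g l) ≤ l.length := by
  induction l using List.reverseRecOn with
  | nil => rw [wordProd_nil, inv_one]; exact Nat.zero_le _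
  | append_singleton l i ih =>
    rw [wordProd_append, wordProd_singleton, List.length_append, List.length_singleton]
    by_cases h : wordProd g l (simpleRoot g i) ∈ posRoots g
    · rw [inv_mul_s_of_mem h]; omega
    · have := inv_mul_s_of_notMem (wordProd_mem l) h; omega

theorem inv_le_card (w : Weight g ≃ₗ[ℤ] Weight g) : inv g w ≤ (posRoots g).card :=
  Finset.card_filter_le _ _

theorem mem_posRoots_of_inv_eq_zero {w : Weight g ≃ₗ[ℤ] Weight g} (h : inv g w = 0) {b : Weight g}
    (hb : b ∈ posRoots g) : w b ∈ posRoots g := by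
  rw [inv, Finset.card_eq_zero, Finset.filter_eq_empty_iff] at h
  exact not_not.1 (h hb)

/-- Deletion argument. If the last letter i is preceded by l, then l sends α_i to a negative root,
so α_i becomes a simple root α_j just before some letter j of l = a j c. Then c s_i = s_j c, the two
letters cancel, and a c is a shorter word for the same element. -/
theorem wordProd_eq_one_of_inv_eq_zero (n : ℕ) : ∀ l : List (Vertex g), l.length = n →
    inv g (wordProd g l) = 0 → wordProd g l = 1 := by
  induction n using Nat.strong_induction_on with
  | _ n ih =>
    intro l hl h
    rcases List.eq_nil_or_concat' l with rfl | ⟨l, i, rfl⟩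
    · rfl
    · have h1 := mem_posRoots_of_inv_eq_zero h (simpleRoot_mem i)
      rw [wordProd_append, wordProd_singleton, LinearEquiv.mul_apply, s_simpleRoot, map_neg] at h1
      have h2 := neg_notMem h1
      rw [neg_neg] at h2
      obtain ⟨a, j, c, rfl, hc⟩ := exists_split_of_notMem (simpleRoot_mem i) h2
      have h3 : wordProd g (a ++ j :: c ++ [i]) = wordProd g (a ++ c) := by
        rw [wordProd_append, wordProd_append, wordProd_append, wordProd_cons, wordProd_singleton,
          ← mul_s_of_simpleRoot (wordProd_mem c) hc, mul_assoc, mul_assoc, s_mul_self, mul_one]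
      rw [h3] at h ⊢
      refine ih _ ?_ _ rfl h
      simp only [List.length_append, List.length_cons, List.length_nil] at hl ⊢
      omega

theorem eq_one_of_inv_eq_zero {w : Weight g ≃ₗ[ℤ] Weight g} (hw : w ∈ weylGroup g)
    (h : inv g w = 0) : w = 1 := by
  obtain ⟨l, rfl⟩ := exists_word hw
  exact wordProd_eq_one_of_inv_eq_zero _ l rfl h

theorem weyl_inCone_of_simple {w : Weight g ≃ₗ[ℤ] Weight g}
    (h : ∀ i, w (simpleRoot g i) ∈ posRoots g) {b : Weight g} (hb : InCone g b) :
    InCone g (w b) := by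
  obtain ⟨c, rfl⟩ := hb
  rw [map_sum]
  refine inCone_sum _ fun i _ => ?_
  rw [map_nsmul]
  exact (inCone_of_mem (h i)).nsmul _

theorem inv_eq_zero_of_simple {w : Weight g ≃ₗ[ℤ] Weight g} (hw : w ∈ weylGroup g)
    (h : ∀ i, w (simpleRoot g i) ∈ posRoots g) : inv g w = 0 := by
  rw [inv, Finset.card_eq_zero, Finset.filter_eq_empty_iff]
  intro b hb
  rw [weyl_notMem_iff hw hb]
  intro h1
  have h2 := weyl_inCone_of_simple h (inCone_of_mem hb)
  have h3 := h2.eq_zero_of_neg (inCone_of_mem h1)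
  rw [h3, neg_zero] at h1
  exact zero_notMem_posRoots h1

theorem exists_reduced (n : ℕ) : ∀ w ∈ weylGroup g, inv g w = n →
    ∃ l, wordProd g l = w ∧ l.length = n := by
  induction n with
  | zero => exact fun w hw h => ⟨[], (eq_one_of_inv_eq_zero hw h).symm, rfl⟩
  | succ n ih =>
    intro w hw h
    by_cases h1 : ∀ i, w (simpleRoot g i) ∈ posRoots g
    · rw [inv_eq_zero_of_simple hw h1] at h; omega
    · push Not at h1
      obtain ⟨i, hi⟩ := h1
      have h2 := inv_mul_s_of_notMem hw hi
      obtain ⟨l, hl, hl'⟩ := ih (w * s g i) (mul_mem hw (s_mem_weylGroup i)) (by omega)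
      refine ⟨l ++ [i], ?_, by simp [hl']⟩
      rw [wordProd_append, hl, wordProd_singleton, mul_assoc, s_mul_self, mul_one]

theorem len_eq_inv {w : Weight g ≃ₗ[ℤ] Weight g} (hw : w ∈ weylGroup g) : len g w = inv g w := by
  obtain ⟨l, hl, hl'⟩ := exists_reduced _ w hw rfl
  refine le_antisymm (Nat.sInf_le ⟨l, hl', hl⟩) (le_csInf ⟨_, l, hl', hl⟩ ?_)
  rintro _ ⟨m, rfl, rfl⟩
  exact inv_wordProd_le m

/-! ### The longest element -/

theorem w0_spec (g : AffineType) :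
    w0 g ∈ weylGroup g ∧ ∀ v ∈ weylGroup g, len g v ≤ len g (w0 g) := by
  have h : ∃ w, w ∈ weylGroup g ∧ ∀ v ∈ weylGroup g, len g v ≤ len g w := by
    have hb : ∀ n, (∃ w ∈ weylGroup g, inv g w = n) → n ≤ (posRoots g).card := by
      rintro _ ⟨w, -, rfl⟩
      exact inv_le_card w
    classical
    obtain ⟨w, hw, h⟩ := Nat.findGreatest_spec (P := fun n => ∃ w ∈ weylGroup g, inv g w = n)
      (Nat.zero_le (posRoots g).card) ⟨1, one_mem _, inv_one⟩
    refine ⟨w, hw, fun v hv => ?_⟩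
    rw [len_eq_inv hv, len_eq_inv hw, h]
    exact Nat.le_findGreatest (inv_le_card v) ⟨v, hv, rfl⟩
  exact Classical.epsilon_spec h

theorem w0_mem (g : AffineType) : w0 g ∈ weylGroup g := (w0_spec g).1

theorem w0_simpleRoot_notMem (i : Vertex g) : w0 g (simpleRoot g i) ∉ posRoots g := by
  intro h
  have h1 := inv_mul_s_of_mem h
  have h2 := (w0_spec g).2 _ (mul_mem (w0_mem g) (s_mem_weylGroup i))
  rw [len_eq_inv (w0_mem g), len_eq_inv (mul_mem (w0_mem g) (s_mem_weylGroup i))] at h2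
  omega

theorem neg_weyl_inCone {w : Weight g ≃ₗ[ℤ] Weight g} (hw : w ∈ weylGroup g)
    (h : ∀ i, w (simpleRoot g i) ∉ posRoots g) {b : Weight g} (hb : InCone g b) :
    InCone g (-w b) := by
  obtain ⟨c, rfl⟩ := hb
  rw [map_sum, ← Finset.sum_neg_distrib]
  refine inCone_sum _ fun i _ => ?_
  rw [map_nsmul, ← smul_neg]
  exact (inCone_of_mem ((weyl_notMem_iff hw (simpleRoot_mem i)).1 (h i))).nsmul _

theorem neg_weyl_mem {w : Weight g ≃ₗ[ℤ] Weight g} (hw : w ∈ weylGroup g)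
    (h : ∀ i, w (simpleRoot g i) ∉ posRoots g) {b : Weight g} (hb : b ∈ posRoots g) :
    -w b ∈ posRoots g := by
  rw [← weyl_notMem_iff hw hb]
  intro h1
  have h2 := (inCone_of_mem h1).eq_zero_of_neg (neg_weyl_inCone hw h (inCone_of_mem hb))
  exact zero_notMem_posRoots (h2 ▸ h1)

theorem neg_w0_mem {b : Weight g} (hb : b ∈ posRoots g) : -w0 g b ∈ posRoots g :=
  neg_weyl_mem (w0_mem g) w0_simpleRoot_notMem hb

/-- An element of the Weyl group that makes all simple roots negative is `w_0⁻¹`. -/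
theorem w0_mul_eq_one {w : Weight g ≃ₗ[ℤ] Weight g} (hw : w ∈ weylGroup g)
    (h : ∀ i, w (simpleRoot g i) ∉ posRoots g) : w0 g * w = 1 := by
  refine eq_one_of_inv_eq_zero (mul_mem (w0_mem g) hw) (inv_eq_zero_of_simple
    (mul_mem (w0_mem g) hw) fun i => ?_)
  have := neg_w0_mem (neg_weyl_mem hw h (simpleRoot_mem i))
  rwa [map_neg, neg_neg] at this

theorem w0_mul_self (g : AffineType) : w0 g * w0 g = 1 := w0_mul_eq_one (w0_mem g) w0_simpleRoot_notMem

theorem w0_inv (g : AffineType) : (w0 g)⁻¹ = w0 g := inv_eq_of_mul_eq_one_left (w0_mul_self g)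

theorem w0_w0 (v : Weight g) : w0 g (w0 g v) = v := LinearEquiv.congr_fun (w0_mul_self g) v

theorem eq_w0 {w : Weight g ≃ₗ[ℤ] Weight g} (hw : w ∈ weylGroup g)
    (h : ∀ i, w (simpleRoot g i) ∉ posRoots g) : w = w0 g := by
  rw [← w0_inv, eq_inv_iff_mul_eq_one, ← mul_right_inj (w0 g), ← mul_assoc, w0_mul_eq_one hw h,
    one_mul, mul_one]

theorem inv_w0 (g : AffineType) : inv g (w0 g) = (posRoots g).card := by
  rw [inv, Finset.filter_true_of_mem]
  exact fun b hb => (weyl_notMem_iff (w0_mem g) hb).2 (neg_w0_mem hb)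

theorem ell_eq (g : AffineType) : ell g = (posRoots g).card := by
  rw [ell, len_eq_inv (w0_mem g), inv_w0]

/-- The conjugate w_0 s_i w_0 has -w_0 α_i as its only inversion. An element with one inversion is a
simple reflection s_j, whose inversion is α_j. -/
theorem exists_star (i : Vertex g) : ∃ j, simpleRoot g j = -w0 g (simpleRoot g i) := by
  have hw : w0 g * s g i * w0 g ∈ weylGroup g :=
    mul_mem (mul_mem (w0_mem g) (s_mem_weylGroup i)) (w0_mem g)
  have hb : -w0 g (simpleRoot g i) ∈ posRoots g := neg_w0_mem (simpleRoot_mem i)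
  have key : ∀ b ∈ posRoots g, (w0 g * s g i * w0 g) b ∉ posRoots g →
      b = -w0 g (simpleRoot g i) := by
    intro b hb h
    rw [LinearEquiv.mul_apply, LinearEquiv.mul_apply] at h
    by_contra h1
    have h2 : -w0 g b ≠ simpleRoot g i := fun h2 => h1 (by rw [← h2, map_neg, neg_neg, w0_w0])
    have h3 := neg_w0_mem (s_mem_posRoots (neg_w0_mem hb) h2)
    rw [map_neg, map_neg, neg_neg] at h3
    exact h h3
  have h1 : inv g (w0 g * s g i * w0 g) = 1 := by
    rw [inv, Finset.card_eq_one]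
    refine ⟨-w0 g (simpleRoot g i), ?_⟩
    ext b
    rw [Finset.mem_filter, Finset.mem_singleton]
    refine ⟨fun h => key b h.1 h.2, ?_⟩
    rintro rfl
    refine ⟨hb, ?_⟩
    rw [LinearEquiv.mul_apply, LinearEquiv.mul_apply, map_neg, w0_w0, map_neg, s_simpleRoot,
      neg_neg]
    exact w0_simpleRoot_notMem i
  obtain ⟨l, hl, hl'⟩ := exists_reduced _ _ hw h1
  obtain ⟨j, rfl⟩ := List.length_eq_one_iff.1 hl'
  rw [wordProd_singleton] at hl
  refine ⟨j, key _ (simpleRoot_mem j) ?_⟩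
  rw [← hl, s_simpleRoot]
  exact neg_simpleRoot_notMem j

theorem simpleRoot_star (i : Vertex g) : simpleRoot g (star g i) = -w0 g (simpleRoot g i) := by
  have h := exists_star i
  rw [star, dif_pos h]
  exact h.choose_spec

theorem w0_simpleRoot (i : Vertex g) : w0 g (simpleRoot g i) = -simpleRoot g (star g i) := by
  rw [simpleRoot_star, neg_neg]

theorem simpleRoot_injective (g : AffineType) : Function.Injective (simpleRoot g) := by
  intro i j h
  by_contra hij
  have h1 := congrFun h j
  simp only [simpleRoot, cartan_diag] at h1
  have := cartan_nonpos (Ne.symm hij)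
  omega

theorem star_star (i : Vertex g) : star g (star g i) = i := by
  apply simpleRoot_injective
  rw [simpleRoot_star, simpleRoot_star, map_neg, neg_neg, w0_w0]

theorem w0_apply (v : Weight g) : w0 g v = fun i => -v (star g i) := by
  ext i
  have h := form_weyl (w0_mem g) v (w0 g (simpleRoot g i))
  rw [w0_w0, form_simpleRoot, w0_simpleRoot, map_neg, form_simpleRoot] at h
  exact_mod_cast h

theorem cartan_star (i j : Vertex g) : cartan g (star g i) (star g j) = cartan g i j := by
  have h := form_weyl (w0_mem g) (simpleRoot g j) (simpleRoot g i)
  rw [w0_simpleRoot, w0_simpleRoot, map_neg, map_neg, LinearMap.neg_apply, neg_neg,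
    form_simpleRoot, form_simpleRoot] at h
  exact_mod_cast h

end QData

namespace QData
variable {g : AffineType}

/-! ### Dominant weights -/

/-- This ties the explicit lists to the definition of positive roots. A listed root is made negative
by w_0, so along a word of w_0 it passes through a simple root and hence lies in the Weyl orbit of
one. -/
theorem mem_posRoots_iff (b : Weight g) : b ∈ posRoots g ↔ IsPosRoot g b := by
  constructor
  · intro hb
    obtain ⟨l, hl⟩ := exists_word (w0_mem g)
    have h : wordProd g l b ∉ posRoots g := by
      rw [hl]
      exact fun h => neg_notMem h (neg_w0_mem hb)
    obtain ⟨a, j, c, -, hc⟩ := exists_split_of_notMem hb h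
    refine ⟨⟨(wordProd g c)⁻¹, inv_mem (wordProd_mem c), j, ?_⟩, inCone_of_mem hb⟩
    rw [← hc, ← LinearEquiv.mul_apply, inv_mul_cancel, LinearEquiv.coe_one, id]
  · rintro ⟨⟨w, hw, i, rfl⟩, hc⟩
    refine (weyl_pos_or_neg hw (simpleRoot_mem i)).resolve_right fun h => ?_
    have := InCone.eq_zero_of_neg hc (inCone_of_mem h)
    rw [this, neg_zero] at h
    exact zero_notMem_posRoots h

/-- `λ` is dominant. -/
def IsDominant (v : Weight g) : Prop := ∀ i, 0 ≤ v i

theorem isDominant_fundWeight (i : Vertex g) : IsDominant (fundWeight g i) := by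
  intro j
  rw [fundWeight, Pi.single_apply]
  split_ifs <;> simp

theorem form_inCone {u v : Weight g} (hu : IsDominant u) (hv : InCone g v) :
    0 ≤ form g u v := by
  obtain ⟨c, rfl⟩ := hv
  rw [map_sum]
  refine Finset.sum_nonneg fun i _ => ?_
  rw [map_nsmul, form_simpleRoot]
  have := hu i
  positivity

/-- Induction on the number of inversions: if w α_i is negative, then v - w v is v - w s_i v plus
⟨h_i, v⟩ times the positive root -w α_i. -/
theorem inCone_sub_weyl (n : ℕ) {v : Weight g} (hv : IsDominant v) :
    ∀ w ∈ weylGroup g, inv g w = n → InCone g (v - w v) := by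
  induction n with
  | zero =>
    intro w hw h
    rw [eq_one_of_inv_eq_zero hw h, LinearEquiv.coe_one, id, sub_self]
    exact inCone_zero
  | succ n ih =>
    intro w hw h
    have : ∃ i, w (simpleRoot g i) ∉ posRoots g := by
      by_contra! h'
      rw [inv_eq_zero_of_simple hw h'] at h
      omega
    obtain ⟨i, hi⟩ := this
    have h1 := inv_mul_s_of_notMem hw hi
    have h2 := ih (w * s g i) (mul_mem hw (s_mem_weylGroup i)) (by omega)
    have h3 := (weyl_notMem_iff hw (simpleRoot_mem i)).1 hi
    have h4 : v - w v = v - (w * s g i) v + (v i).toNat • -w (simpleRoot g i) := by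
      rw [LinearEquiv.mul_apply, s_apply, map_sub, map_smul, ← natCast_zsmul,
        Int.toNat_of_nonneg (hv i), smul_neg]
      abel
    rw [h4]
    exact h2.add ((inCone_of_mem h3).nsmul _)

theorem IsDominant.inCone {v : Weight g} (hv : IsDominant v) {w : Weight g ≃ₗ[ℤ] Weight g}
    (hw : w ∈ weylGroup g) : InCone g (v - w v) :=
  inCone_sub_weyl _ hv w hw rfl

theorem IsDominant.eq_of_conj {u v : Weight g} (hu : IsDominant u) (hv : IsDominant v)
    {w : Weight g ≃ₗ[ℤ] Weight g} (hw : w ∈ weylGroup g) (h : w u = v) : u = v := by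
  have h1 := hu.inCone hw
  have h2 := hv.inCone (inv_mem hw)
  have h3 : w⁻¹ v = u := by
    rw [← h, ← LinearEquiv.mul_apply, inv_mul_cancel, LinearEquiv.coe_one, id]
  rw [h] at h1
  rw [h3, ← neg_sub] at h2
  exact sub_eq_zero.1 (h1.eq_zero_of_neg h2)

/-- An element of the Weyl group that fixes a sum of fundamental weights fixes each of them. -/
theorem fix_of_fix_sum {t : Finset (Vertex g)} {w : Weight g ≃ₗ[ℤ] Weight g}
    (hw : w ∈ weylGroup g) (h : w (∑ i ∈ t, fundWeight g i) = ∑ i ∈ t, fundWeight g i)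
    {j : Vertex g} (hj : j ∈ t) : w (fundWeight g j) = fundWeight g j := by
  have h1 := fun i => (isDominant_fundWeight i).inCone hw
  have h2 : ∑ i ∈ t, (fundWeight g i - w (fundWeight g i)) = 0 := by
    rw [Finset.sum_sub_distrib, ← map_sum, h, sub_self]
  have h3 : fundWeight g j - w (fundWeight g j) = 0 := by
    refine (h1 j).eq_zero_of_neg ?_
    rw [← Finset.add_sum_erase _ _ hj] at h2
    rw [neg_eq_of_add_eq_zero_right h2]
    exact inCone_sum _ fun i _ => h1 i
  exact (sub_eq_zero.1 h3).symm

theorem linearEquiv_fund_ext {u v : Weight g ≃ₗ[ℤ] Weight g}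
    (h : ∀ i, u (fundWeight g i) = v (fundWeight g i)) : u = v := by
  refine LinearEquiv.toLinearMap_injective (LinearMap.pi_ext' fun i => LinearMap.ext_ring ?_)
  exact h i

theorem form_fund_ext {v w : Weight g}
    (h : ∀ i, form g v (fundWeight g i) = form g w (fundWeight g i)) : v = w := by
  refine weight_ext fun i => ?_
  have : form g v = form g w := LinearMap.pi_ext' fun i => LinearMap.ext_ring (h i)
  rw [this]

theorem form_simpleRoot_fund (i j : Vertex g) :
    form g (simpleRoot g i) (fundWeight g j) = if i = j then 1 else 0 := by
  rw [simpleRoot_form, fundWeight, Pi.single_apply]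
  split_ifs <;> simp

/-- A nonzero dominant element of the root cone pairs positively with nonzero dominant
weights. -/
theorem form_pos {v : Weight g} (hv : IsDominant v) (hc : InCone g v) (h0 : v ≠ 0)
    (i : Vertex g) : 0 < form g (fundWeight g i) v := by
  obtain ⟨c, rfl⟩ := hc
  have key : ∀ i, form g (fundWeight g i) (∑ j, c j • simpleRoot g j) = c i := by
    intro i
    rw [map_sum, Finset.sum_eq_single i]
    · rw [map_nsmul, form_symm, form_simpleRoot_fund, if_pos rfl]; simp
    · intro j _ hj
      rw [map_nsmul, form_symm, form_simpleRoot_fund, if_neg hj, smul_zero]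
    · simp
  rw [key]
  by_contra hi
  have hi0 : c i = 0 := by
    by_contra h
    exact hi (by exact_mod_cast Nat.pos_of_ne_zero h)
  refine h0 ?_
  -- If c_j = 0, the j-th coordinate of the vector is minus the sum of the coefficients at the
  -- neighbours of j. Dominance makes it nonnegative, so these coefficients vanish, and zeros spread
  -- over the connected diagram.
  have hall : ∀ j, c j = 0 := by
    refine connected_induction g i hi0 fun j k hjk hj => ?_
    have h1 := hv j
    have e : ∀ x, (c x • simpleRoot g x) j = (c x : ℤ) * cartan g j x := fun x => by
      rw [Pi.smul_apply, nsmul_eq_mul, simpleRoot]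
    simp only [Finset.sum_apply, e] at h1
    rw [← Finset.add_sum_erase _ _ (Finset.mem_univ j), hj, Nat.cast_zero, zero_mul, zero_add,
      ← Finset.add_sum_erase _ _ (Finset.mem_erase.2 ⟨hjk.1.symm, Finset.mem_univ k⟩),
      cartan_of_adj g hjk] at h1
    have h2 : ∑ x ∈ (Finset.univ.erase j).erase k, (c x : ℤ) * cartan g j x ≤ 0 := by
      refine Finset.sum_nonpos fun x hx => ?_
      rw [Finset.mem_erase, Finset.mem_erase] at hx
      have := cartan_nonpos hx.2.1.symm
      exact mul_nonpos_of_nonneg_of_nonpos (by positivity) this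
    omega
  exact Finset.sum_eq_zero fun j _ => by rw [hall, zero_smul]

theorem s_fundWeight (i : Vertex g) :
    s g i (fundWeight g i) = fundWeight g i - simpleRoot g i := by
  rw [s_apply, fundWeight, Pi.single_eq_same, one_smul]

theorem s_fundWeight_of_ne {i j : Vertex g} (h : i ≠ j) :
    s g i (fundWeight g j) = fundWeight g j := by
  rw [s_apply, fundWeight, Pi.single_eq_of_ne h, zero_smul, sub_zero]

theorem wordProd_fundWeight {l : List (Vertex g)} {j : Vertex g} (h : j ∉ l) :
    wordProd g l (fundWeight g j) = fundWeight g j := by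
  induction l with
  | nil => rfl
  | cons i l ih =>
    rw [List.mem_cons, not_or] at h
    rw [wordProd_cons, LinearEquiv.mul_apply, ih h.2, s_fundWeight_of_ne (Ne.symm h.1)]

/-- By invariance (w α_j, Λ_j) = (α_j, Λ_j) = 1, while a negative root pairs nonpositively with Λ_j.
-/
theorem simpleRoot_mem_of_fix {w : Weight g ≃ₗ[ℤ] Weight g} (hw : w ∈ weylGroup g)
    {j : Vertex g} (h : w (fundWeight g j) = fundWeight g j) :
    w (simpleRoot g j) ∈ posRoots g := by
  refine (weyl_pos_or_neg hw (simpleRoot_mem j)).resolve_right fun h1 => ?_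
  have h2 := form_weyl hw (simpleRoot g j) (fundWeight g j)
  rw [h, form_simpleRoot_fund, if_pos rfl] at h2
  have h3 := form_inCone (isDominant_fundWeight j) (inCone_of_mem h1)
  rw [form_symm, map_neg, LinearMap.neg_apply, h2] at h3
  norm_num at h3

/-- The letters after the first letter i do not move Λ_i. Pairing the rest of the word applied to v,
which equals s_i v, with Λ_i forces v_i = 0; then s_i fixes v and the letter can be dropped. -/
theorem apply_eq_zero_of_wordProd {l : List (Vertex g)} (hl : l.Nodup) {v : Weight g}
    (h : wordProd g l v = v) : ∀ i ∈ l, v i = 0 := by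
  induction l with
  | nil => simp
  | cons i l ih =>
    rw [List.nodup_cons] at hl
    have h1 : wordProd g l v = s g i v := by
      conv_rhs => rw [← h]
      rw [wordProd_cons, LinearEquiv.mul_apply, s_s]
    have h2 : v i = 0 := by
      have e := form_weyl (wordProd_mem l) v (fundWeight g i)
      rw [wordProd_fundWeight hl.1, h1, s_apply, map_sub, map_smul, LinearMap.sub_apply,
        LinearMap.smul_apply, form_simpleRoot_fund, if_pos rfl] at e
      have : (v i : ℚ) = 0 := by simpa using e
      exact_mod_cast this
    have h3 : s g i v = v := by rw [s_apply, h2, zero_smul, sub_zero]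
    intro j hj
    rcases List.mem_cons.1 hj with rfl | hj
    · exact h2
    · exact ih hl.2 (h1.trans h3) j hj

theorem w0_fundWeight (i : Vertex g) : w0 g (fundWeight g i) = -fundWeight g (star g i) := by
  rw [w0_apply]
  ext j
  simp only [fundWeight, Pi.single_apply, Pi.neg_apply]
  have h : star g j = i ↔ j = star g i :=
    ⟨fun h => by rw [← h, star_star], fun h => by rw [h, star_star]⟩
  simp only [h]

/-! ### Diagram automorphisms -/

/-- Automorphisms of the Dynkin diagram that commute with `σ`. -/
structure IsAut (g : AffineType) (π : Equiv.Perm (Vertex g)) : Prop where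
  cartan : ∀ i j, cartan g (π i) (π j) = cartan g i j
  comm : ∀ i, π (sigma g i) = sigma g (π i)

theorem IsAut.symm {π : Equiv.Perm (Vertex g)} (h : IsAut g π) : IsAut g π.symm where
  cartan i j := by rw [← h.cartan, π.apply_symm_apply, π.apply_symm_apply]
  comm i := by rw [Equiv.symm_apply_eq, h.comm, π.apply_symm_apply]

theorem IsAut.adj {π : Equiv.Perm (Vertex g)} (h : IsAut g π) {i j : Vertex g} :
    Adj g (π i) (π j) ↔ Adj g i j := by
  rw [Adj, Adj, h.cartan, π.injective.ne_iff]

theorem IsAut.dd {π : Equiv.Perm (Vertex g)} (h : IsAut g π) (i : Vertex g) :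
    dd g (π i) = dd g i := by
  by_cases hi : sigma g i = i
  · rw [dd_of_fixed g hi, dd_of_fixed g (by rw [← h.comm, hi])]
  · rw [dd_of_not_fixed g hi, dd_of_not_fixed g]
    rw [← h.comm]
    exact fun h' => hi (π.injective h')

theorem isAut_sigma (g : AffineType) : IsAut g (sigma g) := ⟨cartan_sigma g, fun _ => rfl⟩

theorem isAut_one (g : AffineType) : IsAut g 1 := ⟨fun _ _ => rfl, fun _ => rfl⟩

/-- The action of a permutation of the vertices on the weight lattice. -/
def permP (π : Equiv.Perm (Vertex g)) : Weight g ≃ₗ[ℤ] Weight g :=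
  LinearEquiv.funCongrLeft ℤ ℤ π.symm

theorem permP_apply (π : Equiv.Perm (Vertex g)) (v : Weight g) (k : Vertex g) :
    permP π v k = v (π.symm k) := rfl

theorem permP_sigma : permP (sigma g) = sigmaP g := rfl

theorem permP_fundWeight (π : Equiv.Perm (Vertex g)) (i : Vertex g) :
    permP π (fundWeight g i) = fundWeight g (π i) := by
  ext k
  rw [permP_apply, fundWeight, fundWeight, Pi.single_apply, Pi.single_apply]
  simp only [Equiv.symm_apply_eq]

theorem permP_simpleRoot {π : Equiv.Perm (Vertex g)} (h : IsAut g π) (i : Vertex g) :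
    permP π (simpleRoot g i) = simpleRoot g (π i) := by
  ext k
  rw [permP_apply, simpleRoot, simpleRoot, ← h.cartan, π.apply_symm_apply]

theorem permP_s {π : Equiv.Perm (Vertex g)} (h : IsAut g π) (i : Vertex g) :
    permP π * s g i = s g (π i) * permP π := by
  ext1 v
  rw [LinearEquiv.mul_apply, LinearEquiv.mul_apply, s_apply, s_apply, map_sub, map_smul,
    permP_simpleRoot h, permP_apply, π.symm_apply_apply]

theorem permP_wordProd {π : Equiv.Perm (Vertex g)} (h : IsAut g π) (l : List (Vertex g)) :
    permP π * wordProd g l = wordProd g (l.map π) * permP π := by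
  induction l with
  | nil => rfl
  | cons i l ih =>
    rw [wordProd_cons, ← mul_assoc, permP_s h, mul_assoc, ih, List.map_cons, wordProd_cons,
      mul_assoc]

theorem permP_conj {π : Equiv.Perm (Vertex g)} (h : IsAut g π)
    {w : Weight g ≃ₗ[ℤ] Weight g} (hw : w ∈ weylGroup g) :
    permP π * w * (permP π)⁻¹ ∈ weylGroup g := by
  obtain ⟨l, rfl⟩ := exists_word hw
  rw [permP_wordProd h, mul_inv_cancel_right]
  exact wordProd_mem _

theorem form_permP {π : Equiv.Perm (Vertex g)} (h : IsAut g π) (v w : Weight g) :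
    form g (permP π v) (permP π w) = form g v w := by
  have : (form g (permP π v)).comp (permP π).toLinearMap = form g v := by
    refine linearMap_ext fun i => ?_
    rw [LinearMap.comp_apply, LinearEquiv.coe_coe, permP_simpleRoot h, form_simpleRoot,
      form_simpleRoot, permP_apply, π.symm_apply_apply]
  rw [← this]
  rfl

theorem permP_mem {π : Equiv.Perm (Vertex g)} (h : IsAut g π) {b : Weight g}
    (hb : b ∈ posRoots g) : permP π b ∈ posRoots g := by
  rw [mem_posRoots_iff] at hb ⊢
  obtain ⟨⟨w, hw, i, rfl⟩, c, hc⟩ := hb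
  refine ⟨⟨_, permP_conj h hw, π i, ?_⟩, fun i => c (π.symm i), ?_⟩
  · rw [← permP_simpleRoot h, LinearEquiv.mul_apply, LinearEquiv.mul_apply,
      ← LinearEquiv.mul_apply (permP π)⁻¹, inv_mul_cancel, LinearEquiv.coe_one, id]
  · rw [hc, map_sum, ← Equiv.sum_comp π (fun i => c (π.symm i) • simpleRoot g i)]
    refine Finset.sum_congr rfl fun i _ => ?_
    rw [map_nsmul, permP_simpleRoot h, π.symm_apply_apply]

theorem permP_mem_iff {π : Equiv.Perm (Vertex g)} (h : IsAut g π) {b : Weight g} :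
    permP π b ∈ posRoots g ↔ b ∈ posRoots g := by
  refine ⟨fun hb => ?_, permP_mem h⟩
  have := permP_mem h.symm hb
  rwa [show permP π.symm (permP π b) = b from funext fun k => by
    rw [permP_apply, permP_apply, Equiv.symm_symm, π.symm_apply_apply]] at this

/-- The involution `i ↦ i^*` as a permutation. -/
noncomputable def starPerm (g : AffineType) : Equiv.Perm (Vertex g) :=
  ⟨star g, star g, star_star, star_star⟩

theorem w0_eq_neg_permP (v : Weight g) : w0 g v = -permP (starPerm g) v := w0_apply v

theorem permP_w0 {π : Equiv.Perm (Vertex g)} (h : IsAut g π) :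
    permP π * w0 g = w0 g * permP π := by
  have : permP π * w0 g * (permP π)⁻¹ = w0 g := by
    refine eq_w0 (permP_conj h (w0_mem g)) fun i => ?_
    have h1 : (permP π)⁻¹ (simpleRoot g i) = simpleRoot g (π.symm i) := by
      rw [← permP_simpleRoot h.symm]; rfl
    rw [LinearEquiv.mul_apply, LinearEquiv.mul_apply, h1, permP_mem_iff h]
    exact w0_simpleRoot_notMem _
  rwa [mul_inv_eq_iff_eq_mul] at this

theorem star_sigma (i : Vertex g) : star g (sigma g i) = sigma g (star g i) := by
  have h := congrArg (fun u => u (simpleRoot g i)) (permP_w0 (isAut_sigma g))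
  simp only [LinearEquiv.mul_apply, w0_simpleRoot, map_neg, permP_simpleRoot (isAut_sigma g),
    neg_inj] at h
  exact (simpleRoot_injective g h).symm

theorem isAut_star (g : AffineType) : IsAut g (starPerm g) := ⟨cartan_star, star_sigma⟩

theorem dd_star (i : Vertex g) : dd g (star g i) = dd g i := (isAut_star g).dd i

theorem adj_star {i j : Vertex g} : Adj g (star g i) (star g j) ↔ Adj g i j := (isAut_star g).adj

/-- The permutation * acts on weights as -w_0, and the sign disappears under conjugation. -/
theorem w0_conj (w : Weight g ≃ₗ[ℤ] Weight g) :
    permP (starPerm g) * w * (permP (starPerm g))⁻¹ = w0 g * w * w0 g := by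
  rw [mul_inv_eq_iff_eq_mul]
  ext1 v
  have h : w0 g (permP (starPerm g) v) = -v := by
    rw [w0_eq_neg_permP]
    congr 1
    funext k
    rw [permP_apply, permP_apply]
    exact congrArg v (star_star k)
  rw [LinearEquiv.mul_apply, LinearEquiv.mul_apply, LinearEquiv.mul_apply, LinearEquiv.mul_apply,
    h, map_neg, map_neg, w0_eq_neg_permP, neg_neg]

/-! ### Reduced words -/

theorem wordProd_reduced_iff (l : List (Vertex g)) : inv g (wordProd g l) = l.length ↔
    ∀ a j c, l = a ++ j :: c → wordProd g a (simpleRoot g j) ∈ posRoots g := by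
  induction l using List.reverseRecOn with
  | nil => simp [wordProd_nil, inv_one]
  | append_singleton l i ih =>
    rw [wordProd_append, wordProd_singleton, List.length_append, List.length_singleton]
    have hle := inv_wordProd_le l
    constructor
    · intro h a j c hc
      have hi : wordProd g l (simpleRoot g i) ∈ posRoots g := by
        by_contra hi
        have := inv_mul_s_of_notMem (wordProd_mem l) hi
        omega
      rw [inv_mul_s_of_mem hi] at h
      rcases List.eq_nil_or_concat' c with rfl | ⟨c, k, rfl⟩
      · obtain ⟨rfl, h2⟩ := List.append_inj' hc rfl
        rw [List.singleton_inj.1 h2] at hi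
        exact hi
      · rw [← List.cons_append, ← List.append_assoc] at hc
        obtain ⟨h1, -⟩ := List.append_inj' hc rfl
        exact ih.1 (by omega) a j c h1
    · intro h
      rw [inv_mul_s_of_mem (h l i [] rfl), ih.2 fun a j c hc => h a j (c ++ [i]) (by simp [hc])]

end QData

namespace QData
variable {g : AffineType}

/-! ### Height functions -/

/-- The smallest admissible height difference along an edge. -/
noncomputable def edge (g : AffineType) (i j : Vertex g) : ℤ := min (dd g i : ℤ) (dd g j)

theorem edge_symm (i j : Vertex g) : edge g i j = edge g j i := min_comm _ _

theorem edge_pos (i j : Vertex g) : 0 < edge g i j :=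
  lt_min (by exact_mod_cast dd_pos g i) (by exact_mod_cast dd_pos g j)

theorem edge_dvd (i j : Vertex g) : 2 * edge g i j ∣ 2 * (dd g i : ℤ) := by
  refine mul_dvd_mul_left 2 ?_
  rcases min_choice (dd g i : ℤ) (dd g j) with h | h
  · rw [edge, h]
  · rw [edge, h]
    have h2 : dd g j ≤ dd g i := by
      have := min_le_left (dd g i : ℤ) (dd g j)
      rw [h] at this
      exact_mod_cast this
    refine Int.natCast_dvd_natCast.2 ?_
    rcases dd_eq_one_or g j with h1 | h1
    · rw [h1]; exact one_dvd _
    · rw [h1] at h2 ⊢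
      rw [le_antisymm (dd_le_ordSigma g i) h2]

theorem two_dd_pos (i : Vertex g) : (0 : ℤ) < 2 * dd g i := by
  have := dd_pos g i
  omega

theorem le_neg_of_dvd_sub {e x : ℤ} (he : 0 < e) (h : 2 * e ∣ x - e) (hx : x < e) : x ≤ -e := by
  obtain ⟨k, hk⟩ := h
  have : k < 0 := by
    by_contra! h
    nlinarith
  nlinarith

theorem nonneg_of_dvd {d x : ℤ} (h : d ∣ x) (hx : -d < x) : 0 ≤ x := by
  obtain ⟨k, rfl⟩ := h
  by_contra! h
  rcases lt_trichotomy d 0 with hd | hd | hd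
  · nlinarith
  · subst hd; simp at h
  · have : k < 0 := by
      by_contra! h
      nlinarith
    nlinarith

theorem eq_of_dvd_sub {d x y : ℤ} (h : d ∣ x - y) (h1 : x - y < d) (h2 : y - x < d) : x = y := by
  have h3 := nonneg_of_dvd h (by omega)
  have h4 := nonneg_of_dvd (d := d) (x := y - x) (by rw [← neg_sub]; exact h.neg_right) (by omega)
  omega

/-- The linear form of the conditions on a height function. -/
structure HF (g : AffineType) (ξ : Vertex g → ℤ) : Prop where
  bound : ∀ i j, Adj g i j → ξ i - ξ j ≤ 2 * dd g i - edge g i j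
  cong : ∀ i j, Adj g i j → 2 * edge g i j ∣ ξ i - ξ j - edge g i j
  sig : ∀ i, (2 * dd g i : ℤ) ∣ ξ (sigma g i) - ξ i - 2

variable {ξ ξ' ξ'' : Vertex g → ℤ}

theorem HF.sig_pow (h : HF g ξ) (i : Vertex g) (k : ℕ) :
    (2 * dd g i : ℤ) ∣ ξ ((sigma g ^ k) i) - ξ i - 2 * k := by
  induction k with
  | zero => simp
  | succ k ih =>
    have h1 := h.sig ((sigma g ^ k) i)
    rw [show dd g ((sigma g ^ k) i) = dd g i from
      dd_of_sameCycle g ⟨k, by rw [zpow_natCast]⟩, ← Equiv.Perm.mul_apply, ← pow_succ'] at h1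
    have := h1.add ih
    rwa [show ξ ((sigma g ^ (k + 1)) i) - ξ ((sigma g ^ k) i) - 2 +
      (ξ ((sigma g ^ k) i) - ξ i - 2 * k) = ξ ((sigma g ^ (k + 1)) i) - ξ i - 2 * ((k + 1 : ℕ) : ℤ)
      by push_cast; ring] at this

theorem HF.lt_iff (h : HF g ξ) {i j : Vertex g} (hij : Adj g i j) :
    ξ i < ξ j ↔ ξ i + edge g i j ≤ ξ j := by
  have := edge_pos i j
  constructor
  · intro h1
    have := le_neg_of_dvd_sub this (h.cong i j hij) (by omega)
    omega
  · intro; omega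

theorem HF.ne (h : HF g ξ) {i j : Vertex g} (hij : Adj g i j) : ξ i ≠ ξ j := by
  intro h1
  have := le_neg_of_dvd_sub (edge_pos i j) (h.cong i j hij) (by have := edge_pos i j; omega)
  have := edge_pos i j
  omega

theorem reflect_self (i : Vertex g) (ξ : Vertex g → ℤ) :
    reflect g i ξ i = ξ i + 2 * dd g i := by simp [reflect]

theorem reflect_of_ne {i j : Vertex g} (h : j ≠ i) (ξ : Vertex g → ℤ) :
    reflect g i ξ j = ξ j := by simp [reflect, h]

theorem reflectInv_reflect (i : Vertex g) (ξ : Vertex g → ℤ) :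
    reflectInv g i (reflect g i ξ) = ξ := by
  funext j; simp [reflect, reflectInv]

/-- Two height functions that differ by multiples of `2 d_i`. -/
structure Compat (g : AffineType) (ξ ξ' : Vertex g → ℤ) : Prop where
  left : HF g ξ
  right : HF g ξ'
  dvd : ∀ i, (2 * dd g i : ℤ) ∣ ξ' i - ξ i

theorem Compat.symm (h : Compat g ξ ξ') : Compat g ξ' ξ :=
  ⟨h.right, h.left, fun i => by rw [← neg_sub]; exact (h.dvd i).neg_right⟩

theorem Compat.trans (h : Compat g ξ ξ') (h' : Compat g ξ' ξ'') : Compat g ξ ξ'' :=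
  ⟨h.left, h'.right, fun i => by simpa using (h'.dvd i).add (h.dvd i)⟩

theorem HF.refl (h : HF g ξ) : Compat g ξ ξ := ⟨h, h, fun i => by simp⟩

/-- A function congruent to a height function is a height function once it satisfies the
bounds. -/
theorem HF.compat (h : HF g ξ) (hd : ∀ i, (2 * dd g i : ℤ) ∣ ξ' i - ξ i)
    (hb : ∀ i j, Adj g i j → ξ' i - ξ' j ≤ 2 * dd g i - edge g i j) : Compat g ξ ξ' where
  left := h
  dvd := hd
  right :=
    { bound := hb
      cong := fun i j hij => by
        have h1 := (edge_dvd i j).trans (hd i)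
        have h2 := (edge_dvd j i).trans (hd j)
        rw [edge_symm] at h2
        have := ((h.cong i j hij).add h1).sub h2
        rwa [show ξ i - ξ j - edge g i j + (ξ' i - ξ i) - (ξ' j - ξ j) = ξ' i - ξ' j - edge g i j
          by ring] at this
      sig := fun i => by
        have h1 := hd (sigma g i)
        rw [dd_sigma] at h1
        have := ((h.sig i).add h1).sub (hd i)
        rwa [show ξ (sigma g i) - ξ i - 2 + (ξ' (sigma g i) - ξ (sigma g i)) - (ξ' i - ξ i) =
          ξ' (sigma g i) - ξ' i - 2 by ring] at this }

/-- The congruences make ξ'_i - ξ'_j - 2d_i an odd multiple of the edge length, so a strict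
inequality already gives the full gap. -/
theorem HF.compat_of_lt (h : HF g ξ) (hd : ∀ i, (2 * dd g i : ℤ) ∣ ξ' i - ξ i)
    (hb : ∀ i j, Adj g i j → ξ' i - ξ' j < 2 * dd g i) : Compat g ξ ξ' := by
  refine h.compat hd fun i j hij => ?_
  have h1 := (edge_dvd i j).trans (hd i)
  have h2 := (edge_dvd j i).trans (hd j)
  rw [edge_symm] at h2
  have h3 := (((h.cong i j hij).add h1).sub h2).sub (edge_dvd i j)
  have := le_neg_of_dvd_sub (edge_pos i j) (x := ξ' i - ξ' j - 2 * dd g i)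
    (by rwa [show ξ' i - ξ' j - 2 * dd g i - edge g i j = ξ i - ξ j - edge g i j +
        (ξ' i - ξ i) - (ξ' j - ξ j) - 2 * dd g i by ring]) (by have := hb i j hij; have := edge_pos i j; omega)
  omega

theorem HF.sink (h : HF g ξ) {i : Vertex g} (hi : IsSink g ξ i) :
    Compat g ξ (reflect g i ξ) := by
  refine h.compat_of_lt (fun j => ?_) fun j k hjk => ?_
  · by_cases hj : j = i
    · subst hj; rw [reflect_self]; simp
    · rw [reflect_of_ne hj]; simp
  · by_cases hj : j = i
    · subst hj
      rw [reflect_self, reflect_of_ne hjk.1.symm]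
      have := hi k hjk
      omega
    · rw [reflect_of_ne hj]
      have h1 := h.bound j k hjk
      have h2 := edge_pos j k
      by_cases hk : k = i
      · subst hk; rw [reflect_self]; omega
      · rw [reflect_of_ne hk]; omega

theorem HF.source_reflect (h : HF g ξ) (i : Vertex g) :
    IsSource g (reflect g i ξ) i := by
  intro j hij
  rw [reflect_self, reflect_of_ne hij.1.symm]
  have h1 := h.bound j i (adj_symm g hij)
  have h2 := edge_pos j i
  omega

/-- Each condition bounds a difference ξ_i - ξ_j by a constant, and such systems are closed under
minima. The minimum is the base point from which transition elements are defined. -/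
theorem Compat.inf (h : Compat g ξ ξ') : Compat g ξ (ξ ⊓ ξ') := by
  refine h.left.compat (fun i => ?_) fun i j hij => ?_
  · rw [Pi.inf_apply]
    rcases min_choice (ξ i) (ξ' i) with h1 | h1 <;> rw [h1]
    · simp
    · exact h.dvd i
  · rw [Pi.inf_apply, Pi.inf_apply]
    have h1 := h.left.bound i j hij
    have h2 := h.right.bound i j hij
    have h3 := min_le_left (ξ i) (ξ' i)
    have h4 := min_le_right (ξ i) (ξ' i)
    rcases min_choice (ξ j) (ξ' j) with h5 | h5 <;> rw [h5] <;> omega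

/-- The smallest height function `≥ t` congruent to `ξ`. -/
noncomputable def fl (g : AffineType) (ξ : Vertex g → ℤ) (t : ℤ) : Vertex g → ℤ :=
  fun i => t + (ξ i - t) % (2 * dd g i)

theorem le_fl (i : Vertex g) (ξ : Vertex g → ℤ) (t : ℤ) : t ≤ fl g ξ t i := by
  have := Int.emod_nonneg (ξ i - t) (two_dd_pos i).ne'
  rw [fl]; omega

theorem fl_lt (i : Vertex g) (ξ : Vertex g → ℤ) (t : ℤ) : fl g ξ t i < t + 2 * dd g i := by
  have := Int.emod_lt_of_pos (ξ i - t) (two_dd_pos i)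
  rw [fl]; omega

theorem fl_dvd (i : Vertex g) (ξ : Vertex g → ℤ) (t : ℤ) :
    (2 * dd g i : ℤ) ∣ fl g ξ t i - ξ i := by
  have := Int.dvd_sub_self_of_emod_eq (a := ξ i - t) (b := 2 * dd g i) rfl
  rw [fl]
  convert this using 1
  ring

theorem HF.fl (h : HF g ξ) (t : ℤ) : Compat g ξ (fl g ξ t) := by
  refine h.compat_of_lt (fun i => fl_dvd i ξ t) fun i j _ => ?_
  have := fl_lt i ξ t
  have := le_fl j ξ t
  omega

theorem fl_le {t : ℤ} (i : Vertex g) (h : t ≤ ξ i) : fl g ξ t i ≤ ξ i := by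
  have h1 := fl_lt i ξ t
  have h2 := nonneg_of_dvd (d := 2 * dd g i) (x := ξ i - QData.fl g ξ t i)
    (by rw [← neg_sub]; exact (fl_dvd i ξ t).neg_right) (by omega)
  omega

theorem exists_fl_le (ξ : Vertex g → ℤ) : ∃ t, fl g ξ t ≤ ξ := by
  obtain ⟨i₀, -⟩ := exists_sigma_fixed g
  obtain ⟨i, -, hi⟩ := Finset.exists_min_image Finset.univ ξ ⟨i₀, Finset.mem_univ _⟩
  exact ⟨ξ i, fun j => fl_le j (hi j (Finset.mem_univ j))⟩

/-- On each `σ`-orbit the heights increase by `2` along `σ`, starting from a minimal one. -/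
def IsAligned (g : AffineType) (ξ : Vertex g → ℤ) : Prop :=
  ∀ i, IsOrbitMin g ξ i → ∀ k : ℕ, k < dd g i → ξ ((sigma g ^ k) i) = ξ i + 2 * k

theorem sameCycle_pow (i : Vertex g) (k : ℕ) : (sigma g).SameCycle i ((sigma g ^ k) i) :=
  ⟨k, by rw [zpow_natCast]⟩

theorem dd_sigma_pow (i : Vertex g) (k : ℕ) : dd g ((sigma g ^ k) i) = dd g i :=
  dd_of_sameCycle g (sameCycle_pow i k)

/-- All heights on an orbit lie in the window [t, t + 2d). The minimum is t or t + 1: otherwise the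
vertex preceding the minimal one along σ would have the height two less, still in the window. The
other heights are then determined by their residues modulo 2d. -/
theorem HF.isAligned_fl (h : HF g ξ) (t : ℤ) : IsAligned g (QData.fl g ξ t) := by
  intro i hi k hk
  have h1 := (h.fl t).right
  have hd := dd_pos g i
  have hl : ∀ k : ℕ, QData.fl g ξ t ((sigma g ^ k) i) < t + 2 * dd g i := by
    intro k
    have := fl_lt ((sigma g ^ k) i) ξ t
    rwa [dd_sigma_pow] at this
  have h2 : QData.fl g ξ t i ≤ t + 1 := by
    by_contra! hc
    have h3 := h1.sig_pow i (dd g i - 1)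
    have h4 := hi _ (sameCycle_pow i (dd g i - 1))
    have h5 := hl (dd g i - 1)
    have h6 := eq_of_dvd_sub (d := 2 * dd g i) (x := QData.fl g ξ t ((sigma g ^ (dd g i - 1)) i))
      (y := QData.fl g ξ t i - 2)
      (by
        have := h3.add (dvd_refl (2 * (dd g i : ℤ)))
        push_cast [Nat.cast_sub (show 1 ≤ dd g i from hd)] at this
        rwa [sub_sub_eq_add_sub, show QData.fl g ξ t ((sigma g ^ (dd g i - 1)) i) + 2 -
          QData.fl g ξ t i = QData.fl g ξ t ((sigma g ^ (dd g i - 1)) i) -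
          QData.fl g ξ t i - 2 * (dd g i - 1) + 2 * dd g i by ring]) (by have := le_fl i ξ t; omega) (by omega)
    omega
  have h3 := le_fl ((sigma g ^ k) i) ξ t
  have h4 := hl k
  refine eq_of_dvd_sub (d := 2 * dd g i) ?_ (by have := le_fl i ξ t; omega) (by omega)
  convert h1.sig_pow i k using 1
  ring

/-! ### Adapted words between two height functions -/

/-- `l` is an adapted word that leads from `ξ` to `ξ'`. -/
def Path (g : AffineType) : (Vertex g → ℤ) → List (Vertex g) → (Vertex g → ℤ) → Prop
  | ξ, [], ξ' => ξ = ξ'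
  | ξ, i :: l, ξ' => IsSink g ξ i ∧ Path g (reflect g i ξ) l ξ'

theorem Path.adapted {l : List (Vertex g)} (h : Path g ξ l ξ') : IsAdapted g ξ l := by
  induction l generalizing ξ with
  | nil => trivial
  | cons i l ih => exact ⟨h.1, ih h.2⟩

theorem IsAdapted.exists_path {l : List (Vertex g)} (h : IsAdapted g ξ l) :
    ∃ ξ', Path g ξ l ξ' := by
  induction l generalizing ξ with
  | nil => exact ⟨ξ, rfl⟩
  | cons i l ih =>
    obtain ⟨ξ', h'⟩ := ih h.2
    exact ⟨ξ', h.1, h'⟩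

theorem path_append {l m : List (Vertex g)} :
    Path g ξ (l ++ m) ξ'' ↔ ∃ ξ', Path g ξ l ξ' ∧ Path g ξ' m ξ'' := by
  induction l generalizing ξ with
  | nil => exact ⟨fun h => ⟨ξ, rfl, h⟩, fun ⟨_, h1, h2⟩ => by rw [List.nil_append, h1]; exact h2⟩
  | cons i l ih =>
    constructor
    · rintro ⟨h1, h2⟩
      obtain ⟨ξ', h3, h4⟩ := ih.1 h2
      exact ⟨ξ', ⟨h1, h3⟩, h4⟩
    · rintro ⟨ξ', ⟨h1, h2⟩, h3⟩
      exact ⟨h1, ih.2 ⟨ξ', h2, h3⟩⟩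

theorem Path.compat {l : List (Vertex g)} (h : Path g ξ l ξ') (hξ : HF g ξ) : Compat g ξ ξ' := by
  induction l generalizing ξ with
  | nil => rw [← show ξ = ξ' from h]; exact hξ.refl
  | cons i l ih =>
    have := hξ.sink h.1
    exact this.trans (ih h.2 this.right)

theorem Path.apply {l : List (Vertex g)} (h : Path g ξ l ξ') (j : Vertex g) :
    ξ' j = ξ j + 2 * dd g j * l.count j := by
  induction l generalizing ξ with
  | nil => rw [← show ξ = ξ' from h]; simp
  | cons i l ih =>
    rw [ih h.2, List.count_cons]
    by_cases hj : i = j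
    · subst hj
      rw [reflect_self, if_pos (by simp)]
      push_cast
      ring
    · rw [reflect_of_ne (Ne.symm hj), if_neg (by simpa using hj), add_zero]

theorem Path.le {l : List (Vertex g)} (h : Path g ξ l ξ') : ξ ≤ ξ' := by
  intro j
  rw [h.apply j]
  exact le_add_of_nonneg_right (by positivity)

theorem Path.notMem {l : List (Vertex g)} (h : Path g ξ l ξ') {j : Vertex g} (hj : ξ' j = ξ j) :
    j ∉ l := by
  have h1 := h.apply j
  rw [← List.count_eq_zero]
  have h2 := two_dd_pos j
  have h3 : (2 * dd g j : ℤ) * l.count j = 0 := by omega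
  exact_mod_cast (mul_eq_zero.1 h3).resolve_left h2.ne'

/-- A reflection at i raises ξ_i by 2d_i, so with weights ord(σ)/d_i every letter contributes the
same amount 2 ord(σ). In particular the length depends only on the two ends. -/
theorem Path.length {l : List (Vertex g)} (h : Path g ξ l ξ') :
    (2 * ordSigma g : ℤ) * l.length =
      ∑ i, (ordSigma g / dd g i : ℕ) * (ξ' i - ξ i) := by
  have h1 : ∀ i, ((ordSigma g / dd g i : ℕ) : ℤ) * (ξ' i - ξ i) =
      (2 * ordSigma g : ℤ) * l.count i := by
    intro i
    have := Nat.div_mul_cancel (dd_dvd_ordSigma g i)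
    have h2 : ((ordSigma g / dd g i : ℕ) : ℤ) * dd g i = ordSigma g := by exact_mod_cast this
    rw [h.apply i, ← h2]
    ring
  rw [Finset.sum_congr rfl fun i _ => h1 i, ← Finset.mul_sum]
  congr 1
  rw [← Nat.cast_sum]
  congr 1
  have := Multiset.sum_count_eq_card (s := Finset.univ) (m := (l : Multiset (Vertex g)))
    (fun _ _ => Finset.mem_univ _)
  simpa using this.symm

/-- A vertex of minimal height among those below `ξ'` is a sink. -/
theorem Compat.sink (h : Compat g ξ ξ') {i : Vertex g} (hi : ξ i < ξ' i)
    (hm : ∀ j, ξ j < ξ' j → ξ i ≤ ξ j) (hle : ξ ≤ ξ') : IsSink g ξ i := by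
  intro j hij
  have h1 := h.left.ne hij
  by_cases hj : ξ j < ξ' j
  · exact lt_of_le_of_ne (hm j hj) h1
  · have h2 : ξ j = ξ' j := le_antisymm (hle j) (not_lt.1 hj)
    have h3 := h.right.bound i j hij
    have h4 := edge_pos i j
    have h5 : (2 * dd g i : ℤ) ≤ ξ' i - ξ i := Int.le_of_dvd (by omega) (h.dvd i)
    omega

theorem reflect_le (h : Compat g ξ ξ') (hle : ξ ≤ ξ') {i : Vertex g} (hi : ξ i < ξ' i) :
    reflect g i ξ ≤ ξ' := by
  intro j
  by_cases hj : j = i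
  · subst hj
    rw [reflect_self]
    have h5 : (2 * dd g j : ℤ) ≤ ξ' j - ξ j := Int.le_of_dvd (by omega) (h.dvd j)
    linarith
  · rw [reflect_of_ne hj]; exact hle j

theorem exists_path_aux (n : ℕ) : ∀ ξ : Vertex g → ℤ, Compat g ξ ξ' → ξ ≤ ξ' →
    ∑ i, (ξ' i - ξ i) < n → ∃ l, Path g ξ l ξ' := by
  induction n with
  | zero =>
    intro ξ _ hle hn
    have : 0 ≤ ∑ i, (ξ' i - ξ i) := Finset.sum_nonneg fun i _ => sub_nonneg.2 (hle i)
    omega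
  | succ n ih =>
    intro ξ h hle hn
    by_cases hall : ∃ i, ξ i < ξ' i
    · obtain ⟨i, hi, hm⟩ := Finset.exists_min_image (Finset.univ.filter fun i => ξ i < ξ' i) ξ
        (by obtain ⟨i, hi⟩ := hall; exact ⟨i, by simpa using hi⟩)
      rw [Finset.mem_filter] at hi
      have hs : IsSink g ξ i := h.sink hi.2 (fun j hj => hm j (by simpa using hj)) hle
      obtain ⟨l, hl⟩ := ih (reflect g i ξ) ((h.left.sink hs).symm.trans h)
        (reflect_le h hle hi.2) (by
          have h1 : ∑ j, (ξ' j - reflect g i ξ j) = ∑ j, (ξ' j - ξ j) - 2 * dd g i := by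
            simp only [reflect, Finset.sum_sub_distrib, Finset.sum_add_distrib,
              Finset.sum_ite_eq', Finset.mem_univ, if_true]
            ring
          have := two_dd_pos i
          push_cast at hn
          linarith)
      exact ⟨i :: l, hs, hl⟩
    · push Not at hall
      exact ⟨[], le_antisymm hle hall⟩

theorem Compat.exists_path (h : Compat g ξ ξ') (hle : ξ ≤ ξ') : ∃ l, Path g ξ l ξ' :=
  exists_path_aux (∑ i, (ξ' i - ξ i) + 1).toNat ξ h hle (by omega)

theorem s_comm {i j : Vertex g} (hij : i ≠ j) (h : ¬Adj g i j) : s g i * s g j = s g j * s g i := by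
  have h1 : cartan g i j = 0 := by
    by_contra h1
    exact h ⟨hij, h1⟩
  refine mul_s_of_simpleRoot (s_mem_weylGroup i) ?_
  rw [s_apply]
  simp [simpleRoot, h1]

/-- Adapted words with the same ends have the same product. -/
theorem path_unique (n : ℕ) : ∀ (ξ : Vertex g → ℤ) (l m : List (Vertex g)), HF g ξ →
    l.length = n → Path g ξ l ξ' → Path g ξ m ξ' → wordProd g l = wordProd g m := by
  induction n with
  | zero =>
    intro ξ l m _ hn hl hm
    rw [List.length_eq_zero_iff] at hn
    subst hn
    have : m = [] := by
      rw [List.eq_nil_iff_forall_not_mem]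
      exact fun j => hm.notMem (by rw [show ξ = ξ' from hl])
    rw [this]
  | succ n ih =>
    intro ξ l m hξ hn hl hm
    rcases l with _ | ⟨i, l⟩
    · simp at hn
    have hlen : m.length = n + 1 := by
      have h1 := hl.length
      rw [← hm.length, hn] at h1
      have : (0 : ℤ) < 2 * ordSigma g := by have := ordSigma_pos g; omega
      exact_mod_cast (mul_left_cancel₀ this.ne' h1).symm
    rcases m with _ | ⟨j, m⟩
    · simp at hlen
    simp only [List.length_cons, Nat.add_right_cancel_iff] at hn hlen
    by_cases hij : i = j
    · subst hij
      rw [wordProd_cons, wordProd_cons, ih _ l m (hξ.sink hl.1).right hn hl.2 hm.2]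
    -- Diamond argument. Two distinct sinks are not adjacent, so they can be reflected in either
    -- order, with commuting reflections. Both words are compared with words that begin with i, j
    -- respectively j, i and then continue by one common word p.
    · have hadj : ¬Adj g i j := fun h => by
        have h1 := hl.1 j h
        have h2 := hm.1 i (adj_symm g h)
        omega
      have hsj : IsSink g (reflect g i ξ) j := fun k hk => by
        rw [reflect_of_ne (Ne.symm hij), reflect_of_ne]
        · exact hm.1 k hk
        · rintro rfl; exact hadj (adj_symm g hk)
      have hsi : IsSink g (reflect g j ξ) i := fun k hk => by
        rw [reflect_of_ne hij, reflect_of_ne]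
        · exact hl.1 k hk
        · rintro rfl; exact hadj hk
      have hc : reflect g i (reflect g j ξ) = reflect g j (reflect g i ξ) := by
        funext k; simp only [reflect]; ring
      have h1 := (hξ.sink hl.1).right
      have h2 := (hξ.sink hm.1).right
      have hjl : j ∈ l := by
        by_contra hj
        have := hl.2.apply j
        rw [List.count_eq_zero.2 hj, reflect_of_ne (Ne.symm hij)] at this
        have h3 := hm.2.le j
        rw [reflect_self] at h3
        have := two_dd_pos j
        simp at *
        omega
      have hle : reflect g j (reflect g i ξ) ≤ ξ' := by
        refine reflect_le (hl.2.compat h1) hl.2.le ?_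
        rw [hl.2.apply j]
        have h3 := two_dd_pos j
        have h4 : (0 : ℤ) < l.count j := by exact_mod_cast List.count_pos_iff.2 hjl
        nlinarith
      obtain ⟨p, hp⟩ := ((h1.sink hsj).symm.trans (hl.2.compat h1)).exists_path hle
      rw [wordProd_cons, wordProd_cons, ih _ l (j :: p) h1 hn hl.2 ⟨hsj, hp⟩,
        ih _ m (i :: p) h2 hlen hm.2 ⟨hsi, by rwa [hc]⟩, wordProd_cons, wordProd_cons,
        ← mul_assoc, ← mul_assoc, s_comm hij hadj]

theorem Path.wordProd_eq {l m : List (Vertex g)} (hl : Path g ξ l ξ') (hm : Path g ξ m ξ')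
    (h : HF g ξ) : wordProd g l = wordProd g m :=
  path_unique _ ξ l m h rfl hl hm

end QData

namespace QData
variable {g : AffineType} {ξ ξ' ξ'' : Vertex g → ℤ}

/-! ### The transition elements between height functions -/

open Classical in
/-- The product of the adapted words from `ξ` to `ξ'`, when there are any. -/
noncomputable def up (g : AffineType) (ξ ξ' : Vertex g → ℤ) : Weight g ≃ₗ[ℤ] Weight g :=
  if h : ∃ l, Path g ξ l ξ' then wordProd g h.choose else 1

theorem Path.up_eq {l : List (Vertex g)} (h : Path g ξ l ξ') (hξ : HF g ξ) :
    up g ξ ξ' = wordProd g l := by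
  have h1 : ∃ l, Path g ξ l ξ' := ⟨l, h⟩
  rw [up, dif_pos h1]
  exact h1.choose_spec.wordProd_eq h hξ

theorem up_self (h : HF g ξ) : up g ξ ξ = 1 := Path.up_eq (l := []) rfl h

theorem up_mem (ξ ξ' : Vertex g → ℤ) : up g ξ ξ' ∈ weylGroup g := by
  rw [up]
  split_ifs
  · exact wordProd_mem _
  · exact one_mem _

theorem up_mul (h : Compat g ξ ξ') (h' : Compat g ξ' ξ'') (hle : ξ ≤ ξ') (hle' : ξ' ≤ ξ'') :
    up g ξ ξ' * up g ξ' ξ'' = up g ξ ξ'' := by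
  obtain ⟨l, hl⟩ := h.exists_path hle
  obtain ⟨m, hm⟩ := h'.exists_path hle'
  rw [hl.up_eq h.left, hm.up_eq h'.left, ← wordProd_append,
    (path_append.2 ⟨_, hl, hm⟩).up_eq h.left]

/-- The transition element between two congruent height functions. -/
noncomputable def tr (g : AffineType) (ξ ξ' : Vertex g → ℤ) : Weight g ≃ₗ[ℤ] Weight g :=
  (up g (ξ ⊓ ξ') ξ)⁻¹ * up g (ξ ⊓ ξ') ξ'

theorem tr_mem (ξ ξ' : Vertex g → ℤ) : tr g ξ ξ' ∈ weylGroup g :=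
  mul_mem (inv_mem (up_mem _ _)) (up_mem _ _)

/-- Any common lower bound may replace the minimum, which makes multiplicativity of `tr` a
cancellation above a lower bound common to three functions. -/
theorem tr_of_le {n : Vertex g → ℤ} (hn : Compat g n ξ) (h : Compat g ξ ξ') (h1 : n ≤ ξ)
    (h2 : n ≤ ξ') : tr g ξ ξ' = (up g n ξ)⁻¹ * up g n ξ' := by
  have hm := hn.trans h.inf
  have h3 : n ≤ ξ ⊓ ξ' := le_inf h1 h2
  rw [← up_mul hm (hm.symm.trans hn) h3 inf_le_left,
    ← up_mul hm (hm.symm.trans (hn.trans h)) h3 inf_le_right, tr]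
  group

theorem tr_mul (h : Compat g ξ ξ') (h' : Compat g ξ' ξ'') :
    tr g ξ ξ' * tr g ξ' ξ'' = tr g ξ ξ'' := by
  have h1 := h.inf
  have h2 : Compat g ξ (ξ ⊓ ξ' ⊓ ξ'') := h1.trans (h1.symm.trans (h.trans h')).inf
  have l1 : ξ ⊓ ξ' ⊓ ξ'' ≤ ξ := inf_le_left.trans inf_le_left
  have l2 : ξ ⊓ ξ' ⊓ ξ'' ≤ ξ' := inf_le_left.trans inf_le_right
  have l3 : ξ ⊓ ξ' ⊓ ξ'' ≤ ξ'' := inf_le_right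
  rw [tr_of_le h2.symm h l1 l2, tr_of_le (h2.symm.trans h) h' l2 l3,
    tr_of_le h2.symm (h.trans h') l1 l3]
  group

theorem tr_self (ξ : Vertex g → ℤ) : tr g ξ ξ = 1 := by rw [tr, inv_mul_cancel]

theorem tr_inv (h : Compat g ξ ξ') : (tr g ξ ξ')⁻¹ = tr g ξ' ξ := by
  rw [inv_eq_iff_mul_eq_one, tr_mul h h.symm, tr_self]

theorem Path.tr_eq {l : List (Vertex g)} (h : Path g ξ l ξ') (hξ : HF g ξ) :
    tr g ξ ξ' = wordProd g l := by
  rw [tr_of_le hξ.refl (h.compat hξ) le_rfl h.le, up_self hξ, _root_.inv_one, one_mul, h.up_eq hξ]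

theorem tr_sink (h : HF g ξ) {i : Vertex g} (hi : IsSink g ξ i) :
    tr g ξ (reflect g i ξ) = s g i := by
  rw [Path.tr_eq (l := [i]) ⟨hi, rfl⟩ h, wordProd_singleton]

/-- The minimum of ξ and ξ' has the same value at i as both, so neither adapted word starting from
it contains the letter i, and the other letters fix Λ_i. -/
theorem tr_fundWeight (h : Compat g ξ ξ') {i : Vertex g} (hi : ξ i = ξ' i) :
    tr g ξ ξ' (fundWeight g i) = fundWeight g i := by
  have key : ∀ {a : Vertex g → ℤ}, Compat g (ξ ⊓ ξ') a → ξ ⊓ ξ' ≤ a → a i = ξ i →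
      up g (ξ ⊓ ξ') a (fundWeight g i) = fundWeight g i := by
    intro a hc hle ha
    obtain ⟨l, hl⟩ := hc.exists_path hle
    rw [hl.up_eq hc.left]
    exact wordProd_fundWeight (hl.notMem (by rw [ha, Pi.inf_apply, ← hi]; simp))
  have h1 := h.inf
  rw [tr, LinearEquiv.mul_apply, key (h1.symm.trans h) inf_le_right hi.symm]
  have h2 := key h1.symm inf_le_left rfl
  conv_lhs => rw [← h2]
  rw [← LinearEquiv.mul_apply, inv_mul_cancel, LinearEquiv.coe_one, id]

/-! ### Diagram automorphisms and shifts -/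

/-- The height function moved by a permutation of the vertices and a shift. -/
def move (π : Equiv.Perm (Vertex g)) (c : ℤ) (ξ : Vertex g → ℤ) : Vertex g → ℤ :=
  fun k => ξ (π.symm k) + c

theorem move_apply (π : Equiv.Perm (Vertex g)) (c : ℤ) (ξ : Vertex g → ℤ) (k : Vertex g) :
    move π c ξ (π k) = ξ k + c := by rw [move, π.symm_apply_apply]

variable {π : Equiv.Perm (Vertex g)}

theorem HF.move (hπ : IsAut g π) (h : HF g ξ) (c : ℤ) : HF g (QData.move π c ξ) := by
  have hπ' := hπ.symm
  have he : ∀ i j, edge g (π.symm i) (π.symm j) = edge g i j := fun i j => by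
    rw [edge, edge, hπ'.dd, hπ'.dd]
  refine ⟨fun i j hij => ?_, fun i j hij => ?_, fun i => ?_⟩
  · have := h.bound _ _ (hπ'.adj.2 hij)
    rw [he, hπ'.dd] at this
    simp only [QData.move]
    omega
  · have := h.cong _ _ (hπ'.adj.2 hij)
    rw [he] at this
    simp only [QData.move]
    rwa [add_sub_add_right_eq_sub]
  · have := h.sig (π.symm i)
    rw [hπ'.dd, ← hπ'.comm] at this
    simp only [QData.move]
    rwa [add_sub_add_right_eq_sub]

theorem Compat.move (hπ : IsAut g π) (h : Compat g ξ ξ') (c : ℤ) :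
    Compat g (QData.move π c ξ) (QData.move π c ξ') := by
  refine ⟨h.left.move hπ c, h.right.move hπ c, fun i => ?_⟩
  have := h.dvd (π.symm i)
  rw [hπ.symm.dd] at this
  simp only [QData.move]
  rwa [add_sub_add_right_eq_sub]

theorem IsSink.move (hπ : IsAut g π) {i : Vertex g} (h : IsSink g ξ i) (c : ℤ) :
    IsSink g (QData.move π c ξ) (π i) := by
  intro j hj
  rw [move_apply, QData.move, add_lt_add_iff_right]
  refine h _ ?_
  rw [← hπ.adj, π.apply_symm_apply]
  exact hj

theorem move_reflect (hπ : IsAut g π) (i : Vertex g) (c : ℤ) (ξ : Vertex g → ℤ) :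
    move π c (reflect g i ξ) = reflect g (π i) (move π c ξ) := by
  funext k
  simp only [move, reflect, hπ.dd, Equiv.symm_apply_eq]
  ring

theorem Path.move (hπ : IsAut g π) {l : List (Vertex g)} (h : Path g ξ l ξ') (c : ℤ) :
    Path g (QData.move π c ξ) (l.map π) (QData.move π c ξ') := by
  induction l generalizing ξ with
  | nil => rw [show ξ = ξ' from h]; rfl
  | cons i l ih =>
    refine ⟨h.1.move hπ c, ?_⟩
    rw [← move_reflect hπ]
    exact ih h.2

theorem up_move (hπ : IsAut g π) (h : Compat g ξ ξ') (hle : ξ ≤ ξ') (c : ℤ) :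
    up g (move π c ξ) (move π c ξ') = permP π * up g ξ ξ' * (permP π)⁻¹ := by
  obtain ⟨l, hl⟩ := h.exists_path hle
  rw [hl.up_eq h.left, (hl.move hπ c).up_eq (h.left.move hπ c), permP_wordProd hπ,
    mul_inv_cancel_right]

theorem move_inf (c : ℤ) (ξ ξ' : Vertex g → ℤ) :
    move π c (ξ ⊓ ξ') = move π c ξ ⊓ move π c ξ' := by
  funext k
  exact (min_add_add_right _ _ _).symm

theorem tr_move (hπ : IsAut g π) (h : Compat g ξ ξ') (c : ℤ) :
    tr g (move π c ξ) (move π c ξ') = permP π * tr g ξ ξ' * (permP π)⁻¹ := by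
  have h1 := h.inf
  rw [tr, tr, ← move_inf, up_move hπ h1.symm inf_le_left,
    up_move hπ (h1.symm.trans h) inf_le_right]
  group

theorem tr_move_star (h : Compat g ξ ξ') (c : ℤ) :
    tr g (move (starPerm g) c ξ) (move (starPerm g) c ξ') = w0 g * tr g ξ ξ' * w0 g := by
  rw [tr_move (isAut_star g) h, w0_conj]

theorem move_star_apply (c : ℤ) (ξ : Vertex g → ℤ) (k : Vertex g) :
    move (starPerm g) c ξ k = ξ (star g k) + c := rfl

/-- The height function `σ ξ + 2`. -/
def rot (g : AffineType) (ξ : Vertex g → ℤ) : Vertex g → ℤ := move (sigma g) 2 ξ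

theorem rot_sigma (ξ : Vertex g → ℤ) (k : Vertex g) : rot g ξ (sigma g k) = ξ k + 2 :=
  move_apply _ _ _ _

theorem HF.rot (h : HF g ξ) : Compat g ξ (rot g ξ) := by
  refine ⟨h, h.move (isAut_sigma g) 2, fun i => ?_⟩
  obtain ⟨j, rfl⟩ := (sigma g).surjective i
  rw [rot_sigma, dd_sigma]
  have := (h.sig j).neg_right
  rwa [neg_sub, sub_sub_eq_add_sub, add_comm] at this

/-- The Coxeter element attached to a height function. -/
noncomputable def cox (g : AffineType) (ξ : Vertex g → ℤ) : Weight g ≃ₗ[ℤ] Weight g :=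
  tr g ξ (rot g ξ) * sigmaP g

theorem tr_rot (h : Compat g ξ ξ') :
    tr g (rot g ξ) (rot g ξ') * sigmaP g = sigmaP g * tr g ξ ξ' := by
  rw [rot, rot, tr_move (isAut_sigma g) h, permP_sigma, inv_mul_cancel_right]

/-- Both sides equal `tr g ξ (rot g ξ')` followed by σ. At a sink this is the rule τ ↦ s_i τ s_i. -/
theorem tr_mul_cox (h : Compat g ξ ξ') : tr g ξ ξ' * cox g ξ' = cox g ξ * tr g ξ ξ' := by
  rw [cox, cox, mul_assoc, ← tr_rot h, ← mul_assoc, ← mul_assoc, tr_mul h h.right.rot,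
    tr_mul h.left.rot (h.left.rot.symm.trans (h.trans h.right.rot))]

theorem cox_tr (h : Compat g ξ ξ') (i : Vertex g) :
    cox g ξ (tr g ξ ξ' (fundWeight g i)) = tr g ξ (rot g ξ') (fundWeight g (sigma g i)) := by
  rw [cox, ← LinearEquiv.mul_apply, mul_assoc, ← tr_rot h, ← mul_assoc,
    tr_mul h.left.rot (h.left.rot.symm.trans (h.trans h.right.rot)), LinearEquiv.mul_apply,
    ← permP_sigma, permP_fundWeight]

theorem cox_pow_tr (h : Compat g ξ ξ') (i : Vertex g) (k : ℕ) :
    Compat g ξ ((rot g)^[k] ξ') ∧ (∀ j, (rot g)^[k] ξ' ((sigma g ^ k) j) = ξ' j + 2 * k) ∧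
    (cox g ξ ^ k) (tr g ξ ξ' (fundWeight g i)) =
      tr g ξ ((rot g)^[k] ξ') (fundWeight g ((sigma g ^ k) i)) := by
  induction k with
  | zero => exact ⟨h, fun j => by simp, rfl⟩
  | succ k ih =>
    rw [Function.iterate_succ_apply']
    refine ⟨ih.1.trans ih.1.right.rot, fun j => ?_, ?_⟩
    · rw [pow_succ', Equiv.Perm.mul_apply, rot_sigma, ih.2.1]
      push_cast; ring
    · rw [pow_succ', LinearEquiv.mul_apply, ih.2.2, cox_tr ih.1, pow_succ', Equiv.Perm.mul_apply]

/-- The transported weight depends on the target only through its value at i; hence it may be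
indexed by the pair (i, p). -/
theorem tr_fundWeight_congr {a b : Vertex g → ℤ} (ha : Compat g ξ a) (hb : Compat g ξ b)
    {i : Vertex g} (h : a i = b i) : tr g ξ a (fundWeight g i) = tr g ξ b (fundWeight g i) := by
  have hab := ha.symm.trans hb
  rw [← tr_mul ha hab, LinearEquiv.mul_apply, tr_fundWeight hab h]

/-! ### Height functions in the sense of the definition -/

/-- Along edges with equal d the bounds and the congruence leave only ±d. At a σ-fixed vertex i next
to a longer orbit, the heights on the orbit lie in [ξ_i - 1, ξ_i + 2d - 1] and advance by 2 modulo
2d along σ, so they form a single run. -/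
theorem HF.isHeight (h : HF g ξ) : IsHeight g ξ := by
  constructor
  · intro i j hij hd
    have he : edge g i j = dd g i := by rw [edge, hd, min_self]
    have h1 := h.bound i j hij
    have h2 := h.bound j i (adj_symm g hij)
    rw [edge_symm, ← hd] at h2
    have hp := dd_pos g i
    rw [he] at h1 h2
    rcases lt_or_ge (ξ i) (ξ j) with hlt | hlt
    · have := (h.lt_iff hij).1 hlt
      rw [he] at this
      rw [abs_of_neg (by omega)]
      omega
    · have h3 := lt_of_le_of_ne hlt (h.ne (adj_symm g hij))
      have := (h.lt_iff (adj_symm g hij)).1 h3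
      rw [edge_symm, he] at this
      rw [abs_of_pos (by omega)]
      omega
  · intro i j hij h1 hlt hD
    have hDj : 1 < dd g j := by omega
    have hsi := sigma_eq_of_dd g h1.symm
    have hsik : ∀ k : ℕ, (sigma g ^ k) i = i := fun k => by
      rw [sigma_pow_eq_self_iff, ← h1]; exact one_dvd _
    have hadj : ∀ k : ℕ, Adj g i ((sigma g ^ k) j) := by
      intro k
      induction k with
      | zero => exact hij
      | succ k ih =>
        rw [pow_succ', Equiv.Perm.mul_apply]
        have := (adj_sigma g).2 ih
        rwa [hsi] at this
    have he : ∀ k : ℕ, edge g i ((sigma g ^ k) j) = 1 := fun k => by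
      rw [edge, dd_sigma_pow, ← h1]
      exact min_eq_left (by exact_mod_cast hDj.le)
    have hlo : ∀ k : ℕ, ξ i - 1 ≤ ξ ((sigma g ^ k) j) := fun k => by
      have := h.bound _ _ (hadj k)
      rw [he, ← h1, Nat.cast_one] at this
      omega
    have hhi : ∀ k : ℕ, ξ ((sigma g ^ k) j) ≤ ξ i + 2 * dd g j - 1 := fun k => by
      have := h.bound _ _ (adj_symm g (hadj k))
      rw [edge_symm, he, dd_sigma_pow] at this
      omega
    have hodd : (2 : ℤ) ∣ ξ j - ξ i - 1 := by
      have := h.cong j i (adj_symm g hij)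
      rw [edge_symm, show edge g i j = 1 from he 0] at this
      simpa using this
    -- the first vertex of the orbit
    obtain ⟨k₀, hk₀⟩ : ∃ k : ℕ, (2 * dd g j : ℤ) ∣ ξ ((sigma g ^ k) j) - (ξ i - 1) := by
      obtain ⟨m, hm⟩ := hodd
      obtain ⟨k, hk⟩ : ∃ k : ℕ, (dd g j : ℤ) ∣ m + 1 + k := by
        refine ⟨(-(m + 1) % dd g j).toNat, ?_⟩
        rw [Int.toNat_of_nonneg (Int.emod_nonneg _ (by omega))]
        have := Int.dvd_self_sub_of_emod_eq (a := -(m + 1)) (b := dd g j) rfl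
        have := this.neg_right
        rwa [neg_sub, sub_neg_eq_add, add_comm] at this
      refine ⟨k, ?_⟩
      have h2 := (h.sig_pow j k).add (mul_dvd_mul_left 2 hk)
      rwa [show ξ ((sigma g ^ k) j) - ξ j - 2 * k + 2 * (m + 1 + k) =
        ξ ((sigma g ^ k) j) - (ξ i - 1) by linarith] at h2
    have hseq : ∀ k : ℕ, (2 * dd g j : ℤ) ∣ ξ ((sigma g ^ (k + k₀)) j) - (ξ i - 1 + 2 * k) := by
      intro k
      have h2 := h.sig_pow ((sigma g ^ k₀) j) k
      rw [dd_sigma_pow, ← Equiv.Perm.mul_apply, ← pow_add] at h2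
      have := h2.add hk₀
      rwa [show ξ ((sigma g ^ (k + k₀)) j) - ξ ((sigma g ^ k₀) j) - 2 * k +
        (ξ ((sigma g ^ k₀) j) - (ξ i - 1)) = ξ ((sigma g ^ (k + k₀)) j) - (ξ i - 1 + 2 * k) by
        ring] at this
    have hval : ∀ k : ℕ, 1 ≤ k → k < dd g j →
        ξ ((sigma g ^ (k + k₀)) j) = ξ i - 1 + 2 * k := by
      intro k hk1 hk2
      have := hlo (k + k₀)
      have := hhi (k + k₀)
      exact eq_of_dvd_sub (hseq k) (by omega) (by omega)
    have huniq : ∀ j₁ j₂, ((sigma g).SameCycle j j₁ ∧ |ξ i - ξ j₁| = 1 ∧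
        ∀ k : ℕ, k < ordSigma g → ξ ((sigma g ^ k) j₁) = ξ j₁ + 2 * k) →
        ((sigma g).SameCycle j j₂ ∧ |ξ i - ξ j₂| = 1 ∧
        ∀ k : ℕ, k < ordSigma g → ξ ((sigma g ^ k) j₂) = ξ j₂ + 2 * k) → j₁ = j₂ := by
      rintro j₁ j₂ ⟨a1, -, a3⟩ ⟨b1, -, b3⟩
      obtain ⟨k, hk, hk'⟩ := (sameCycle_iff g).1 (a1.symm.trans b1)
      obtain ⟨m, hm, hm'⟩ := (sameCycle_iff g).1 (b1.symm.trans a1)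
      rw [dd_of_sameCycle g a1, hD] at hk
      rw [dd_of_sameCycle g b1, hD] at hm
      have e1 := a3 k hk
      have e2 := b3 m hm
      rw [hk'] at e1
      rw [hm'] at e2
      have : k = 0 := by omega
      subst this
      exact hk'
    suffices hex : ∃ j₀, (sigma g).SameCycle j j₀ ∧ |ξ i - ξ j₀| = 1 ∧
        ∀ k : ℕ, k < ordSigma g → ξ ((sigma g ^ k) j₀) = ξ j₀ + 2 * k by
      obtain ⟨j₀, hj₀⟩ := hex
      exact ⟨j₀, hj₀, fun y hy => huniq y j₀ hy hj₀⟩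
    rw [← hD]
    -- The vertex with residue ξ_i - 1 sits at one of the two ends of the interval. At the lower end
    -- it starts the run; at the upper end it closes the run, which then starts one σ-step later at
    -- height ξ_i + 1.
    by_cases hfirst : ξ ((sigma g ^ k₀) j) = ξ i - 1
    · refine ⟨(sigma g ^ k₀) j, sameCycle_pow j k₀, by rw [hfirst]; simp, fun k hk => ?_⟩
      rw [← Equiv.Perm.mul_apply, ← pow_add, hfirst]
      rcases Nat.eq_zero_or_pos k with rfl | hk0
      · rw [zero_add, hfirst]; simp
      · exact hval k hk0 hk
    · have hlast : ξ ((sigma g ^ k₀) j) = ξ i - 1 + 2 * dd g j := by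
        have h2 := hlo k₀
        have h3 := hhi k₀
        have h4 := Int.le_of_dvd (by omega) hk₀
        omega
      refine ⟨(sigma g ^ (1 + k₀)) j, sameCycle_pow j _, by
          rw [hval 1 le_rfl hDj, show ξ i - (ξ i - 1 + 2 * (1 : ℕ)) = -1 by push_cast; ring]; rfl,
        fun k hk => ?_⟩
      rw [← Equiv.Perm.mul_apply, ← pow_add, ← add_assoc, hval 1 le_rfl hDj]
      rcases Nat.lt_or_ge (k + 1) (dd g j) with hk1 | hk1
      · rw [hval (k + 1) (by omega) hk1]
        push_cast; ring
      · have : k + 1 = dd g j := by omega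
        rw [this, pow_add, Equiv.Perm.mul_apply, ← dd_sigma_pow j k₀, sigma_pow_dd, hlast,
          ← this]
        push_cast; ring

theorem IsHeight.hf (h : IsHeight g ξ) : HF g ξ := by
  have hlt : ∀ i j, Adj g i j → sigma g i = i → sigma g j ≠ j →
      ∃ j₀, |ξ i - ξ j₀| = 1 ∧ (∃ k < dd g j, (sigma g ^ k) j₀ = j) ∧ dd g j₀ = dd g j ∧
        ∀ k : ℕ, k < dd g j → ξ ((sigma g ^ k) j₀) = ξ j₀ + 2 * k := by
    intro i j hij hi hj
    have h1 := dd_of_fixed g hi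
    have h2 := dd_of_not_fixed g hj
    have h3 : 1 < dd g j := by
      rcases dd_eq_one_or g j with h | h
      · exact absurd (sigma_eq_of_dd g h) hj
      · have := dd_pos g j
        rcases Nat.lt_or_ge 1 (dd g j) with h | h
        · exact h
        · exact absurd (sigma_eq_of_dd g (by omega)) hj
    obtain ⟨j₀, ⟨a, b, c⟩, -⟩ := h.lt_case i j hij h1.symm (by omega) h2
    have h4 := dd_of_sameCycle g a
    refine ⟨j₀, b, ?_, h4, by rwa [h2]⟩
    rw [← h4]
    exact (sameCycle_iff g).1 a.symm
  have heq : ∀ i j, Adj g i j → dd g i = dd g j →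
      ξ i - ξ j = dd g i ∨ ξ i - ξ j = -dd g i := fun i j hij hd => by
    have := h.eq_case i j hij hd
    rcases abs_choice (ξ i - ξ j) with h1 | h1 <;> omega
  have hsig : ∀ i, (2 * dd g i : ℤ) ∣ ξ (sigma g i) - ξ i - 2 := by
    obtain ⟨i₀, hi₀⟩ := exists_sigma_fixed g
    have hfix : ∀ i, sigma g i = i → (2 * dd g i : ℤ) ∣ ξ (sigma g i) - ξ i - 2 := by
      intro i hi
      rw [hi, dd_of_fixed g hi]
      norm_num
    -- The congruence along σ spreads over the diagram from a fixed vertex. Across an edge between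
    -- two nontrivial orbits it is transported because the differences on the edge and on its
    -- σ-image are both ±d, hence agree modulo 2d.
    refine connected_induction g i₀ (hfix i₀ hi₀) fun i j hij ih => ?_
    by_cases hj : sigma g j = j
    · exact hfix j hj
    by_cases hi : sigma g i = i
    · obtain ⟨j₀, -, ⟨k, hk, rfl⟩, hd, hs⟩ := hlt i j hij hi hj
      rw [← Equiv.Perm.mul_apply, ← pow_succ', hs k hk]
      rcases Nat.lt_or_ge (k + 1) (dd g ((sigma g ^ k) j₀)) with hk1 | hk1
      · rw [hs _ hk1]
        refine ⟨0, ?_⟩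
        push_cast; ring
      · have e : k + 1 = dd g j₀ := by omega
        rw [← hd]
        conv_rhs => rw [e, sigma_pow_dd]
        refine ⟨-1, ?_⟩
        rw [← e]
        push_cast; ring
    · have hd : dd g i = dd g j := by rw [dd_of_not_fixed g hi, dd_of_not_fixed g hj]
      have h1 := heq i j hij hd
      have h2 := heq _ _ ((adj_sigma g).2 hij) (by rw [dd_sigma, dd_sigma, hd])
      rw [dd_sigma] at h2
      rw [hd] at h1 h2 ih
      have h3 : (2 * dd g j : ℤ) ∣ (ξ (sigma g i) - ξ (sigma g j)) - (ξ i - ξ j) := by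
        rcases h1 with h1 | h1 <;> rcases h2 with h2 | h2 <;> rw [h1, h2]
        · simp
        · exact ⟨-1, by ring⟩
        · exact ⟨1, by ring⟩
        · simp
      have := ih.sub h3
      rwa [show ξ (sigma g i) - ξ i - 2 - (ξ (sigma g i) - ξ (sigma g j) - (ξ i - ξ j)) =
        ξ (sigma g j) - ξ j - 2 by ring] at this
  have key : ∀ i j, Adj g i j → (ξ i - ξ j ≤ 2 * dd g i - edge g i j ∧
      ξ j - ξ i ≤ 2 * dd g j - edge g i j) ∧ 2 * edge g i j ∣ ξ i - ξ j - edge g i j ∨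
      sigma g i ≠ i := by
    intro i j hij
    by_cases hi : sigma g i = i
    · left
      have hdi := dd_of_fixed g hi
      by_cases hj : sigma g j = j
      · have hdj := dd_of_fixed g hj
        have h1 := heq i j hij (by rw [hdi, hdj])
        rw [edge, hdi, hdj]
        rw [hdi] at h1
        simp only [Nat.cast_one, min_self]
        refine ⟨by omega, by omega⟩
      · obtain ⟨j₀, hj₀, ⟨k, hk, rfl⟩, hd, hs⟩ := hlt i j hij hi hj
        have he : edge g i ((sigma g ^ k) j₀) = 1 := by
          rw [edge, hdi]
          exact min_eq_left (by exact_mod_cast dd_pos g _)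
        rw [he, hs k hk, hdi]
        have h1 : ξ i - ξ j₀ = 1 ∨ ξ i - ξ j₀ = -1 := by
          rcases abs_choice (ξ i - ξ j₀) with h1 | h1 <;> omega
        refine ⟨⟨by push_cast; omega, by omega⟩, by omega⟩
    · exact Or.inr hi
  have hall : ∀ i j, Adj g i j → (ξ i - ξ j ≤ 2 * dd g i - edge g i j) ∧
      2 * edge g i j ∣ ξ i - ξ j - edge g i j := by
    intro i j hij
    rcases key i j hij with h1 | hi
    · exact ⟨h1.1.1, h1.2⟩
    rcases key j i (adj_symm g hij) with h1 | hj
    · rw [edge_symm j i] at h1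
      refine ⟨h1.1.2, ?_⟩
      have := h1.2.neg_right.sub (dvd_refl (2 * edge g i j))
      rwa [show -(ξ j - ξ i - edge g i j) - 2 * edge g i j = ξ i - ξ j - edge g i j by ring]
        at this
    · have hd : dd g i = dd g j := by rw [dd_of_not_fixed g hi, dd_of_not_fixed g hj]
      have h1 := heq i j hij hd
      have he : edge g i j = dd g i := by rw [edge, hd, min_self]
      rw [he]
      rcases h1 with h1 | h1 <;> rw [h1]
      · exact ⟨by omega, by simp⟩
      · exact ⟨by omega, ⟨-1, by ring⟩⟩
  exact ⟨fun i j hij => (hall i j hij).1, fun i j hij => (hall i j hij).2, hsig⟩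

end QData

namespace QData
variable {g : AffineType} {ξ ξ' : Vertex g → ℤ}

/-! ### The Coxeter elements -/

theorem adj_sigma_pow (k : ℕ) {i j : Vertex g} :
    Adj g ((sigma g ^ k) i) ((sigma g ^ k) j) ↔ Adj g i j := by
  induction k with
  | zero => rfl
  | succ k ih => rw [pow_succ', Equiv.Perm.mul_apply, Equiv.Perm.mul_apply, adj_sigma, ih]

theorem exists_orbitMin (ξ : Vertex g → ℤ) (i : Vertex g) :
    ∃ r, IsOrbitMin g ξ r ∧ dd g r = dd g i ∧ ∃ k < dd g i, (sigma g ^ k) r = i := by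
  classical
  obtain ⟨r, hr, hm⟩ := Finset.exists_min_image
    (Finset.univ.filter fun j => (sigma g).SameCycle i j) ξ
    ⟨i, Finset.mem_filter.2 ⟨Finset.mem_univ i, Equiv.Perm.SameCycle.refl _ i⟩⟩
  simp only [Finset.mem_filter, Finset.mem_univ, true_and] at hr hm
  have hd := dd_of_sameCycle g hr
  refine ⟨r, fun j hj => hm j (hr.trans hj), hd, ?_⟩
  rw [← hd]
  exact (sameCycle_iff g).1 hr.symm

theorem IsAligned.eq_zero (h : IsAligned g ξ) {r : Vertex g} (hr : IsOrbitMin g ξ r) {k : ℕ}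
    (hk : k < dd g r) (hm : IsOrbitMin g ξ ((sigma g ^ k) r)) : k = 0 := by
  have h1 := h r hr k hk
  have h2 := hm r (sameCycle_pow r k).symm
  omega

theorem IsAligned.unique (h : IsAligned g ξ) {r r' : Vertex g} (hr : IsOrbitMin g ξ r)
    (hr' : IsOrbitMin g ξ r') (hc : (sigma g).SameCycle r r') : r = r' := by
  obtain ⟨k, hk, rfl⟩ := (sameCycle_iff g).1 hc
  rw [h.eq_zero hr hk hr']
  rfl

/-- For aligned ξ the functions ξ and σξ + 2 differ only at the orbit minima, by one reflection
each. This is why τ has exactly one letter per orbit. -/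
theorem IsAligned.rot_of_min (h : IsAligned g ξ) {r : Vertex g} (hr : IsOrbitMin g ξ r) :
    rot g ξ r = ξ r + 2 * dd g r := by
  have hd := dd_pos g r
  have h1 := rot_sigma ξ ((sigma g ^ (dd g r - 1)) r)
  rw [← Equiv.Perm.mul_apply, ← pow_succ', Nat.sub_add_cancel hd, sigma_pow_dd,
    h r hr _ (by omega)] at h1
  omega

theorem IsAligned.rot_of_not_min (h : IsAligned g ξ) {i : Vertex g} (hi : ¬IsOrbitMin g ξ i) :
    rot g ξ i = ξ i := by
  obtain ⟨r, hr, hd, k, hk, rfl⟩ := exists_orbitMin ξ i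
  rw [← hd] at hk
  rcases k with _ | k
  · exact absurd hr hi
  · rw [h r hr _ hk, pow_succ', Equiv.Perm.mul_apply, rot_sigma, h r hr _ (by omega)]
    push_cast; ring

/-- It guarantees that neighbours already reflected are higher than i. The edge bound fails to
suffice only when j is fixed and i is not; then the bound is applied to the last vertex of the orbit
of i, which lies 2(d_i - 1) above i. -/
theorem IsAligned.lt_add (h : IsAligned g ξ) (hξ : HF g ξ) {i j : Vertex g}
    (hi : IsOrbitMin g ξ i) (hij : Adj g i j) : ξ i < ξ j + 2 * dd g j := by
  have h1 := hξ.bound i j hij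
  have h2 := edge_pos i j
  by_cases hd : dd g i ≤ dd g j
  · omega
  · have hj1 : dd g j = 1 := by
      have := dd_le_ordSigma g i
      rcases dd_eq_one_or g j with h | h <;> omega
    have hj : (sigma g ^ (dd g i - 1)) j = j := by
      rw [sigma_pow_eq_self_iff, hj1]; exact one_dvd _
    have h3 := (adj_sigma_pow (dd g i - 1)).2 hij
    rw [hj] at h3
    have h4 := hξ.bound _ _ h3
    have h5 := edge_pos ((sigma g ^ (dd g i - 1)) i) j
    rw [h i hi _ (by have := dd_pos g i; omega), dd_sigma_pow] at h4
    have := dd_pos g i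
    omega

/-- A power of σ moves the edge to one where the edge bound is sharp: an edge from i to the minimum
r if i is fixed, and otherwise an edge from a later vertex of the orbit of i to r. -/
theorem IsAligned.lt_of_not_min (h : IsAligned g ξ) (hξ : HF g ξ) {i j : Vertex g}
    (hi : IsOrbitMin g ξ i) (hij : Adj g i j) (hj : ¬IsOrbitMin g ξ j) : ξ i < ξ j := by
  obtain ⟨r, hr, hd, k, hk, rfl⟩ := exists_orbitMin ξ j
  rw [← hd] at hk
  have hk0 : k ≠ 0 := by
    rintro rfl
    exact hj hr
  have hjv := h r hr k hk
  rcases dd_eq_one_or g i with h1 | h1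
  · have hik : (sigma g ^ k) i = i := by
      rw [sigma_pow_eq_self_iff, h1]; exact one_dvd _
    have h3 : Adj g i r := by
      rw [← adj_sigma_pow k, hik]; exact hij
    have h4 := hξ.bound _ _ h3
    have h5 := edge_pos i r
    rw [h1] at h4
    omega
  · have h2 : dd g r = ordSigma g := by
      rcases dd_eq_one_or g r with h | h
      · omega
      · exact h
    have h3 := (adj_sigma_pow (dd g r - k)).2 hij
    rw [← Equiv.Perm.mul_apply (sigma g ^ (dd g r - k)) (sigma g ^ k), ← pow_add,
      Nat.sub_add_cancel hk.le, sigma_pow_dd] at h3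
    have h4 := hξ.bound _ _ h3
    rw [h i hi _ (by omega), edge, dd_sigma_pow, h1, h2, min_self] at h4
    omega

-- The function displayed is ξ after the minima in a have been reflected. The next minimum i is a
-- sink: neighbours in a have been raised enough, later minima are higher by the chosen order, and
-- neighbours that are not minima are higher by alignment.
open Classical in
theorem IsAligned.path_rot_aux (h : IsAligned g ξ) (hξ : HF g ξ) {l : List (Vertex g)}
    (hl : l.Nodup) (hmin : ∀ i, i ∈ l ↔ IsOrbitMin g ξ i)
    (hs : l.Pairwise fun i j => ξ i ≤ ξ j) : ∀ b a, l = a ++ b →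
    Path g (fun j => if j ∈ a then ξ j + 2 * dd g j else ξ j) b (rot g ξ) := by
  intro b
  induction b with
  | nil =>
    intro a ha
    rw [List.append_nil] at ha
    subst ha
    funext j
    by_cases hj : IsOrbitMin g ξ j
    · simp only [hmin, hj, if_true, h.rot_of_min hj]
    · simp only [hmin, hj, if_false, h.rot_of_not_min hj]
  | cons i b ih =>
    intro a ha
    have hi : IsOrbitMin g ξ i := (hmin i).1 (by rw [ha]; simp)
    rw [ha] at hl hs
    have hia : i ∉ a := fun hia => (List.nodup_append.1 hl).2.2 i hia i (by simp) rfl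
    refine ⟨fun j hij => ?_, ?_⟩
    · simp only [hia, if_false]
      split_ifs with hja
      · exact h.lt_add hξ hi hij
      · by_cases hj : IsOrbitMin g ξ j
        · have hjl := (hmin j).2 hj
          rw [ha, List.mem_append, List.mem_cons] at hjl
          rcases hjl with hjl | rfl | hjl
          · exact absurd hjl hja
          · exact absurd rfl hij.1
          · exact lt_of_le_of_ne ((List.pairwise_cons.1 (List.pairwise_append.1 hs).2.1).1 j hjl)
              (hξ.ne hij)
        · exact h.lt_of_not_min hξ hi hij hj
    · have := ih (a ++ [i]) (by rw [ha, List.append_assoc]; rfl)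
      convert this using 1
      funext j
      simp only [reflect, List.mem_append, List.mem_singleton]
      by_cases hj : j = i
      · subst hj; simp [hia]
      · simp [hj]

theorem IsAligned.path_rot (h : IsAligned g ξ) (hξ : HF g ξ) {l : List (Vertex g)}
    (hl : l.Nodup) (hmin : ∀ i, i ∈ l ↔ IsOrbitMin g ξ i)
    (hs : l.Pairwise fun i j => ξ i ≤ ξ j) : Path g ξ l (rot g ξ) := by
  classical
  have := h.path_rot_aux hξ hl hmin hs l [] rfl
  simpa using this

theorem exists_sorted_orbitMin (ξ : Vertex g → ℤ) : ∃ l : List (Vertex g), l.Nodup ∧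
    (∀ i, i ∈ l ↔ IsOrbitMin g ξ i) ∧ l.Pairwise fun i j => ξ i ≤ ξ j := by
  classical
  let r : Vertex g → Vertex g → Prop := fun i j => ξ i ≤ ξ j
  have : Std.Total r := ⟨fun i j => le_total (ξ i) (ξ j)⟩
  have : IsTrans (Vertex g) r := ⟨fun _ _ _ => le_trans⟩
  let m := (Finset.univ.filter fun i => IsOrbitMin g ξ i).toList
  refine ⟨m.insertionSort r, ?_, fun i => ?_, List.pairwise_insertionSort r m⟩
  · exact (List.perm_insertionSort r m).nodup_iff.2 (Finset.nodup_toList _)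
  · rw [(List.perm_insertionSort r m).mem_iff]
    simp [m]

theorem isCoxeterFamily_cox (g : AffineType) : IsCoxeterFamily g fun Q => cox g Q.ξ where
  base Q h l hl hmin hs := by
    have h1 : IsAligned g Q.ξ := h
    have h2 := Q.isHeight.hf
    rw [cox, (h1.path_rot h2 hl hmin hs).tr_eq h2]
  reflection Q Q' i hi hQ := by
    have h := Q.isHeight.hf
    have h1 := tr_mul_cox (h.sink hi)
    rw [tr_sink h hi, ← hQ] at h1
    rw [mul_assoc, ← h1, ← mul_assoc, s_mul_self, one_mul]

theorem IsCoxeterFamily.path_eq {τ τ' : QDatum g → (Weight g ≃ₗ[ℤ] Weight g)}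
    (hτ : IsCoxeterFamily g τ) (hτ' : IsCoxeterFamily g τ') {l : List (Vertex g)} :
    ∀ {Q Q' : QDatum g}, Path g Q.ξ l Q'.ξ → τ Q = τ' Q → τ Q' = τ' Q' := by
  induction l with
  | nil =>
    intro Q Q' h hQ
    have : Q = Q' := by
      cases Q; cases Q'
      congr 1
    rwa [← this]
  | cons i l ih =>
    intro Q Q' h hQ
    refine ih (Q := ⟨_, (Q.isHeight.hf.sink h.1).right.isHeight⟩) h.2 ?_
    rw [hτ.reflection Q _ i h.1 rfl, hτ'.reflection Q _ i h.1 rfl, hQ]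

/-- Some aligned height function lies below the given one and is joined to it by an adapted word;
the explicit product fixes the value at the start and conjugation carries it along. -/
theorem IsCoxeterFamily.eq {τ τ' : QDatum g → (Weight g ≃ₗ[ℤ] Weight g)}
    (hτ : IsCoxeterFamily g τ) (hτ' : IsCoxeterFamily g τ') : τ = τ' := by
  funext Q
  have h := Q.isHeight.hf
  obtain ⟨t, ht⟩ := exists_fl_le Q.ξ
  have hf := h.fl t
  obtain ⟨m, hm⟩ := hf.symm.exists_path ht
  let Q₀ : QDatum g := ⟨fl g Q.ξ t, hf.right.isHeight⟩
  refine hτ.path_eq hτ' (Q := Q₀) hm ?_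
  obtain ⟨l, h1, h2, h3⟩ := exists_sorted_orbitMin (fl g Q.ξ t)
  rw [hτ.base Q₀ (h.isAligned_fl t) l h1 h2 h3, hτ'.base Q₀ (h.isAligned_fl t) l h1 h2 h3]

theorem existsUnique_coxeterFamily (g : AffineType) : ∃! τ, IsCoxeterFamily g τ :=
  ⟨_, isCoxeterFamily_cox g, fun _ h => h.eq (isCoxeterFamily_cox g)⟩

theorem coxeter_eq (Q : QDatum g) : coxeter g Q = cox g Q.ξ := by
  have h : IsCoxeterFamily g (coxeter g) :=
    Classical.epsilon_spec (p := IsCoxeterFamily g) ⟨_, isCoxeterFamily_cox g⟩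
  rw [h.eq (isCoxeterFamily_cox g)]

end QData

namespace QData
variable {g : AffineType}

/-! ### Orbits of a Coxeter element on the roots -/

/-- A periodic function on `ℤ` that decreases on `[0, N]` and increases on `[N, T]` has no period
of its increments that is not a multiple of `T`. -/
theorem dvd_of_periodic_sub {F : ℤ → ℚ} {N T : ℤ} (hT : 0 < T)
    (per : Function.Periodic F T) (dec : ∀ u, 0 ≤ u → u < N → F (u + 1) ≤ F u)
    (inc : ∀ u, N ≤ u → u < T → F u ≤ F (u + 1)) (hlt : F N < F 0) {k : ℤ}
    (hk : ∀ u, F (u + k) - F (u + k + 1) = F u - F (u + 1)) : T ∣ k := by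
  set d := k % T with hd
  have hd0 : 0 ≤ d := Int.emod_nonneg _ hT.ne'
  have hdT : d < T := Int.emod_lt_of_pos _ hT
  have hFd : ∀ u, F (u + k) = F (u + d) := by
    intro u
    have h1 : u + k = u + d + (k / T) * T := by
      have := Int.emod_add_mul_ediv k T
      rw [mul_comm] at this
      omega
    rw [h1]
    exact per.int_mul (k / T) (u + d)
  have hE : ∀ u, F (u + d) - F u = F (0 + d) - F 0 := by
    have h1 : ∀ u, F (u + 1 + d) - F (u + 1) = F (u + d) - F u := by
      intro u
      have := hk u
      rw [show u + k + 1 = u + 1 + k by ring, hFd, hFd] at this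
      linarith
    intro u
    induction u using Int.induction_on with
    | zero => rfl
    | succ i ih => rw [h1, ih]
    | pred i ih =>
      have := h1 (-i - 1)
      rw [sub_add_cancel] at this
      rw [← this, ih]
  -- F(u + d) - F(u) is a constant; adding it T times leads from F(0) to F(dT) = F(0), so the
  -- constant is zero and d is itself a period of F.
  have he : F (0 + d) - F 0 = 0 := by
    have h1 : ∀ n : ℕ, F (n * d) = F 0 + n * (F (0 + d) - F 0) := by
      intro n
      induction n with
      | zero => simp
      | succ n ih =>
        have := hE (n * d)
        push_cast
        rw [add_mul, one_mul]
        linarith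
    have h2 := h1 T.toNat
    rw [Int.toNat_of_nonneg hT.le, mul_comm] at h2
    have h3 : F (d * T) = F 0 := by simpa using per.int_mul d 0
    rw [h3] at h2
    have h4 : (T.toNat : ℚ) ≠ 0 := by
      have : 0 < T.toNat := by omega
      exact_mod_cast this.ne'
    have h5 : (T.toNat : ℚ) * (F (0 + d) - F 0) = 0 := by linarith
    exact (mul_eq_zero.1 h5).resolve_left h4
  have pd : Function.Periodic F d := fun u => by have := hE u; linarith
  have hanti : ∀ x, 0 ≤ x → ∀ y, x ≤ y → y ≤ N → F y ≤ F x := by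
    intro x hx y hxy
    induction y, hxy using Int.leInduction with
    | base => exact fun _ => le_rfl
    | succ y hy ih => exact fun h => (dec y (by omega) (by omega)).trans (ih (by omega))
  have hmono : ∀ x, N ≤ x → ∀ y, x ≤ y → y ≤ T → F x ≤ F y := by
    intro x hx y hxy
    induction y, hxy using Int.leInduction with
    | base => exact fun _ => le_rfl
    | succ y hy ih => exact fun h => (ih (by omega)).trans (inc y (by omega) (by omega))
  have hF0d : F d = F 0 := by rw [← pd 0, zero_add]
  have hF0T : F T = F 0 := by rw [← per 0, zero_add]
  by_cases hdz : d = 0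
  · exact Int.dvd_of_emod_eq_zero hdz
  exfalso
  -- A whole period d lies in the decreasing range [0, N], or a whole period T - d lies in the
  -- increasing range [N, T]. Reducing N into that interval gives F(0) ≤ F(N), a contradiction.
  rcases le_total d N with h | h
  · have h1 : F N = F (N % d) := by
      conv_lhs => rw [← Int.emod_add_mul_ediv N d, mul_comm]
      exact pd.int_mul _ _
    have h2 := hanti (N % d) (Int.emod_nonneg _ hdz) d
      (Int.emod_lt_of_pos _ (by omega)).le h
    linarith
  · have pe : Function.Periodic F (T - d) := per.sub_period pd
    have h1 : F N = F (d + (N - d) % (T - d)) := by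
      have : F (d + (N - d) % (T - d) + ((N - d) / (T - d)) * (T - d)) =
        F (d + (N - d) % (T - d)) := pe.int_mul _ _
      rw [← this]
      congr 1
      have := Int.emod_add_mul_ediv (N - d) (T - d)
      rw [mul_comm] at this
      omega
    have h2 := Int.emod_nonneg (N - d) (show T - d ≠ 0 by omega)
    have h3 := Int.emod_lt_of_pos (N - d) (show 0 < T - d by omega)
    have h4 := hmono d h (d + (N - d) % (T - d)) (by omega) (by omega)
    linarith

/-! ### Fundamental weights summed over a σ-orbit -/

open Classical in
/-- The sum of the fundamental weights of a `σ`-orbit. -/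
noncomputable def orbitWeight (g : AffineType) (i : Vertex g) : Weight g :=
  fun k => if (sigma g).SameCycle i k then 1 else 0

open Classical in
theorem orbitWeight_eq_sum (i : Vertex g) : orbitWeight g i =
    ∑ j ∈ Finset.univ.filter (fun j => (sigma g).SameCycle i j), fundWeight g j := by
  ext k
  simp [orbitWeight, fundWeight, Finset.sum_apply, Pi.single_apply]

theorem orbitWeight_congr {i j : Vertex g} (h : (sigma g).SameCycle i j) :
    orbitWeight g i = orbitWeight g j := by
  funext k
  have : (sigma g).SameCycle i k ↔ (sigma g).SameCycle j k := ⟨h.symm.trans, h.trans⟩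
  simp only [orbitWeight, this]

theorem orbitWeight_self (i : Vertex g) : orbitWeight g i i = 1 := by
  rw [orbitWeight, if_pos (Equiv.Perm.SameCycle.refl _ _)]

theorem isDominant_orbitWeight (i : Vertex g) : IsDominant (orbitWeight g i) := by
  intro k
  rw [orbitWeight]
  split_ifs <;> simp

theorem orbitWeight_injective {i j : Vertex g} (h : orbitWeight g i = orbitWeight g j) :
    (sigma g).SameCycle j i := by
  by_contra hc
  have := congrFun h i
  rw [orbitWeight_self, orbitWeight, if_neg hc] at this
  exact one_ne_zero this

theorem sigmaP_orbitWeight (i : Vertex g) : sigmaP g (orbitWeight g i) = orbitWeight g i := by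
  funext k
  have h : (sigma g).SameCycle i ((sigma g).symm k) ↔ (sigma g).SameCycle i k :=
    Equiv.Perm.sameCycle_symm_apply_right
  rw [← permP_sigma, permP_apply]
  simp only [orbitWeight, h]

theorem sigmaP_pow_fundWeight (i : Vertex g) (k : ℕ) :
    (sigmaP g ^ k) (fundWeight g i) = fundWeight g ((sigma g ^ k) i) := by
  induction k with
  | zero => rfl
  | succ k ih =>
    rw [pow_succ', LinearEquiv.mul_apply, ih, ← permP_sigma, permP_fundWeight, pow_succ',
      Equiv.Perm.mul_apply]

theorem sigmaP_pow_orbitWeight (i : Vertex g) (k : ℕ) :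
    (sigmaP g ^ k) (orbitWeight g i) = orbitWeight g i := by
  induction k with
  | zero => rfl
  | succ k ih => rw [pow_succ', LinearEquiv.mul_apply, ih, sigmaP_orbitWeight]

theorem star_sigma_pow (i : Vertex g) (k : ℕ) :
    star g ((sigma g ^ k) i) = (sigma g ^ k) (star g i) := by
  induction k with
  | zero => rfl
  | succ k ih => rw [pow_succ', Equiv.Perm.mul_apply, star_sigma, ih, Equiv.Perm.mul_apply]

theorem sameCycle_star {i j : Vertex g} (h : (sigma g).SameCycle i j) :
    (sigma g).SameCycle (star g i) (star g j) := by
  obtain ⟨k, -, rfl⟩ := (sameCycle_iff g).1 h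
  rw [star_sigma_pow]
  exact sameCycle_pow _ _

theorem w0_orbitWeight (i : Vertex g) :
    w0 g (orbitWeight g i) = -orbitWeight g (star g i) := by
  rw [w0_apply]
  funext k
  have h : (sigma g).SameCycle i (star g k) ↔ (sigma g).SameCycle (star g i) k :=
    ⟨fun h => by have := sameCycle_star h; rwa [star_star] at this,
      fun h => by have := sameCycle_star h; rwa [star_star] at this⟩
  simp only [orbitWeight, h, Pi.neg_apply]

theorem form_pos_of_dominant {u v : Weight g} (hu : IsDominant u) {i : Vertex g} (hi : 0 < u i)
    (hv : IsDominant v) (hc : InCone g v) (h0 : v ≠ 0) : 0 < form g u v := by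
  have h1 := form_pos hv hc h0 i
  have h2 : IsDominant (u - fundWeight g i) := by
    intro j
    rw [Pi.sub_apply, fundWeight, Pi.single_apply]
    split_ifs with h
    · subst h; omega
    · have := hu j; omega
  have h3 := form_inCone h2 hc
  rw [map_sub, LinearMap.sub_apply] at h3
  linarith

/-- `τ` is the Coxeter element `s_{i_1} ⋯ s_{i_n} σ` of a word with one letter in each
`σ`-orbit. -/
structure IsCoxeterWord (g : AffineType) (l : List (Vertex g))
    (τ : Weight g ≃ₗ[ℤ] Weight g) : Prop where
  nodup : l.Nodup
  exists_mem : ∀ i, ∃ r ∈ l, (sigma g).SameCycle i r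
  unique : ∀ r ∈ l, ∀ r' ∈ l, (sigma g).SameCycle r r' → r = r'
  eq : τ = wordProd g l * sigmaP g

namespace IsCoxeterWord

variable {l : List (Vertex g)} {τ : Weight g ≃ₗ[ℤ] Weight g}

theorem wordProd_orbitWeight {a : List (Vertex g)} {i : Vertex g}
    (h : ∀ k ∈ a, ¬(sigma g).SameCycle i k) : wordProd g a (orbitWeight g i) = orbitWeight g i := by
  induction a with
  | nil => rfl
  | cons k a ih =>
    rw [wordProd_cons, LinearEquiv.mul_apply, ih fun k hk => h k (List.mem_cons_of_mem _ hk),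
      s_apply, orbitWeight, if_neg (h k (by simp)), zero_smul, sub_zero]

/-- The only letter of the word that moves Λ_o is the representative r of the orbit, and σ fixes
Λ_o. -/
theorem sub_apply_orbitWeight (h : IsCoxeterWord g l τ) {a b : List (Vertex g)} {r : Vertex g}
    (hl : l = a ++ r :: b) :
    orbitWeight g r - τ (orbitWeight g r) = wordProd g a (simpleRoot g r) := by
  have hr : r ∈ l := by rw [hl]; simp
  have hnd := h.nodup
  rw [hl, List.nodup_append, List.nodup_cons] at hnd
  have ha : ∀ k ∈ a, ¬(sigma g).SameCycle r k := fun k hk hc =>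
    hnd.2.2 k hk r (by simp) (h.unique r hr k (by rw [hl]; simp [hk]) hc).symm
  have hb : ∀ k ∈ b, ¬(sigma g).SameCycle r k := fun k hk hc =>
    hnd.2.1.1 (h.unique r hr k (by rw [hl]; simp [hk]) hc ▸ hk)
  rw [h.eq, LinearEquiv.mul_apply, sigmaP_orbitWeight, hl, wordProd_append, wordProd_cons,
    LinearEquiv.mul_apply, LinearEquiv.mul_apply, wordProd_orbitWeight hb, s_apply,
    orbitWeight_self, one_smul, map_sub, wordProd_orbitWeight ha, sub_sub_cancel]

/-- The root `(1 - τ) Λ_o` of an orbit `o`. -/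
noncomputable def orbitRoot (τ : Weight g ≃ₗ[ℤ] Weight g) (i : Vertex g) : Weight g :=
  orbitWeight g i - τ (orbitWeight g i)

theorem orbitRoot_congr {i j : Vertex g} (h : (sigma g).SameCycle i j) :
    orbitRoot τ i = orbitRoot τ j := by rw [orbitRoot, orbitRoot, orbitWeight_congr h]

theorem orbitRoot_mem (h : IsCoxeterWord g l τ) (i : Vertex g) : orbitRoot τ i ∈ posRoots g := by
  obtain ⟨r, hr, hc⟩ := h.exists_mem i
  obtain ⟨a, b, hl⟩ := List.append_of_mem hr
  have hnd := h.nodup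
  rw [hl, List.nodup_append] at hnd
  rw [orbitRoot_congr hc, orbitRoot, h.sub_apply_orbitWeight hl]
  exact simpleRoot_mem_of_fix (wordProd_mem a)
    (wordProd_fundWeight fun hra => hnd.2.2 r hra r (by simp) rfl)

/-- As σ preserves positivity, the positive roots made negative by τ⁻¹ are the inversions of the
inverse word. Each becomes simple at some letter j, which exhibits it as a prefix applied to α_j,
that is, as γ_o. -/
theorem exists_eq_orbitRoot (h : IsCoxeterWord g l τ) {b : Weight g} (hb : b ∈ posRoots g)
    (hτ : τ⁻¹ b ∉ posRoots g) : ∃ i, b = orbitRoot τ i := by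
  have h1 : wordProd g l.reverse b ∉ posRoots g := by
    rw [wordProd_reverse]
    intro h2
    refine hτ ?_
    rw [h.eq, mul_inv_rev, LinearEquiv.mul_apply, ← permP_mem_iff (isAut_sigma g), permP_sigma,
      ← LinearEquiv.mul_apply, mul_inv_cancel]
    exact h2
  obtain ⟨a, j, c, hl, hc⟩ := exists_split_of_notMem hb h1
  refine ⟨j, ?_⟩
  have h2 : l = c.reverse ++ j :: a.reverse := by
    rw [← List.reverse_reverse l, hl]; simp
  rw [orbitRoot, h.sub_apply_orbitWeight h2, wordProd_reverse, ← hc, ← LinearEquiv.mul_apply,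
    inv_mul_cancel, LinearEquiv.coe_one, id]

theorem form_apply (h : IsCoxeterWord g l τ) (u v : Weight g) :
    form g (τ u) (τ v) = form g u v := by
  rw [h.eq, LinearEquiv.mul_apply, LinearEquiv.mul_apply, form_weyl (wordProd_mem l),
    ← permP_sigma, form_permP (isAut_sigma g)]

/-- Let v = τv. Pairing with Λ_j for j outside the word, and with the orbit sums, shows σv = v,
because each orbit has a single letter in the word. Then the multiplicity-free word itself fixes v,
so v vanishes at its letters and, being σ-invariant, everywhere. Hence 1 - τ is injective. -/
theorem eq_zero_of_fix (h : IsCoxeterWord g l τ) {v : Weight g} (hv : τ v = v) : v = 0 := by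
  have h1 : wordProd g l (sigmaP g v) = v := by rw [← LinearEquiv.mul_apply, ← h.eq, hv]
  have hs : ∀ i, form g (sigmaP g v) (orbitWeight g i) = form g v (orbitWeight g i) := by
    intro i
    conv_lhs => rw [← sigmaP_orbitWeight i]
    rw [← permP_sigma, form_permP (isAut_sigma g)]
  have hn : ∀ j, j ∉ l → form g (sigmaP g v) (fundWeight g j) = form g v (fundWeight g j) := by
    intro j hj
    rw [← form_weyl (wordProd_mem l), h1, wordProd_fundWeight hj]
  have h2 : sigmaP g v = v := by
    refine form_fund_ext fun j => ?_
    by_cases hj : j ∈ l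
    · classical
      have h3 := hs j
      rw [orbitWeight_eq_sum, map_sum, map_sum,
        ← Finset.add_sum_erase _ _ (Finset.mem_filter.2 ⟨Finset.mem_univ j,
          Equiv.Perm.SameCycle.refl (sigma g) j⟩),
        ← Finset.add_sum_erase _ (fun k => form g v (fundWeight g k))
          (Finset.mem_filter.2 ⟨Finset.mem_univ j, Equiv.Perm.SameCycle.refl (sigma g) j⟩),
        Finset.sum_congr rfl fun k hk => hn k fun hkl => ?_] at h3
      · exact add_right_cancel h3
      · rw [Finset.mem_erase, Finset.mem_filter] at hk
        exact hk.1 (h.unique j hj k hkl hk.2.2).symm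
    · exact hn j hj
  rw [h2] at h1
  have h4 := apply_eq_zero_of_wordProd h.nodup h1
  have h5 : ∀ i, v (sigma g i) = v i := by
    intro i
    have := congrFun h2 (sigma g i)
    rw [← permP_sigma, permP_apply, Equiv.symm_apply_apply] at this
    exact this.symm
  funext i
  obtain ⟨r, hr, hc⟩ := h.exists_mem i
  obtain ⟨k, -, hk⟩ := (sameCycle_iff g).1 hc
  have h6 : ∀ k : ℕ, v ((sigma g ^ k) i) = v i := by
    intro k
    induction k with
    | zero => rfl
    | succ k ih => rw [pow_succ', Equiv.Perm.mul_apply, h5, ih]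
  rw [← h6 k, hk, h4 r hr]
  rfl

theorem sub_injective (h : IsCoxeterWord g l τ) {u v : Weight g} (huv : u - τ u = v - τ v) :
    u = v := by
  refine sub_eq_zero.1 (h.eq_zero_of_fix ?_)
  rw [map_sub]
  have h1 : u = v - τ v + τ u := sub_eq_iff_eq_add.1 huv
  rw [sub_eq_sub_iff_sub_eq_sub.1 huv]

theorem pow_orbitRoot (i : Vertex g) (k : ℕ) : (τ ^ k) (orbitRoot τ i) =
    (τ ^ k) (orbitWeight g i) - τ ((τ ^ k) (orbitWeight g i)) := by
  rw [orbitRoot, map_sub, ← LinearEquiv.mul_apply, ← LinearEquiv.mul_apply, ← pow_succ,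
    ← pow_succ']

/-- If all τ^k γ_o were positive, two of them would coincide by finiteness, and injectivity of 1 - τ
would give τ^a Λ_o = τ^b Λ_o. The difference telescopes into a nonempty sum of positive roots, which
pairs positively with ρ. -/
theorem exists_notMem (h : IsCoxeterWord g l τ) (i : Vertex g) :
    ∃ k : ℕ, 1 ≤ k ∧ (τ ^ k) (orbitRoot τ i) ∉ posRoots g := by
  by_contra! hall
  have hmem : ∀ k : ℕ, (τ ^ k) (orbitRoot τ i) ∈ posRoots g := by
    intro k
    rcases Nat.eq_zero_or_pos k with rfl | hk
    · exact h.orbitRoot_mem i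
    · exact hall k hk
  obtain ⟨a, b, hab, heq⟩ : ∃ a b : ℕ, a < b ∧
      (τ ^ a) (orbitRoot τ i) = (τ ^ b) (orbitRoot τ i) := by
    obtain ⟨a, -, b, -, hab, heq⟩ := Set.infinite_univ.exists_ne_map_eq_of_mapsTo
      (f := fun k : ℕ => (τ ^ k) (orbitRoot τ i)) (t := (posRoots g : Set (Weight g)))
      (fun k _ => hmem k) (Finset.finite_toSet _)
    rcases lt_or_gt_of_ne hab with h1 | h1
    · exact ⟨a, b, h1, heq⟩
    · exact ⟨b, a, h1, heq.symm⟩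
  rw [pow_orbitRoot, pow_orbitRoot] at heq
  have h1 := h.sub_injective heq
  have h2 : ∀ n, (τ ^ a) (orbitWeight g i) - (τ ^ (a + n)) (orbitWeight g i) =
      ∑ k ∈ Finset.range n, (τ ^ (a + k)) (orbitRoot τ i) := by
    intro n
    induction n with
    | zero => simp
    | succ n ih =>
      rw [Finset.sum_range_succ, ← ih, pow_orbitRoot, ← add_assoc, pow_succ' τ (a + n),
        LinearEquiv.mul_apply]
      abel
  have h3 := h2 (b - a)
  rw [show a + (b - a) = b by omega, h1, sub_self] at h3
  have h4 := congrArg (fun v => form g v (rho g)) h3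
  simp only [map_zero, LinearMap.zero_apply, map_sum, LinearMap.sum_apply] at h4
  have h5 : 0 < ∑ k ∈ Finset.range (b - a), form g ((τ ^ (a + k)) (orbitRoot τ i)) (rho g) :=
    Finset.sum_pos (fun k _ => form_rho_pos (hmem _)) ⟨0, by simp; omega⟩
  exact h5.ne h4

open Classical in
/-- The number of positive roots in the sequence `τ^k γ` before the first negative one. -/
noncomputable def turn (h : IsCoxeterWord g l τ) (i : Vertex g) : ℕ := Nat.find (h.exists_notMem i)

theorem turn_pos (h : IsCoxeterWord g l τ) (i : Vertex g) : 0 < h.turn i := by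
  classical
  exact (Nat.find_spec (h.exists_notMem i)).1

theorem pow_turn_notMem (h : IsCoxeterWord g l τ) (i : Vertex g) :
    (τ ^ h.turn i) (orbitRoot τ i) ∉ posRoots g := by
  classical
  exact (Nat.find_spec (h.exists_notMem i)).2

theorem pow_mem_of_lt_turn (h : IsCoxeterWord g l τ) {i : Vertex g} {k : ℕ} (hk : k < h.turn i) :
    (τ ^ k) (orbitRoot τ i) ∈ posRoots g := by
  classical
  rcases Nat.eq_zero_or_pos k with rfl | h0
  · exact h.orbitRoot_mem i
  · by_contra hc
    exact Nat.find_min (h.exists_notMem i) hk ⟨h0, hc⟩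

theorem turn_congr (h : IsCoxeterWord g l τ) {i j : Vertex g} (hc : (sigma g).SameCycle i j) :
    h.turn i = h.turn j := by
  classical
  rw [turn, turn]
  congr 1
  funext k
  rw [orbitRoot_congr hc]

theorem exists_pow_eq (h : IsCoxeterWord g l τ) (k : ℕ) :
    ∃ w ∈ weylGroup g, τ ^ k = w * sigmaP g ^ k := by
  induction k with
  | zero => exact ⟨1, one_mem _, by simp⟩
  | succ k ih =>
    obtain ⟨w, hw, hk⟩ := ih
    refine ⟨wordProd g l * (sigmaP g * w * (sigmaP g)⁻¹),
      mul_mem (wordProd_mem l) (permP_conj (isAut_sigma g) hw), ?_⟩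
    rw [pow_succ', hk, h.eq, pow_succ' (sigmaP g)]
    group

/-- At the turn N, -τ^N γ_o is positive with negative image under τ⁻¹, so it is γ_{o'} for some
orbit o'. Injectivity of 1 - τ gives τ^N Λ_o = -Λ_{o'}. Applying w_0 produces two dominant weights
in one W-orbit, which forces o' = o^*. -/
theorem pow_turn_orbitWeight (h : IsCoxeterWord g l τ) (i : Vertex g) :
    (τ ^ h.turn i) (orbitWeight g i) = -orbitWeight g (star g i) := by
  have h0 := h.turn_pos i
  have hn := h.pow_turn_notMem i
  have hp := h.pow_mem_of_lt_turn (show h.turn i - 1 < h.turn i by omega)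
  have hstep : (τ ^ h.turn i) (orbitRoot τ i) = τ ((τ ^ (h.turn i - 1)) (orbitRoot τ i)) := by
    rw [← LinearEquiv.mul_apply, ← pow_succ', Nat.sub_add_cancel h0]
  have hneg : -(τ ^ h.turn i) (orbitRoot τ i) ∈ posRoots g := by
    have hk : ∀ v, τ v = wordProd g l (permP (sigma g) v) := fun v => by rw [h.eq]; rfl
    have hw := wordProd_mem l
    rw [hstep, hk] at hn ⊢
    exact (weyl_notMem_iff hw (permP_mem (isAut_sigma g) hp)).1 hn
  obtain ⟨j, hj⟩ := h.exists_eq_orbitRoot hneg (by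
    rw [hstep, map_neg, ← LinearEquiv.mul_apply, inv_mul_cancel, LinearEquiv.coe_one, id]
    exact neg_notMem hp)
  have h1 : (τ ^ h.turn i) (orbitWeight g i) = -orbitWeight g j := by
    refine h.sub_injective ?_
    rw [← pow_orbitRoot, map_neg, ← neg_sub', ← orbitRoot, ← hj, neg_neg]
  obtain ⟨w, hw, hk⟩ := h.exists_pow_eq (h.turn i)
  rw [hk, LinearEquiv.mul_apply, sigmaP_pow_orbitWeight] at h1
  have h2 : orbitWeight g i = orbitWeight g (star g j) := by
    refine (isDominant_orbitWeight i).eq_of_conj (isDominant_orbitWeight _)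
      (mul_mem (w0_mem g) hw) ?_
    rw [LinearEquiv.mul_apply, h1, map_neg, w0_orbitWeight, neg_neg]
  rw [hk, LinearEquiv.mul_apply, sigmaP_pow_orbitWeight, h1]
  have h3 := sameCycle_star (orbitWeight_injective h2)
  rw [star_star] at h3
  rw [orbitWeight_congr h3]

/-- The orbit sum is fixed by w_0 times the Weyl part of τ^turn; an element of W fixing a sum of
fundamental weights fixes each of them. -/
theorem pow_turn_fundWeight (h : IsCoxeterWord g l τ) (i : Vertex g) :
    (τ ^ h.turn i) (fundWeight g i) = w0 g (fundWeight g ((sigma g ^ h.turn i) i)) := by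
  classical
  obtain ⟨w, hw, hk⟩ := h.exists_pow_eq (h.turn i)
  have h1 := h.pow_turn_orbitWeight i
  rw [hk, LinearEquiv.mul_apply, sigmaP_pow_orbitWeight, ← w0_orbitWeight] at h1
  have h2 : (w0 g * w) (orbitWeight g i) = orbitWeight g i := by
    rw [LinearEquiv.mul_apply, h1, w0_w0]
  rw [orbitWeight_eq_sum] at h2
  have h3 := fix_of_fix_sum (mul_mem (w0_mem g) hw) h2 (j := (sigma g ^ h.turn i) i)
    (Finset.mem_filter.2 ⟨Finset.mem_univ _, sameCycle_pow i _⟩)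
  rw [hk, LinearEquiv.mul_apply, sigmaP_pow_fundWeight]
  rw [LinearEquiv.mul_apply] at h3
  rw [← h3, w0_w0, h3]

/-- The period of the sequence `τ^k γ`. -/
noncomputable def period (h : IsCoxeterWord g l τ) (i : Vertex g) : ℕ :=
  h.turn i + h.turn (star g i)

theorem pow_period_orbitWeight (h : IsCoxeterWord g l τ) (i : Vertex g) :
    (τ ^ h.period i) (orbitWeight g i) = orbitWeight g i := by
  rw [period, add_comm, pow_add, LinearEquiv.mul_apply, pow_turn_orbitWeight, map_neg,
    pow_turn_orbitWeight, neg_neg, star_star]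

theorem pow_turn_add (h : IsCoxeterWord g l τ) (i : Vertex g) (k : ℕ) :
    (τ ^ (h.turn i + k)) (orbitRoot τ i) = -(τ ^ k) (orbitRoot τ (star g i)) := by
  rw [add_comm, pow_add, LinearEquiv.mul_apply, pow_orbitRoot, pow_turn_orbitWeight, map_neg,
    ← neg_sub', map_neg, orbitRoot]

theorem form_zpow (h : IsCoxeterWord g l τ) (k : ℤ) (u v : Weight g) :
    form g ((τ ^ k) u) ((τ ^ k) v) = form g u v := by
  have hn : ∀ (n : ℕ) (u v : Weight g), form g ((τ ^ n) u) ((τ ^ n) v) = form g u v := by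
    intro n
    induction n with
    | zero => exact fun _ _ => rfl
    | succ n ih =>
      intro u v
      rw [pow_succ, LinearEquiv.mul_apply, LinearEquiv.mul_apply, ih, h.form_apply]
  obtain ⟨n, rfl | rfl⟩ := k.eq_nat_or_neg
  · rw [zpow_natCast]; exact hn n u v
  · rw [zpow_neg, zpow_natCast, ← hn n, ← LinearEquiv.mul_apply, ← LinearEquiv.mul_apply,
      mul_inv_cancel]
    rfl

/-- Apply the unimodality criterion to t ↦ (u, τ^t Λ_o). Its increments are -(u, τ^t γ_o),
nonpositive before the turn of o and nonnegative from there to the end of the period; Λ_o + Λ_{o^*}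
pairs positively with u, so the descent is strict. -/
theorem period_dvd (h : IsCoxeterWord g l τ) {u : Weight g} (hu : IsDominant u) {j : Vertex g}
    (hj : 0 < u j) (i : Vertex g) {k : ℤ}
    (hk : ∀ t : ℤ, form g u ((τ ^ (t + k)) (orbitRoot τ i)) =
      form g u ((τ ^ t) (orbitRoot τ i))) : (h.period i : ℤ) ∣ k := by
  have hstep : ∀ t : ℤ, form g u ((τ ^ t) (orbitWeight g i)) -
      form g u ((τ ^ (t + 1)) (orbitWeight g i)) = form g u ((τ ^ t) (orbitRoot τ i)) := by
    intro t
    rw [orbitRoot, map_sub, map_sub, zpow_add_one, LinearEquiv.mul_apply]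
  have h1 := h.turn_pos i
  have h2 := h.turn_pos (star g i)
  refine dvd_of_periodic_sub (F := fun t => form g u ((τ ^ t) (orbitWeight g i)))
    (N := h.turn i) (by rw [period]; push_cast; omega) (fun t => ?_) (fun t ht0 ht => ?_) (fun t ht0 ht => ?_) ?_
    (fun t => ?_)
  · beta_reduce
    rw [zpow_add, LinearEquiv.mul_apply, zpow_natCast, pow_period_orbitWeight]
  · have h3 := hstep t
    lift t to ℕ using ht0
    have h4 := form_inCone hu (inCone_of_mem
      (h.pow_mem_of_lt_turn (i := i) (k := t) (by exact_mod_cast ht)))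
    rw [zpow_natCast τ t] at h3
    rw [zpow_natCast τ t]
    linarith
  · have h3 := hstep t
    obtain ⟨m, rfl⟩ : ∃ m : ℕ, t = ((h.turn i + m : ℕ) : ℤ) := ⟨(t - h.turn i).toNat, by omega⟩
    have h4 := form_inCone hu (inCone_of_mem
      (h.pow_mem_of_lt_turn (i := star g i) (k := m)
        (by rw [period] at ht; push_cast at ht; omega)))
    rw [zpow_natCast τ, pow_turn_add, map_neg] at h3
    rw [zpow_natCast τ (h.turn i + m)]
    linarith
  · rw [zpow_natCast, zpow_zero, pow_turn_orbitWeight, LinearEquiv.coe_one, id, ← sub_pos,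
      ← map_sub, sub_neg_eq_add]
    refine form_pos_of_dominant hu hj (fun k => ?_) ?_ fun h0 => ?_
    · exact add_nonneg (isDominant_orbitWeight _ k) (isDominant_orbitWeight _ k)
    · rw [← sub_neg_eq_add, ← w0_orbitWeight]
      exact (isDominant_orbitWeight i).inCone (w0_mem g)
    · have h3 := congrFun h0 i
      have h4 := isDominant_orbitWeight (star g i) i
      rw [Pi.add_apply, orbitWeight_self, Pi.zero_apply] at h3
      omega
  · rw [hstep, hk, hstep]

/-- Taking u = Λ_{o'}, its own period moves across the invariant form to the sequence of γ_o. Thus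
the periods divide each other. -/
theorem period_eq (h : IsCoxeterWord g l τ) (i j : Vertex g) : h.period i = h.period j := by
  have key : ∀ i j, h.period i ∣ h.period j := by
    intro i j
    rw [← Int.natCast_dvd_natCast]
    refine h.period_dvd (isDominant_orbitWeight j) (j := j) (by rw [orbitWeight_self]; simp) i
      fun t => ?_
    rw [add_comm, zpow_add, LinearEquiv.mul_apply]
    conv_lhs => rw [← h.pow_period_orbitWeight j, ← zpow_natCast, h.form_zpow]
  exact Nat.dvd_antisymm (key i j) (key j i)

end IsCoxeterWord

end QData

namespace QData
variable {g : AffineType} {ξ : Vertex g → ℤ}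

/-! ### The weights attached to the pairs `(i, p)` -/

/-- The weight `w Λ_i`, where `w` leads from `ξ` to a height function with value `p` at `i`. -/
noncomputable def slot (g : AffineType) (ξ : Vertex g → ℤ) (i : Vertex g) (p : ℤ) : Weight g :=
  tr g ξ (fl g ξ p) (fundWeight g i)

theorem fl_self {i : Vertex g} {p : ℤ} (hp : (2 * dd g i : ℤ) ∣ p - ξ i) : fl g ξ p i = p := by
  have : (2 * dd g i : ℤ) ∣ ξ i - p := by rw [← neg_sub]; exact hp.neg_right
  rw [fl, Int.emod_eq_zero_of_dvd this, add_zero]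

theorem tr_fundWeight_eq_slot {a : Vertex g → ℤ} (h : Compat g ξ a) (i : Vertex g) :
    tr g ξ a (fundWeight g i) = slot g ξ i (a i) :=
  tr_fundWeight_congr h (h.left.fl (a i)) (fl_self (h.dvd i)).symm

theorem slot_self (h : HF g ξ) (i : Vertex g) : slot g ξ i (ξ i) = fundWeight g i := by
  rw [← tr_fundWeight_eq_slot h.refl, tr_self]
  rfl

theorem cox_pow_slot (h : HF g ξ) {i : Vertex g} {p : ℤ} (hp : (2 * dd g i : ℤ) ∣ p - ξ i)
    (k : ℕ) : (cox g ξ ^ k) (slot g ξ i p) = slot g ξ ((sigma g ^ k) i) (p + 2 * k) := by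
  obtain ⟨h1, h2, h3⟩ := cox_pow_tr (h.fl p) i k
  rw [slot, h3, tr_fundWeight_eq_slot h1, h2, fl_self hp]

theorem cox_zpow_slot (h : HF g ξ) {i : Vertex g} {p : ℤ} (hp : (2 * dd g i : ℤ) ∣ p - ξ i)
    {k : ℤ} (hk : (dd g i : ℤ) ∣ k) : (cox g ξ ^ k) (slot g ξ i p) = slot g ξ i (p + 2 * k) := by
  obtain ⟨n, rfl | rfl⟩ := k.eq_nat_or_neg
  · rw [zpow_natCast, cox_pow_slot h hp, (sigma_pow_eq_self_iff g i n).2 (by exact_mod_cast hk)]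
  · have hn : dd g i ∣ n := by rwa [dvd_neg, Int.natCast_dvd_natCast] at hk
    have h1 := cox_pow_slot h (i := i) (p := p + 2 * -(n : ℤ)) (by
      have := hp.add (mul_dvd_mul_left 2 hk)
      rwa [show p - ξ i + 2 * -(n : ℤ) = p + 2 * -n - ξ i by ring] at this) n
    rw [(sigma_pow_eq_self_iff g i n).2 hn, show p + 2 * -(n : ℤ) + 2 * n = p by ring] at h1
    rw [← h1, zpow_neg, zpow_natCast, ← LinearEquiv.mul_apply, inv_mul_cancel,
      LinearEquiv.coe_one, id]

/-- Consecutive weights in row i differ by the root of the reflection performed between them, since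
s_i Λ_i = Λ_i - α_i. This is the source of the formula for φ_Q. -/
theorem slot_sub_sink {a : Vertex g → ℤ} (h : Compat g ξ a) {i : Vertex g} (hi : IsSink g a i) :
    slot g ξ i (a i) - slot g ξ i (a i + 2 * dd g i) = tr g ξ a (simpleRoot g i) := by
  have h1 := h.right.sink hi
  rw [← reflect_self, ← tr_fundWeight_eq_slot h, ← tr_fundWeight_eq_slot (h.trans h1),
    ← tr_mul h h1, tr_sink h.right hi, LinearEquiv.mul_apply, s_fundWeight, map_sub, sub_sub_cancel]

/-! ### Aligned height functions -/

theorem exists_isCoxeterWord (h : HF g ξ) (ha : IsAligned g ξ) :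
    ∃ l, IsCoxeterWord g l (cox g ξ) := by
  obtain ⟨l, h1, h2, h3⟩ := exists_sorted_orbitMin ξ
  refine ⟨l, h1, fun i => ?_, fun r hr r' hr' hc => ?_, ?_⟩
  · obtain ⟨r, hr, -, k, -, hk⟩ := exists_orbitMin ξ i
    refine ⟨r, (h2 r).2 hr, ?_⟩
    rw [← hk]
    exact (sameCycle_pow r k).symm
  · exact ha.unique ((h2 r).1 hr) ((h2 r').1 hr') hc
  · rw [cox, (ha.path_rot h h1 h2 h3).tr_eq h]

theorem orbitWeight_eq_sum_range (r : Vertex g) :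
    orbitWeight g r = ∑ k ∈ Finset.range (dd g r), fundWeight g ((sigma g ^ k) r) := by
  classical
  rw [orbitWeight_eq_sum]
  symm
  refine Finset.sum_nbij (fun k => (sigma g ^ k) r) (fun k _ => ?_) ?_ ?_ fun _ _ => rfl
  · exact Finset.mem_filter.2 ⟨Finset.mem_univ _, sameCycle_pow r k⟩
  · have key : ∀ a b, a < b → b < dd g r → (sigma g ^ a) r ≠ (sigma g ^ b) r := by
      intro a b hab hb heq
      have h1 : (sigma g ^ (b - a)) r = r := by
        apply (sigma g ^ a).injective
        rw [← Equiv.Perm.mul_apply, ← pow_add, Nat.add_sub_cancel' hab.le, heq]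
      have := Nat.le_of_dvd (by omega) ((sigma_pow_eq_self_iff g r _).1 h1)
      omega
    intro a ha b hb heq
    simp only [Finset.coe_range, Set.mem_Iio] at ha hb
    rcases lt_trichotomy a b with h | h | h
    · exact absurd heq (key a b h hb)
    · exact h
    · exact absurd heq.symm (key b a h ha)
  · intro j hj
    simp only [Finset.coe_filter, Finset.mem_univ, true_and, Set.mem_ofPred_eq] at hj
    obtain ⟨k, hk, rfl⟩ := (sameCycle_iff g).1 hj
    exact ⟨k, by simpa using hk, rfl⟩

section Aligned

variable {l : List (Vertex g)}

theorem IsAligned.pow_fundWeight (ha : IsAligned g ξ) (h : HF g ξ) {r : Vertex g}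
    (hr : IsOrbitMin g ξ r) {k : ℕ} (hk : k < dd g r) :
    (cox g ξ ^ k) (fundWeight g r) = fundWeight g ((sigma g ^ k) r) := by
  rw [← slot_self h r, cox_pow_slot h (by simp), ← ha r hr k hk, slot_self h]

/-- For aligned heights the fundamental weights of the orbit are τ^k Λ_r with k < d_r, so (1 - τ)Λ_o
telescopes. -/
theorem IsAligned.orbitRoot_eq (ha : IsAligned g ξ) (h : HF g ξ) {r : Vertex g}
    (hr : IsOrbitMin g ξ r) : IsCoxeterWord.orbitRoot (cox g ξ) r =
      fundWeight g r - (cox g ξ ^ dd g r) (fundWeight g r) := by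
  have h1 : orbitWeight g r =
      ∑ k ∈ Finset.range (dd g r), (cox g ξ ^ k) (fundWeight g r) := by
    rw [orbitWeight_eq_sum_range]
    exact Finset.sum_congr rfl fun k hk =>
      (ha.pow_fundWeight h hr (Finset.mem_range.1 hk)).symm
  rw [IsCoxeterWord.orbitRoot, h1, map_sum, ← Finset.sum_sub_distrib]
  have := Finset.sum_range_sub' (fun k => (cox g ξ ^ k) (fundWeight g r)) (dd g r)
  rw [pow_zero, LinearEquiv.coe_one, id] at this
  rw [← this]
  refine Finset.sum_congr rfl fun k _ => ?_
  rw [pow_succ', LinearEquiv.mul_apply]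

theorem IsAligned.slot_sub (ha : IsAligned g ξ) (h : HF g ξ) {r : Vertex g}
    (hr : IsOrbitMin g ξ r) (k : ℕ) :
    slot g ξ ((sigma g ^ k) r) (ξ r + 2 * k) - slot g ξ ((sigma g ^ k) r) (ξ r + 2 * k +
      2 * dd g r) = (cox g ξ ^ k) (IsCoxeterWord.orbitRoot (cox g ξ) r) := by
  rw [ha.orbitRoot_eq h hr, map_sub, ← LinearEquiv.mul_apply, ← pow_add, ← slot_self h r,
    cox_pow_slot h (by simp), cox_pow_slot h (by simp), pow_add, Equiv.Perm.mul_apply,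
    sigma_pow_dd]
  congr 2
  push_cast; ring

theorem IsAligned.exists_index (ha : IsAligned g ξ) {i : Vertex g} {p : ℤ}
    (hp : (2 * dd g i : ℤ) ∣ p - ξ i) (hle : ξ i ≤ p) :
    ∃ r, IsOrbitMin g ξ r ∧ dd g r = dd g i ∧ ∃ k : ℕ, (sigma g ^ k) r = i ∧ p = ξ r + 2 * k := by
  obtain ⟨r, hr, hd, k, hk, hki⟩ := exists_orbitMin ξ i
  obtain ⟨m, hm⟩ := hp
  have hm0 : 0 ≤ m := by
    have := two_dd_pos i
    by_contra! hc
    nlinarith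
  lift m to ℕ using hm0
  refine ⟨r, hr, hd, k + dd g i * m, ?_, ?_⟩
  · rw [add_comm, pow_add, Equiv.Perm.mul_apply, hki, sigma_pow_eq_self_iff]
    exact dvd_mul_right _ _
  · have h1 := ha r hr k (by omega)
    rw [hki] at h1
    push_cast
    linarith

/-- The first `p` with `slot i p = w₀ Λ_i`. -/
noncomputable def ret (h : IsCoxeterWord g l (cox g ξ)) (i : Vertex g) : ℤ :=
  ξ ((sigma g ^ h.turn i).symm i) + 2 * h.turn i

theorem dd_sigma_pow_symm (i : Vertex g) (k : ℕ) : dd g ((sigma g ^ k).symm i) = dd g i := by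
  rw [← dd_sigma_pow ((sigma g ^ k).symm i) k, Equiv.apply_symm_apply]

theorem turn_symm (h : IsCoxeterWord g l (cox g ξ)) (i : Vertex g) (k : ℕ) :
    h.turn ((sigma g ^ k).symm i) = h.turn i := by
  refine h.turn_congr ?_
  have := sameCycle_pow ((sigma g ^ k).symm i) k
  rwa [Equiv.apply_symm_apply] at this

theorem ret_dvd (hξ : HF g ξ) (h : IsCoxeterWord g l (cox g ξ)) (i : Vertex g) :
    (2 * dd g i : ℤ) ∣ ret h i - ξ i := by
  have := (hξ.sig_pow ((sigma g ^ h.turn i).symm i) (h.turn i)).neg_right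
  rw [Equiv.apply_symm_apply, dd_sigma_pow_symm] at this
  rwa [show -(ξ i - ξ ((sigma g ^ h.turn i).symm i) - 2 * (h.turn i : ℤ)) = ret h i - ξ i by
    rw [ret]; ring] at this

theorem slot_ret (hξ : HF g ξ) (h : IsCoxeterWord g l (cox g ξ)) (i : Vertex g) :
    slot g ξ i (ret h i) = w0 g (fundWeight g i) := by
  have h1 := h.pow_turn_fundWeight ((sigma g ^ h.turn i).symm i)
  rw [turn_symm, Equiv.apply_symm_apply] at h1
  rw [← h1, ← slot_self hξ, cox_pow_slot hξ (by simp), Equiv.apply_symm_apply, ret]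

/-- Writing p = ξ_r + 2k with r the orbit minimum, the difference is τ^k γ_o. As p is at least 2d_i
below `ret`, and heights on an orbit differ by less than 2d_i, k is below the turn. -/
theorem IsAligned.slot_sub_mem (ha : IsAligned g ξ) (hξ : HF g ξ)
    (h : IsCoxeterWord g l (cox g ξ)) {i : Vertex g} {p : ℤ}
    (hp : (2 * dd g i : ℤ) ∣ p - ξ i) (hle : ξ i ≤ p) (hlt : p < ret h i) :
    slot g ξ i p - slot g ξ i (p + 2 * dd g i) ∈ posRoots g := by
  obtain ⟨r, hr, hd, k, hki, hk⟩ := ha.exists_index hp hle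
  have h1 : (2 * dd g i : ℤ) ≤ ret h i - p := by
    refine Int.le_of_dvd (by omega) ?_
    have := (ret_dvd hξ h i).sub hp
    rwa [sub_sub_sub_cancel_right] at this
  have hturn : h.turn r = h.turn i := h.turn_congr (hki ▸ sameCycle_pow r k)
  have h2 : ξ ((sigma g ^ h.turn i).symm i) < ξ r + 2 * dd g r := by
    have hc : (sigma g).SameCycle r ((sigma g ^ h.turn i).symm i) := by
      have := sameCycle_pow ((sigma g ^ h.turn i).symm i) (h.turn i)
      rw [Equiv.apply_symm_apply] at this
      exact (hki ▸ sameCycle_pow r k).trans this.symm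
    obtain ⟨m, hm, hm'⟩ := (sameCycle_iff g).1 hc
    rw [← hm', ha r hr m hm]
    omega
  have h3 : k < h.turn r := by
    rw [ret] at h1
    omega
  have h4 := ha.slot_sub hξ hr k
  rw [hki, hd, ← hk] at h4
  rw [h4]
  exact h.pow_mem_of_lt_turn h3

theorem IsAligned.slot_lt (ha : IsAligned g ξ) (hξ : HF g ξ)
    (h : IsCoxeterWord g l (cox g ξ)) {i : Vertex g} {p : ℤ}
    (hp : (2 * dd g i : ℤ) ∣ p - ξ i) (hle : ξ i ≤ p) (n : ℕ)
    (hn : p + 2 * dd g i * (n + 1) ≤ ret h i) :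
    form g (slot g ξ i (p + 2 * dd g i * (n + 1))) (rho g) < form g (slot g ξ i p) (rho g) := by
  have hd := two_dd_pos i
  have step : ∀ q, (2 * dd g i : ℤ) ∣ q - ξ i → ξ i ≤ q → q < ret h i →
      form g (slot g ξ i (q + 2 * dd g i)) (rho g) < form g (slot g ξ i q) (rho g) := by
    intro q h1 h2 h3
    have := form_rho_pos (ha.slot_sub_mem hξ h h1 h2 h3)
    rw [map_sub, LinearMap.sub_apply] at this
    linarith
  induction n with
  | zero =>
    rw [Nat.cast_zero, zero_add, mul_one] at hn ⊢
    exact step p hp hle (by omega)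
  | succ n ih =>
    push_cast at hn ⊢
    have h1 : (0 : ℤ) ≤ 2 * dd g i * (n + 1) := by positivity
    have h2 : p + 2 * dd g i * ((n : ℤ) + 1 + 1) = p + 2 * dd g i * (n + 1) + 2 * dd g i := by ring
    rw [h2] at hn ⊢
    refine (step _ ?_ (by linarith) (by linarith)).trans (ih (by linarith))
    have := hp.add (dvd_mul_right (2 * (dd g i : ℤ)) (n + 1))
    rwa [show p - ξ i + 2 * dd g i * ((n : ℤ) + 1) = p + 2 * dd g i * (n + 1) - ξ i by ring]
      at this

theorem fundWeight_ne_neg (i j : Vertex g) : fundWeight g i ≠ -fundWeight g j := by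
  intro h
  have h1 := congrFun h i
  have h2 := isDominant_fundWeight j i
  rw [Pi.neg_apply, fundWeight, Pi.single_eq_same] at h1
  omega

/-- For k < d the weight τ^k Λ_r is still fundamental, whereas at the turn it is the negative of a
fundamental weight. -/
theorem IsAligned.dd_le_turn (ha : IsAligned g ξ) (hξ : HF g ξ)
    (h : IsCoxeterWord g l (cox g ξ)) (i : Vertex g) : dd g i ≤ h.turn i := by
  obtain ⟨r, hr, hd, k, -, rfl⟩ := exists_orbitMin ξ i
  rw [← h.turn_congr (sameCycle_pow r k), ← hd]
  by_contra! hc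
  have h1 := h.pow_turn_fundWeight r
  rw [ha.pow_fundWeight hξ hr hc, w0_fundWeight] at h1
  exact fundWeight_ne_neg _ _ h1

/-- The distance from `ξ_i` to the first `p` with `slot (i^*) p = -Λ_i`. -/
noncomputable def gap (h : IsCoxeterWord g l (cox g ξ)) (i : Vertex g) : ℤ :=
  ret h (star g i) - ξ i

theorem slot_gap (hξ : HF g ξ) (h : IsCoxeterWord g l (cox g ξ)) (i : Vertex g) :
    slot g ξ (star g i) (ξ i + gap h i) = -fundWeight g i := by
  rw [gap, add_sub_cancel, slot_ret hξ h, w0_fundWeight, star_star]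

theorem rot_move_star (c : ℤ) (ξ : Vertex g → ℤ) :
    rot g (move (starPerm g) c ξ) = move (starPerm g) c (rot g ξ) := by
  funext k
  have h := (isAut_star g).symm.symm.comm ((sigma g).symm k)
  have h1 : star g ((sigma g).symm k) = (sigma g).symm (star g k) := by
    rw [Equiv.eq_symm_apply, ← star_sigma, Equiv.apply_symm_apply]
  simp only [rot, move, starPerm, Equiv.coe_fn_symm_mk, h1]
  ring

theorem cox_move_star (h : HF g ξ) (c : ℤ) :
    cox g (move (starPerm g) c ξ) = w0 g * cox g ξ * w0 g := by
  rw [cox, cox, rot_move_star, tr_move_star h.rot, mul_assoc, ← permP_sigma,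
    ← permP_w0 (isAut_sigma g)]
  group

/-- The condition that `ξ^* + c` is congruent to `ξ`. -/
def IsShift (g : AffineType) (ξ : Vertex g → ℤ) (c : ℤ) : Prop :=
  ∀ i, (2 * dd g i : ℤ) ∣ ξ i + c - ξ (star g i)

theorem IsShift.compat {c : ℤ} (hc : IsShift g ξ c) (h : HF g ξ) :
    Compat g ξ (move (starPerm g) c ξ) := by
  refine ⟨h, h.move (isAut_star g) c, fun i => ?_⟩
  have := hc (star g i)
  rwa [star_star, dd_star] at this

/-- A congruence modulo 2d_i is preserved by σ and weakens to one modulo 2d_j at a neighbour with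
d_j ≤ d_i. Thus one suitable vertex controls the whole diagram. -/
theorem isShift_of_dvd (h : HF g ξ) {c : ℤ} {i₀ : Vertex g}
    (hreach : ∀ p : Vertex g → Prop, p i₀ → (∀ i, p i → p (sigma g i)) →
      (∀ i j, Adj g i j → dd g j ≤ dd g i → p i → p j) → ∀ i, p i)
    (h0 : (2 * dd g i₀ : ℤ) ∣ ξ i₀ + c - ξ (star g i₀)) : IsShift g ξ c := by
  refine hreach _ h0 (fun i hi => ?_) fun i j hij hd hi => ?_
  · rw [star_sigma, dd_sigma]
    have h1 := h.sig i
    have h2 := h.sig (star g i)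
    rw [dd_star] at h2
    have := (hi.add h1).sub h2
    rwa [show ξ i + c - ξ (star g i) + (ξ (sigma g i) - ξ i - 2) -
      (ξ (sigma g (star g i)) - ξ (star g i) - 2) = ξ (sigma g i) + c - ξ (sigma g (star g i)) by
      ring] at this
  · have h1 := h.cong i j hij
    have h2 := h.cong _ _ (adj_star.2 hij)
    have he : edge g i j = dd g j := min_eq_right (by exact_mod_cast hd)
    have he' : edge g (star g i) (star g j) = dd g j := by
      rw [← he, edge, edge, dd_star, dd_star]
    rw [he] at h1
    rw [he'] at h2
    have h3 := (edge_dvd i j).trans hi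
    rw [he] at h3
    have := (h3.sub h1).add h2
    rwa [show ξ i + c - ξ (star g i) - (ξ i - ξ j - dd g j) +
      (ξ (star g i) - ξ (star g j) - dd g j) = ξ j + c - ξ (star g j) by ring] at this

theorem isShift_gap_dvd (hξ : HF g ξ) (h : IsCoxeterWord g l (cox g ξ)) {c : ℤ}
    (hc : IsShift g ξ c) (i : Vertex g) : (2 * dd g i : ℤ) ∣ c - gap h i := by
  have h1 := ret_dvd hξ h (star g i)
  rw [dd_star] at h1
  have := (hc i).sub h1
  rwa [show ξ i + c - ξ (star g i) - (ret h (star g i) - ξ (star g i)) = c - gap h i by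
    rw [gap]; ring] at this

/-- Let y = x w_0, where x is the transition element. By equivariance under *, y commutes with τ. It
fixes Λ_j because the shift is the gap of j, and it acts on every other Λ_i as a power τ^k. Pairing
with the fixed weight Λ_j shows that k is a period of t ↦ (Λ_j, τ^t γ_r), hence a multiple of the
common period; so y fixes each γ_r, then each orbit sum, then each fundamental weight. -/
theorem IsAligned.tr_eq_w0 (ha : IsAligned g ξ) (hξ : HF g ξ)
    (h : IsCoxeterWord g l (cox g ξ)) {j : Vertex g} (hc : IsShift g ξ (gap h j)) :
    tr g ξ (move (starPerm g) (gap h j) ξ) = w0 g := by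
  classical
  set c := gap h j with hcdef
  have hcomp := hc.compat hξ
  set x := tr g ξ (move (starPerm g) c ξ) with hx
  set τ := cox g ξ with hτ
  have hcomm : (x * w0 g) * τ = τ * (x * w0 g) := by
    have h1 := tr_mul_cox hcomp
    rw [cox_move_star hξ] at h1
    rw [← mul_assoc τ, ← h1]
    simp only [← mul_assoc]
    rw [mul_assoc _ (w0 g) (w0 g), w0_mul_self, mul_one]
  have hcommz : ∀ (k : ℤ) v, (x * w0 g) ((τ ^ k) v) = (τ ^ k) ((x * w0 g) v) := by
    intro k v
    have : Commute (x * w0 g) (τ ^ k) := Commute.zpow_right hcomm k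
    rw [← LinearEquiv.mul_apply, this.eq, LinearEquiv.mul_apply]
  have hfund : ∀ i, ∃ k : ℤ, c - gap h i = 2 * k ∧
      (x * w0 g) (fundWeight g i) = (τ ^ k) (fundWeight g i) := by
    intro i
    obtain ⟨m, hm⟩ := isShift_gap_dvd hξ h hc i
    refine ⟨dd g i * m, by rw [hm]; ring, ?_⟩
    have h1 := slot_gap hξ h i
    have h2 := cox_zpow_slot hξ (i := star g i) (p := ξ i + gap h i) (by
      rw [gap, add_sub_cancel]; exact ret_dvd hξ h _) (k := dd g i * m)
      (by rw [dd_star]; exact dvd_mul_right _ _)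
    have h3 := tr_fundWeight_eq_slot hcomp (star g i)
    rw [move_star_apply, star_star] at h3
    rw [LinearEquiv.mul_apply, w0_fundWeight, map_neg, hx, h3,
      show ξ i + c = ξ i + gap h i + 2 * (dd g i * m) by linarith, ← h2, h1, map_neg, neg_neg]
  have hj : (x * w0 g) (fundWeight g j) = fundWeight g j := by
    obtain ⟨k, hk, h1⟩ := hfund j
    rw [h1, show k = 0 by omega, zpow_zero, LinearEquiv.coe_one, id]
  have hmem : x * w0 g ∈ weylGroup g := mul_mem (tr_mem _ _) (w0_mem g)
  have hone : x * w0 g = 1 := by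
    refine linearEquiv_fund_ext fun i => ?_
    obtain ⟨r, hr, -, m, -, hmi⟩ := exists_orbitMin ξ i
    obtain ⟨k, -, hk⟩ := hfund r
    have hroot : (x * w0 g) (IsCoxeterWord.orbitRoot τ r) =
        (τ ^ k) (IsCoxeterWord.orbitRoot τ r) := by
      rw [ha.orbitRoot_eq hξ hr, map_sub, map_sub, ← hτ, ← zpow_natCast τ (dd g r), hcommz, hk,
        ← LinearEquiv.mul_apply, ← LinearEquiv.mul_apply, ← zpow_add, ← zpow_add, add_comm]
    have hdvd : (h.period r : ℤ) ∣ k := by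
      refine h.period_dvd (isDominant_fundWeight j) (j := j)
        (by rw [fundWeight, Pi.single_eq_same]; simp) r fun t => ?_
      rw [zpow_add, LinearEquiv.mul_apply, ← hroot, ← hcommz]
      conv_lhs => rw [← hj]
      rw [form_weyl hmem]
    have hper : (τ ^ k) (orbitWeight g r) = orbitWeight g r := by
      obtain ⟨n, rfl⟩ := hdvd
      have hp := h.pow_period_orbitWeight r
      rw [zpow_mul, zpow_natCast]
      have hn : ∀ n : ℕ, ((τ ^ h.period r) ^ n) (orbitWeight g r) = orbitWeight g r := by
        intro n
        induction n with
        | zero => rfl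
        | succ n ih => rw [pow_succ, LinearEquiv.mul_apply, hp, ih]
      obtain ⟨m, rfl | rfl⟩ := n.eq_nat_or_neg
      · rw [zpow_natCast, hn]
      · rw [zpow_neg, zpow_natCast]
        conv_lhs => rw [← hn m]
        rw [← LinearEquiv.mul_apply, inv_mul_cancel, LinearEquiv.coe_one, id]
    have hL : (x * w0 g) (orbitWeight g r) = orbitWeight g r := by
      refine h.sub_injective ?_
      have e1 : τ ((x * w0 g) (orbitWeight g r)) = (x * w0 g) (τ (orbitWeight g r)) := by
        rw [← LinearEquiv.mul_apply, ← hcomm, LinearEquiv.mul_apply]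
      rw [e1, ← map_sub]
      change (x * w0 g) (IsCoxeterWord.orbitRoot τ r) = IsCoxeterWord.orbitRoot τ r
      rw [hroot, IsCoxeterWord.orbitRoot, map_sub, hper, ← LinearEquiv.mul_apply, ← zpow_add_one,
        add_comm, zpow_add, zpow_one, LinearEquiv.mul_apply, hper]
    rw [orbitWeight_eq_sum] at hL
    rw [LinearEquiv.coe_one, id]
    exact fix_of_fix_sum hmem hL
      (Finset.mem_filter.2 ⟨Finset.mem_univ _, hmi ▸ sameCycle_pow r m⟩)
  rw [mul_eq_one_iff_eq_inv, w0_inv] at hone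
  exact hone

end Aligned

end QData

namespace QData
variable {g : AffineType} {ξ ξ' : Vertex g → ℤ} {l : List (Vertex g)}

/-! ### The height functions `ξ^* + ord(σ) h^∨` -/

theorem IsAligned.gap_pos (ha : IsAligned g ξ) (hξ : HF g ξ) (h : IsCoxeterWord g l (cox g ξ))
    {t : ℤ} (ht : ∀ i, t ≤ ξ i ∧ ξ i < t + 2 * dd g i) (i : Vertex g) : 0 < gap h i := by
  have h1 := ha.dd_le_turn hξ h (star g i)
  rw [dd_star] at h1
  have h2 := (ht ((sigma g ^ h.turn (star g i)).symm (star g i))).1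
  have h3 := (ht i).2
  rw [gap, ret]
  omega

theorem le_move_star {c t : ℤ} (ht : ∀ i, t ≤ ξ i ∧ ξ i < t + 2 * dd g i) (hc0 : 0 < c)
    (hc : IsShift g ξ c) : ξ ≤ move (starPerm g) c ξ := by
  intro i
  rw [move_star_apply]
  have h1 := hc (star g i)
  rw [star_star, dd_star] at h1
  have h2 := nonneg_of_dvd h1 (by have := (ht i).2; have := (ht (star g i)).1; omega)
  linarith

/-- Row i^* takes the value w_0 Λ_{i^*} both at ξ_i + gap_j and at its return point ξ_i + gap_i. If
the second came later, this would contradict the strict decrease of the pairing with ρ up to the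
return point. -/
theorem IsAligned.gap_le (ha : IsAligned g ξ) (hξ : HF g ξ) (h : IsCoxeterWord g l (cox g ξ))
    {t : ℤ} (ht : ∀ i, t ≤ ξ i ∧ ξ i < t + 2 * dd g i) {j : Vertex g}
    (hc : IsShift g ξ (gap h j)) (i : Vertex g) : gap h i ≤ gap h j := by
  by_contra! hlt
  have hle := le_move_star ht (ha.gap_pos hξ h ht j) hc (star g i)
  have hcomp := hc.compat hξ
  have h1 := tr_fundWeight_eq_slot hcomp (star g i)
  rw [move_star_apply, star_star] at hle h1
  rw [ha.tr_eq_w0 hξ h hc, ← slot_ret hξ h] at h1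
  have hp := hcomp.dvd (star g i)
  rw [move_star_apply, star_star] at hp
  obtain ⟨m, hm⟩ := (ret_dvd hξ h (star g i)).sub hp
  rw [sub_sub_sub_cancel_right] at hm
  have hd := two_dd_pos (star g i)
  have hret : ret h (star g i) = ξ i + gap h i := by rw [gap]; ring
  have hm0 : 0 < m := by
    by_contra! hm0
    have : (2 * dd g (star g i) : ℤ) * m ≤ 0 := mul_nonpos_of_nonneg_of_nonpos hd.le hm0
    omega
  obtain ⟨n, rfl⟩ : ∃ n : ℕ, m = n + 1 := ⟨(m - 1).toNat, by omega⟩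
  have h2 := ha.slot_lt hξ h hp hle n (by omega)
  rw [show ξ i + gap h j + 2 * (dd g (star g i) : ℤ) * (n + 1) = ret h (star g i) by omega, h1]
    at h2
  exact lt_irrefl _ h2

/-- Summed over a set stable under σ and *, the heights cancel because they are merely permuted, and
the turns of i and i^* add up to the period. So the average gap is the period. -/
theorem sum_gap (h : IsCoxeterWord g l (cox g ξ)) {S : Finset (Vertex g)}
    (hstar : ∀ i, star g i ∈ S ↔ i ∈ S) (hsigma : ∀ i, sigma g i ∈ S ↔ i ∈ S) (j : Vertex g) :
    ∑ i ∈ S, gap h i = ∑ _i ∈ S, (h.period j : ℤ) := by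
  have hpow : ∀ (k : ℕ) i, (sigma g ^ k) i ∈ S ↔ i ∈ S := by
    intro k i
    induction k with
    | zero => rfl
    | succ k ih => rw [pow_succ', Equiv.Perm.mul_apply, hsigma, ih]
  have h1 : ∑ i ∈ S, ret h (star g i) = ∑ i ∈ S, ret h i :=
    Finset.sum_nbij' (star g) (star g) (fun i hi => (hstar i).2 hi) (fun i hi => (hstar i).2 hi)
      (fun i _ => star_star i) (fun i _ => star_star i) fun i _ => rfl
  have h2 : ∑ i ∈ S, (h.turn (star g i) : ℤ) = ∑ i ∈ S, (h.turn i : ℤ) :=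
    Finset.sum_nbij' (star g) (star g) (fun i hi => (hstar i).2 hi) (fun i hi => (hstar i).2 hi)
      (fun i _ => star_star i) (fun i _ => star_star i) fun i _ => rfl
  have h3 : ∑ i ∈ S, ξ ((sigma g ^ h.turn i).symm i) = ∑ i ∈ S, ξ i := by
    refine Finset.sum_nbij' (fun i => (sigma g ^ h.turn i).symm i)
      (fun i => (sigma g ^ h.turn i) i) (fun i hi => ?_) (fun i hi => (hpow _ i).2 hi)
      (fun i _ => ?_) (fun i _ => ?_) fun i _ => rfl
    · rw [← hpow (h.turn i), Equiv.apply_symm_apply]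
      exact hi
    · simp only [turn_symm, Equiv.apply_symm_apply]
    · have : h.turn ((sigma g ^ h.turn i) i) = h.turn i :=
        (h.turn_congr (sameCycle_pow i _)).symm
      simp only [this, Equiv.symm_apply_apply]
  have h4 : ∑ _i ∈ S, (h.period j : ℤ) = ∑ i ∈ S, ((h.turn i : ℤ) + h.turn (star g i)) := by
    refine Finset.sum_congr rfl fun i _ => ?_
    rw [h.period_eq j i, IsCoxeterWord.period]
    push_cast; ring
  rw [h4, Finset.sum_add_distrib, h2]
  simp only [gap, Finset.sum_sub_distrib]
  rw [h1]
  simp only [ret, Finset.sum_add_distrib, ← Finset.mul_sum]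
  rw [h3]
  ring

/-- Choose j with d_j = ord(σ) so that its gap is a valid shift. Any other such vertex also gives a
valid shift, so their gaps agree by mutual comparison and equal the period by averaging. All gaps
are at most this value and average to it, hence all are equal to it. -/
theorem IsAligned.exists_gap_eq (ha : IsAligned g ξ) (hξ : HF g ξ)
    (h : IsCoxeterWord g l (cox g ξ)) {t : ℤ} (ht : ∀ i, t ≤ ξ i ∧ ξ i < t + 2 * dd g i) :
    ∃ j, IsShift g ξ (gap h j) ∧ ∀ i, gap h i = gap h j := by
  classical
  obtain ⟨j, hj, hreach⟩ := exists_reach g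
  have hj2 : ∀ i, (2 * dd g i : ℤ) ∣ ξ i + gap h i - ξ (star g i) := by
    intro i
    have := ret_dvd hξ h (star g i)
    rwa [dd_star, show ret h (star g i) - ξ (star g i) = ξ i + gap h i - ξ (star g i) by
      rw [gap]; ring] at this
  have hs := isShift_of_dvd hξ hreach (hj2 j)
  refine ⟨j, hs, ?_⟩
  have hD : ∀ i, dd g i = ordSigma g → gap h i = gap h j := by
    intro i hi
    refine le_antisymm (ha.gap_le hξ h ht hs i) (ha.gap_le hξ h ht ?_ j)
    refine isShift_of_dvd hξ hreach ?_
    have h1 := (hs i).sub (hj2 i)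
    rw [hi, ← hj] at h1
    have := (hj2 j).sub h1
    rwa [show ξ j + gap h j - ξ (star g j) - (ξ i + gap h j - ξ (star g i) -
      (ξ i + gap h i - ξ (star g i))) = ξ j + gap h i - ξ (star g j) by ring] at this
  have hT : gap h j = h.period j := by
    have h1 := sum_gap h (S := Finset.univ.filter fun i => dd g i = ordSigma g)
      (fun i => by simp [dd_star]) (fun i => by simp [dd_sigma]) j
    rw [Finset.sum_congr rfl fun i hi => hD i (Finset.mem_filter.1 hi).2, Finset.sum_const,
      Finset.sum_const] at h1
    have h2 : (Finset.univ.filter fun i => dd g i = ordSigma g).card ≠ 0 :=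
      Finset.card_ne_zero_of_mem (Finset.mem_filter.2 ⟨Finset.mem_univ j, hj⟩)
    exact smul_right_injective ℤ h2 h1
  have h1 := sum_gap h (S := Finset.univ) (fun i => by simp) (fun i => by simp) j
  rw [← hT] at h1
  intro i
  exact (Finset.sum_eq_sum_iff_of_le fun i _ => ha.gap_le hξ h ht hs i).1 h1 i
    (Finset.mem_univ i)

/-- `ord(σ) h^∨`. -/
noncomputable def shiftLen (g : AffineType) : ℤ := ordSigma g * dualCoxeter g

/-- The height function `ξ^* + ord(σ) h^∨`. -/
noncomputable def twist (g : AffineType) (ξ : Vertex g → ℤ) : Vertex g → ℤ :=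
  move (starPerm g) (shiftLen g) ξ

theorem twist_apply (ξ : Vertex g → ℤ) (i : Vertex g) :
    twist g ξ i = ξ (star g i) + shiftLen g := rfl

theorem reduced_of_slots (h : HF g ξ) {m : List (Vertex g)} (hm : Path g ξ m ξ')
    (hpos : ∀ i p, (2 * dd g i : ℤ) ∣ p - ξ i → ξ i ≤ p → p < ξ' i →
      slot g ξ i p - slot g ξ i (p + 2 * dd g i) ∈ posRoots g) :
    inv g (wordProd g m) = m.length := by
  rw [wordProd_reduced_iff]
  rintro a j b rfl
  obtain ⟨η, h1, h2⟩ := path_append.1 hm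
  have hc := h1.compat h
  have h3 := slot_sub_sink hc h2.1
  rw [← h1.tr_eq h, ← h3]
  refine hpos j _ (hc.dvd j) (h1.le j) ?_
  have := h2.2.le j
  rw [reflect_self] at this
  have := two_dd_pos j
  linarith

theorem sum_path_weight (g : AffineType) (c : ℤ) (ξ : Vertex g → ℤ) :
    ∑ i, (ordSigma g / dd g i : ℕ) * (move (starPerm g) c ξ i - ξ i) =
      c * ∑ i, ((ordSigma g / dd g i : ℕ) : ℤ) := by
  have h1 : ∑ i, ((ordSigma g / dd g i : ℕ) : ℤ) * ξ (star g i) =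
      ∑ i, ((ordSigma g / dd g i : ℕ) : ℤ) * ξ i :=
    Finset.sum_nbij' (star g) (star g) (fun _ _ => Finset.mem_univ _)
      (fun _ _ => Finset.mem_univ _) (fun i _ => star_star i) (fun i _ => star_star i)
      fun i _ => by rw [dd_star]
  simp only [move_star_apply]
  rw [Finset.sum_congr rfl fun i _ => show
    ((ordSigma g / dd g i : ℕ) : ℤ) * (ξ (star g i) + c - ξ i) =
    (ordSigma g / dd g i : ℕ) * ξ (star g i) - (ordSigma g / dd g i : ℕ) * ξ i +
      c * (ordSigma g / dd g i : ℕ) by ring, Finset.sum_add_distrib, Finset.sum_sub_distrib, h1,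
    sub_self, zero_add, Finset.mul_sum]

theorem ordSigma_mul_card (g : AffineType) : (2 * ordSigma g : ℤ) * (posRoots g).card =
    shiftLen g * ∑ i, ((ordSigma g / dd g i : ℕ) : ℤ) := by
  have h1 : ∀ i : Vertex g, (if sigma g i = i then ordSigma g else 1) = ordSigma g / dd g i := by
    intro i
    split_ifs with hi
    · rw [dd_of_fixed g hi, Nat.div_one]
    · rw [dd_of_not_fixed g hi, Nat.div_self (ordSigma_pos g)]
  have h2 := two_mul_card_posRoots g
  rw [Finset.sum_congr rfl fun i _ => h1 i] at h2
  have h3 : (2 * (posRoots g).card : ℤ) =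
      dualCoxeter g * ∑ i, ((ordSigma g / dd g i : ℕ) : ℤ) := by exact_mod_cast h2
  rw [shiftLen]
  linear_combination (ordSigma g : ℤ) * h3

theorem sum_weight_pos (g : AffineType) : 0 < ∑ i, ((ordSigma g / dd g i : ℕ) : ℤ) := by
  obtain ⟨i₀, -⟩ := exists_sigma_fixed g
  refine Finset.sum_pos (fun i _ => ?_) ⟨i₀, Finset.mem_univ _⟩
  exact_mod_cast Nat.div_pos (dd_le_ordSigma g i) (dd_pos g i)

/-- The adapted word from the floor function f of ξ to f^* + gap is reduced with product w_0, so it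
has |Φ⁺| letters. Its length is also the gap times a fixed weighted count of vertices; comparison
gives gap = ord(σ) h^∨. -/
theorem HF.twist_fl (h : HF g ξ) (t : ℤ) :
    Compat g (QData.fl g ξ t) (twist g (QData.fl g ξ t)) ∧
      tr g (QData.fl g ξ t) (twist g (QData.fl g ξ t)) = w0 g ∧
      QData.fl g ξ t ≤ twist g (QData.fl g ξ t) := by
  have hξ := (h.fl t).right
  have ha := h.isAligned_fl t
  obtain ⟨l, hl⟩ := exists_isCoxeterWord hξ ha
  have ht : ∀ i, t ≤ QData.fl g ξ t i ∧ QData.fl g ξ t i < t + 2 * dd g i :=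
    fun i => ⟨le_fl i ξ t, fl_lt i ξ t⟩
  obtain ⟨j, hs, hgap⟩ := ha.exists_gap_eq hξ hl ht
  have hcomp := hs.compat hξ
  have hw := ha.tr_eq_w0 hξ hl hs
  have hle := le_move_star ht (ha.gap_pos hξ hl ht j) hs
  obtain ⟨m, hm⟩ := hcomp.exists_path hle
  have hred := reduced_of_slots hξ hm fun i p h1 h2 h3 => by
    refine ha.slot_sub_mem hξ hl h1 h2 ?_
    have := hgap (star g i)
    rw [gap, star_star] at this
    rw [move_star_apply] at h3
    omega
  rw [← hm.tr_eq hξ, hw, inv_w0] at hred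
  have h1 := hm.length
  rw [sum_path_weight, ← hred, ordSigma_mul_card] at h1
  have h2 : shiftLen g = gap hl j := mul_right_cancel₀ (sum_weight_pos g).ne' h1
  rw [twist, h2]
  exact ⟨hcomp, hw, hle⟩

theorem Compat.twist (h : Compat g ξ ξ') : Compat g (QData.twist g ξ) (QData.twist g ξ') :=
  h.move (isAut_star g) _

theorem HF.twist (h : HF g ξ) : Compat g ξ (QData.twist g ξ) := by
  have h1 := h.fl 0
  exact h1.trans ((h.twist_fl 0).1.trans h1.symm.twist)

/-- Go from ξ to an aligned function f, then to its twist, then back to the twist of ξ. The last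
transition is the w_0-conjugate of the inverse of the first, and everything but w_0 cancels. -/
theorem tr_twist (h : HF g ξ) : tr g ξ (twist g ξ) = w0 g := by
  have h1 := h.fl 0
  obtain ⟨h2, h3, -⟩ := h.twist_fl 0
  rw [← tr_mul h1 (h1.symm.trans h.twist), ← tr_mul h2 h1.symm.twist, h3, twist, twist,
    tr_move_star h1.symm, ← tr_inv h1]
  simp only [← mul_assoc]
  rw [mul_assoc _ (w0 g) (w0 g), w0_mul_self, mul_one, mul_inv_cancel, one_mul]

theorem twist_ne (h : HF g ξ) (i : Vertex g) : ξ i ≠ twist g ξ i := by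
  intro hi
  have h1 := tr_fundWeight h.twist hi
  rw [tr_twist h, w0_fundWeight] at h1
  exact fundWeight_ne_neg _ _ h1.symm

theorem twist_reflect (i : Vertex g) (ξ : Vertex g → ℤ) :
    twist g (reflect g i ξ) = reflect g (star g i) (twist g ξ) :=
  move_reflect (isAut_star g) i _ ξ

/-- Known for aligned functions, the inequality is carried along an adapted word. Reflecting at k
raises ξ_k by 2d_k, which does not overshoot because ξ_k differs from its target and is congruent to
it, while the target only moves up. -/
theorem HF.lt_twist (h : HF g ξ) (i : Vertex g) : ξ i < QData.twist g ξ i := by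
  suffices hle : ξ ≤ QData.twist g ξ from lt_of_le_of_ne (hle i) (twist_ne h i)
  have key : ∀ (m : List (Vertex g)) (η : Vertex g → ℤ), HF g η → η ≤ QData.twist g η →
      Path g η m ξ → ξ ≤ QData.twist g ξ := by
    intro m
    induction m with
    | nil =>
      intro η _ hle hp
      rwa [← show η = ξ from hp]
    | cons k m ih =>
      intro η hη hle hp
      have hk := hη.sink hp.1
      refine ih _ hk.right ?_ hp.2
      rw [twist_reflect]
      refine (reflect_le hη.twist hle (lt_of_le_of_ne (hle k) (twist_ne hη k))).trans ?_
      intro j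
      rw [reflect]
      have := two_dd_pos (star g k)
      split_ifs <;> linarith
  obtain ⟨t, ht⟩ := exists_fl_le ξ
  have h1 := h.fl t
  obtain ⟨m, hm⟩ := h1.symm.exists_path ht
  exact key m _ h1.right (h.twist_fl t).2.2 hm

theorem HF.le_twist (h : HF g ξ) : ξ ≤ QData.twist g ξ := fun i => (h.lt_twist i).le

theorem Path.length_eq_ell {m : List (Vertex g)} (hm : Path g ξ m (twist g ξ)) :
    m.length = ell g := by
  have h1 := hm.length
  rw [twist, sum_path_weight, ← ordSigma_mul_card] at h1
  have : (0 : ℤ) < 2 * ordSigma g := by have := ordSigma_pos g; omega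
  have := mul_left_cancel₀ this.ne' h1
  rw [ell_eq]
  exact_mod_cast this

theorem Path.wordProd_twist (h : HF g ξ) {m : List (Vertex g)} (hm : Path g ξ m (twist g ξ)) :
    wordProd g m = w0 g := by
  rw [← hm.tr_eq h, tr_twist h]

theorem Path.isReducedExpr (h : HF g ξ) {m : List (Vertex g)} (hm : Path g ξ m (twist g ξ)) :
    IsReducedExpr g (w0 g) m := ⟨hm.wordProd_twist h, hm.length_eq_ell⟩

/-- Reduced adapted words stay below `ξ^* + ord(σ) h^∨`. -/
theorem Path.le_twist (h : HF g ξ) {m : List (Vertex g)} (hm : Path g ξ m ξ')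
    (hred : inv g (wordProd g m) = m.length) : ξ' ≤ twist g ξ := by
  by_contra hle
  have hc := hm.compat h
  have hc2 := hc.symm.trans h.twist
  set η := ξ' ⊓ twist g ξ with hη
  have h1 : Compat g ξ' η := hc2.inf
  have h2 : Compat g ξ η := hc.trans h1
  have hξη : ξ ≤ η := le_inf hm.le h.le_twist
  obtain ⟨a, ha⟩ := h2.exists_path hξη
  obtain ⟨b, hb⟩ := h1.symm.exists_path inf_le_left
  obtain ⟨c, hcp⟩ := (h1.symm.trans hc2).exists_path inf_le_right
  -- The first letter j beyond η meets η_j = (twist ξ)_j, so the word c from η to the twist avoids j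
  -- and c⁻¹ α_j is positive. With a c = w_0 this makes a α_j negative, although a followed by j
  -- begins a reduced word.
  rcases b with _ | ⟨j, b⟩
  · exact hle ((show η = ξ' from hb) ▸ inf_le_right)
  have hjlt : η j < ξ' j := by
    have h3 := hb.2.le j
    rw [reflect_self] at h3
    have := two_dd_pos j
    linarith
  have hjt : twist g ξ j = η j := by
    rw [hη, Pi.inf_apply] at hjlt ⊢
    rcases min_choice (ξ' j) (twist g ξ j) with h3 | h3
    · exact absurd (hjlt.trans_eq h3.symm) (lt_irrefl _)
    · exact h3.symm
  have hjc : j ∉ c := hcp.notMem hjt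
  have hab : Path g ξ (a ++ j :: b) ξ' := path_append.2 ⟨η, ha, hb⟩
  have hred' : inv g (wordProd g (a ++ j :: b)) = (a ++ j :: b).length := by
    rw [hab.wordProd_eq hm h, hred]
    have e1 := hab.length
    rw [← hm.length] at e1
    have : (0 : ℤ) < 2 * ordSigma g := by have := ordSigma_pos g; omega
    exact_mod_cast (mul_left_cancel₀ this.ne' e1).symm
  have hpos := (wordProd_reduced_iff _).1 hred' a j b rfl
  have hac : wordProd g a * wordProd g c = w0 g := by
    rw [← wordProd_append, (path_append.2 ⟨η, ha, hcp⟩ : Path g ξ (a ++ c) _).wordProd_twist h]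
  have hcinv : (wordProd g c)⁻¹ (fundWeight g j) = fundWeight g j := by
    conv_lhs => rw [← wordProd_fundWeight hjc]
    rw [← LinearEquiv.mul_apply, inv_mul_cancel, LinearEquiv.coe_one, id]
  have h5 := simpleRoot_mem_of_fix (inv_mem (wordProd_mem c)) hcinv
  have h6 := neg_w0_mem h5
  rw [← hac, LinearEquiv.mul_apply, ← LinearEquiv.mul_apply (wordProd g c), mul_inv_cancel,
    LinearEquiv.coe_one, id] at h6
  exact neg_notMem hpos h6

theorem eq_of_le_of_length {a b : List (Vertex g)} {η : Vertex g → ℤ} (ha : Path g ξ a ξ')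
    (hb : Path g ξ b η) (hle : ξ' ≤ η) (hlen : a.length = b.length) : ξ' = η := by
  have h1 := ha.length
  rw [hlen, hb.length] at h1
  have h2 : ∀ i, 0 ≤ ((ordSigma g / dd g i : ℕ) : ℤ) * (η i - ξ' i) := fun i =>
    mul_nonneg (by positivity) (sub_nonneg.2 (hle i))
  have h3 : ∑ i, ((ordSigma g / dd g i : ℕ) : ℤ) * (η i - ξ' i) = 0 := by
    rw [← sub_eq_zero, ← Finset.sum_sub_distrib] at h1
    rw [← h1]
    exact Finset.sum_congr rfl fun i _ => by ring
  funext i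
  have h4 := (Finset.sum_eq_zero_iff_of_nonneg fun i _ => h2 i).1 h3 i (Finset.mem_univ i)
  have h5 : ((ordSigma g / dd g i : ℕ) : ℤ) ≠ 0 := by
    exact_mod_cast (Nat.div_pos (dd_le_ordSigma g i) (dd_pos g i)).ne'
  have := (mul_eq_zero.1 h4).resolve_left h5
  omega

/-- The adapted reduced words of `w₀` lead to `ξ^* + ord(σ) h^∨`. -/
theorem path_twist_of_reduced (h : HF g ξ) {m : List (Vertex g)} (hm : IsAdapted g ξ m)
    (hw : IsReducedExpr g (w0 g) m) : Path g ξ m (twist g ξ) := by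
  obtain ⟨ξ', hp⟩ := hm.exists_path
  obtain ⟨b, hb⟩ := h.twist.exists_path h.le_twist
  have hle := hp.le_twist h (by rw [hw.1, hw.2, len_eq_inv (w0_mem g)])
  have : ξ' = twist g ξ := eq_of_le_of_length hp hb hle (by rw [hb.length_eq_ell, hw.2, ell])
  rwa [← this]

end QData

namespace QData
variable {g : AffineType} {ξ ξ' : Vertex g → ℤ}

/-! ### Bi-infinite adapted sequences -/

theorem ell_pos (g : AffineType) : 0 < ell g := by
  obtain ⟨i, -⟩ := exists_sigma_fixed g
  rw [ell_eq]
  exact Finset.card_pos.2 ⟨_, simpleRoot_mem i⟩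

theorem shiftLen_pos (g : AffineType) : 0 < shiftLen g := by
  have h1 := ordSigma_mul_card g
  have h2 := ell_pos g
  rw [ell_eq] at h2
  have h3 := ordSigma_pos g
  have h4 : (0 : ℤ) < 2 * ordSigma g * (posRoots g).card := by positivity
  rw [h1] at h4
  exact pos_of_mul_pos_left h4 (sum_weight_pos g).le

theorem window_succ (i : ℤ → Vertex g) (a : ℤ) (n : ℕ) :
    window i a (n + 1) = i a :: window i (a + 1) n := by
  rw [window, List.ofFn_succ, window]
  congr 1
  · simp
  · congr 1
    funext j
    congr 1
    simp only [Fin.val_succ]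
    push_cast; ring

theorem length_window (i : ℤ → Vertex g) (a : ℤ) (n : ℕ) : (window i a n).length = n :=
  List.length_ofFn

theorem mem_window {i : ℤ → Vertex g} {a : ℤ} {n : ℕ} {j : Vertex g} (h : j ∈ window i a n) :
    ∃ u, a ≤ u ∧ u < a + n ∧ i u = j := by
  rw [window, List.mem_ofFn] at h
  obtain ⟨k, hk⟩ := h
  exact ⟨a + k, by omega, by have := k.2; omega, hk⟩

/-- A bi-infinite sequence of sink reflections; `Y k` is the height function before the `k`-th
one. -/
structure IsChain (g : AffineType) (i : ℤ → Vertex g) (Y : ℤ → Vertex g → ℤ) : Prop where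
  hf : ∀ k, HF g (Y k)
  sink : ∀ k, IsSink g (Y k) (i k)
  step : ∀ k, Y (k + 1) = reflect g (i k) (Y k)
  twist : ∀ k, Y (k + ell g) = QData.twist g (Y k)

namespace IsChain

variable {i : ℤ → Vertex g} {Y : ℤ → Vertex g → ℤ}

theorem path (h : IsChain g i Y) (a : ℤ) (n : ℕ) : Path g (Y a) (window i a n) (Y (a + n)) := by
  induction n generalizing a with
  | zero => rw [Nat.cast_zero, add_zero]; rfl
  | succ n ih =>
    rw [window_succ]
    refine ⟨h.sink a, ?_⟩
    rw [← h.step, show a + ((n + 1 : ℕ) : ℤ) = a + 1 + n by push_cast; ring]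
    exact ih (a + 1)

theorem path_twist (h : IsChain g i Y) (a : ℤ) :
    Path g (Y a) (window i a (ell g)) (QData.twist g (Y a)) := by
  rw [← h.twist]
  exact h.path a _

theorem longest (h : IsChain g i Y) (a : ℤ) : wordProd g (window i a (ell g)) = w0 g :=
  (h.path_twist a).wordProd_twist (h.hf a)

theorem mono (h : IsChain g i Y) {a b : ℤ} (hab : a ≤ b) : Y a ≤ Y b := by
  obtain ⟨n, rfl⟩ := Int.le.dest hab
  exact (h.path a n).le

theorem compat (h : IsChain g i Y) (a b : ℤ) : Compat g (Y a) (Y b) := by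
  rcases le_total a b with hab | hab <;> obtain ⟨n, rfl⟩ := Int.le.dest hab
  · exact (h.path a n).compat (h.hf a)
  · exact ((h.path b n).compat (h.hf b)).symm

theorem apply_eq (h : IsChain g i Y) {a b : ℤ} (hab : a ≤ b) {j : Vertex g}
    (hj : ∀ u, a ≤ u → u < b → i u ≠ j) : Y b j = Y a j := by
  obtain ⟨n, rfl⟩ := Int.le.dest hab
  have hn : j ∉ window i a n := fun hm => by
    obtain ⟨u, h1, h2, h3⟩ := mem_window hm
    exact hj u h1 h2 h3
  rw [(h.path a n).apply j, List.count_eq_zero.2 hn]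
  simp

theorem apply_succ_self (h : IsChain g i Y) (a : ℤ) :
    Y (a + 1) (i a) = Y a (i a) + 2 * dd g (i a) := by rw [h.step, reflect_self]

theorem apply_succ_of_ne (h : IsChain g i Y) {a : ℤ} {j : Vertex g} (hj : i a ≠ j) :
    Y (a + 1) j = Y a j := by rw [h.step, reflect_of_ne (Ne.symm hj)]

theorem star (h : IsChain g i Y) (k : ℤ) : i (k + ell g) = star g (i k) := by
  have h1 := h.step (k + ell g)
  rw [show k + ell g + 1 = k + 1 + ell g by ring, h.twist, h.twist, h.step, twist_reflect] at h1
  by_contra hne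
  have h2 := congrFun h1 (i (k + ell g))
  rw [reflect_self, reflect_of_ne hne] at h2
  have := two_dd_pos (i (k + ell g))
  omega

theorem apply_mul (h : IsChain g i Y) (k m : ℤ) :
    i (k + m * ell g) = if Even m then i k else QData.star g (i k) := by
  have hstep : ∀ m, i (k + (m + 1) * ell g) = QData.star g (i (k + m * ell g)) := fun m => by
    rw [← h.star]
    congr 1
    ring
  induction m using Int.induction_on with
  | zero => simp
  | succ m ih =>
    rw [hstep, ih]
    have h3 : Even ((m : ℤ) + 1) ↔ ¬Even (m : ℤ) := Int.even_add_one
    by_cases hm : Even (m : ℤ)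
    · rw [if_pos hm, if_neg (h3.not.2 (not_not.2 hm))]
    · rw [if_neg hm, if_pos (h3.2 hm), star_star]
  | pred m ih =>
    have h1 := hstep (-m - 1)
    rw [sub_add_cancel, ih] at h1
    have h2 := congrArg (QData.star g) h1
    rw [star_star] at h2
    rw [← h2]
    have h3 : Even (-(m : ℤ) - 1) ↔ ¬Even (-(m : ℤ)) := Int.even_sub_one
    by_cases hm : Even (-(m : ℤ))
    · rw [if_pos hm, if_neg (h3.not.2 (not_not.2 hm))]
    · rw [if_neg hm, if_pos (h3.2 hm), star_star]

theorem shift (h : IsChain g i Y) (n : ℤ) : IsChain g (fun k => i (k + n)) fun k => Y (k + n) where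
  hf k := h.hf _
  sink k := h.sink _
  step k := by
    rw [show k + 1 + n = k + n + 1 by ring]
    exact h.step _
  twist k := by
    rw [show k + ell g + n = k + n + ell g by ring]
    exact h.twist _

theorem unique {i' : ℤ → Vertex g} {Y' : ℤ → Vertex g → ℤ} (h : IsChain g i Y)
    (h' : IsChain g i' Y') (hY : Y 1 = Y' 1) (hw : window i 1 (ell g) = window i' 1 (ell g)) :
    i = i' ∧ Y = Y' := by
  have hell := ell_pos g
  have hi : i = i' := by
    funext k
    have h1 : ∀ n : ℕ, n < ell g → i (1 + n) = i' (1 + n) := by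
      intro n hn
      have := congrFun (List.ofFn_injective hw) ⟨n, hn⟩
      exact this
    have h2 := Int.emod_add_mul_ediv (k - 1) (ell g)
    have h3 := Int.emod_nonneg (k - 1) (b := ell g) (by omega)
    have h4 := Int.emod_lt_of_pos (k - 1) (b := ell g) (by omega)
    have h5 : k = 1 + (((k - 1) % ell g).toNat : ℤ) + (k - 1) / ell g * ell g := by
      rw [Int.toNat_of_nonneg h3]
      rw [mul_comm] at h2
      linarith
    rw [h5, h.apply_mul, h'.apply_mul, h1 _ (by omega)]
  subst hi
  refine ⟨rfl, ?_⟩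
  funext k
  have hup : ∀ n : ℕ, Y (1 + n) = Y' (1 + n) := by
    intro n
    induction n with
    | zero => simpa using hY
    | succ n ih =>
      push_cast
      rw [← add_assoc, h.step, h'.step, ih]
  have hdown : ∀ n : ℕ, Y (1 - n) = Y' (1 - n) := by
    intro n
    induction n with
    | zero => simpa using hY
    | succ n ih =>
      have e1 := h.step (1 - ((n + 1 : ℕ) : ℤ))
      have e2 := h'.step (1 - ((n + 1 : ℕ) : ℤ))
      rw [show 1 - ((n + 1 : ℕ) : ℤ) + 1 = 1 - n by push_cast; ring] at e1 e2
      rw [← reflectInv_reflect (i (1 - ((n + 1 : ℕ) : ℤ))) (Y _), ← e1,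
        ← reflectInv_reflect (i (1 - ((n + 1 : ℕ) : ℤ))) (Y' _), ← e2, ih]
  rcases le_total 1 k with hk | hk
  · have := hup (k - 1).toNat
    rwa [show (1 : ℤ) + (k - 1).toNat = k by omega] at this
  · have := hdown (1 - k).toNat
    rwa [show (1 : ℤ) - (1 - k).toNat = k by omega] at this

/-- The adapted reduced expression of `w₀` read off from a chain. -/
noncomputable def pair (h : IsChain g i Y) : AdaptedPair g where
  Q := ⟨Y 1, (h.hf 1).isHeight⟩
  word := window i 1 (ell g)
  reduced := (h.path_twist 1).isReducedExpr (h.hf 1)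
  adapted := (h.path_twist 1).adapted

/-- Over 2ℓ steps the height at j grows by twice the shift, so it is unbounded in both directions.
The last step at which it is at most q must be a reflection at j, and the congruence then gives the
value q. -/
theorem exists_eq (h : IsChain g i Y) (j : Vertex g) {q : ℤ}
    (hq : (2 * dd g j : ℤ) ∣ q - Y 1 j) : ∃ k, i k = j ∧ Y k j = q := by
  have hc := shiftLen_pos g
  have htw : ∀ k, Y (k + ell g + ell g) j = Y k j + 2 * shiftLen g := by
    intro k
    rw [h.twist, h.twist, twist_apply, twist_apply, star_star]
    ring
  have hup : ∀ n : ℕ, Y (1 + 2 * ell g * n) j = Y 1 j + 2 * shiftLen g * n := by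
    intro n
    induction n with
    | zero => simp
    | succ n ih =>
      rw [show (1 : ℤ) + 2 * ell g * ((n + 1 : ℕ) : ℤ) = 1 + 2 * ell g * n + ell g + ell g by
        push_cast; ring, htw, ih]
      push_cast; ring
  have hdown : ∀ n : ℕ, Y (1 - 2 * ell g * n) j = Y 1 j - 2 * shiftLen g * n := by
    intro n
    induction n with
    | zero => simp
    | succ n ih =>
      have := htw (1 - 2 * ell g * ((n + 1 : ℕ) : ℤ))
      rw [show (1 : ℤ) - 2 * ell g * ((n + 1 : ℕ) : ℤ) + ell g + ell g = 1 - 2 * ell g * n by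
        push_cast; ring, ih] at this
      push_cast at this ⊢
      linarith
  obtain ⟨k, hk, hmax⟩ := Int.exists_greatest_of_bdd (P := fun k => Y k j ≤ q)
    (by
      refine ⟨1 + 2 * ell g * ((q - Y 1 j).toNat + 1 : ℕ), fun z hz => ?_⟩
      by_contra! hlt
      have h1 := h.mono hlt.le j
      rw [hup] at h1
      have h2 : q - Y 1 j ≤ (q - Y 1 j).toNat := Int.self_le_toNat _
      push_cast at h1
      nlinarith)
    (by
      refine ⟨1 - 2 * ell g * (Y 1 j - q).toNat, ?_⟩
      rw [hdown]
      have h2 : Y 1 j - q ≤ (Y 1 j - q).toNat := Int.self_le_toNat _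
      nlinarith)
  have hk1 : q < Y (k + 1) j := by
    by_contra! hle
    have := hmax _ hle
    omega
  have hik : i k = j := by
    by_contra hne
    rw [h.apply_succ_of_ne hne] at hk1
    omega
  refine ⟨k, hik, ?_⟩
  subst hik
  rw [h.apply_succ_self] at hk1
  have h1 := hq.sub ((h.compat 1 k).dvd (i k))
  rw [sub_sub_sub_cancel_right] at h1
  have := two_dd_pos (i k)
  exact (eq_of_dvd_sub h1 (by omega) (by omega)).symm

theorem lt_of_lt (h : IsChain g i Y) {a b : ℤ} (hab : a < b) (hi : i a = i b) :
    Y a (i a) + 2 * dd g (i a) ≤ Y b (i b) := by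
  rw [← h.apply_succ_self, ← hi]
  exact h.mono (by omega) _

theorem isAdmissible (h : IsChain g i Y) : IsAdmissible g i fun k => Y k (i k) where
  next a b hb := by
    obtain ⟨⟨hab, hi⟩, hmin⟩ := hb
    rw [hi, ← h.apply_succ_self]
    refine h.apply_eq (by omega) fun u h1 h2 h3 => ?_
    have := hmin ⟨by omega, h3⟩
    omega
  adj a b hadj hprev hab hnext := by
    have h1 : Y a (i b) = Y b (i b) := by
      refine (h.apply_eq hab.le fun u h1 h2 h3 => ?_).symm
      have := hprev u h2 h3
      omega
    have h2 : Y b (i a) = Y a (i a) + 2 * dd g (i a) := by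
      rw [← h.apply_succ_self]
      refine h.apply_eq (by omega) fun u h1 h2 h3 => ?_
      have := hnext u (by omega) h3
      omega
    have h3 := (h.hf a).lt_iff hadj |>.1 (h.sink a _ hadj)
    have h4 := (h.hf b).lt_iff (adj_symm g hadj) |>.1 (h.sink b _ (adj_symm g hadj))
    have h5 := (h.hf a).bound _ _ (adj_symm g hadj)
    rw [edge_symm] at h4 h5
    change Y b (i b) = Y a (i a) + edge g (i a) (i b)
    rcases min_choice (dd g (i a) : ℤ) (dd g (i b)) with h6 | h6 <;>
      · change edge g (i a) (i b) = _ at h6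
        omega
  sigma a b hab := by
    have h1 := (h.compat 1 a).dvd (i a)
    have h2 := (h.compat 1 b).dvd (i b)
    have h3 := (h.hf 1).sig (i a)
    rw [hab, dd_sigma] at h2
    have := (h2.add h3).sub h1
    obtain ⟨m, hm⟩ := this
    refine ⟨m, ?_⟩
    rw [← hm, hab]
    ring
  longest := h.longest

/-- The admissible sequence of a chain. -/
def seq (h : IsChain g i Y) : AdmissibleSeq g := ⟨i, fun k => Y k (i k), h.isAdmissible⟩

end IsChain

/-! ### Chains from adapted words -/

open Classical in
/-- The power `*^m` of the involution `*`. -/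
noncomputable def starPow (g : AffineType) (m : ℤ) : Equiv.Perm (Vertex g) :=
  if Even m then 1 else starPerm g

theorem isAut_starPow (m : ℤ) : IsAut g (starPow g m) := by
  rw [starPow]
  split_ifs
  · exact isAut_one g
  · exact isAut_star g

theorem starPow_succ (m : ℤ) (k : Vertex g) :
    (starPow g (m + 1)).symm k = (starPow g m).symm (star g k) := by
  by_cases hm : Even m
  · have : ¬Even (m + 1) := by rw [Int.even_add_one]; exact not_not.2 hm
    rw [starPow, starPow, if_pos hm, if_neg this]
    rfl
  · have : Even (m + 1) := by rw [Int.even_add_one]; exact hm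
    rw [starPow, starPow, if_neg hm, if_pos this]
    exact (star_star k).symm

theorem move_starPow_succ (m : ℤ) (ξ : Vertex g → ℤ) :
    move (starPow g (m + 1)) ((m + 1) * shiftLen g) ξ =
      twist g (move (starPow g m) (m * shiftLen g) ξ) := by
  funext k
  rw [twist_apply, move, move, starPow_succ]
  ring

theorem move_twist (m : ℤ) (ξ : Vertex g → ℤ) :
    move (starPow g m) (m * shiftLen g) (twist g ξ) =
      move (starPow g (m + 1)) ((m + 1) * shiftLen g) ξ := by
  funext k
  rw [move, move, starPow_succ, twist_apply]
  have : (starPow g m).symm (star g k) = star g ((starPow g m).symm k) := by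
    rw [starPow]
    split_ifs <;> rfl
  rw [this]
  ring

/-- Block m of the chain is the given word and its heights moved by *^m and the shift m ord(σ) h^∨.
The blocks fit together because the final height function of one is the twist of its initial one. -/
theorem exists_isChain (h : HF g ξ) {l : List (Vertex g)} (hl : Path g ξ l (twist g ξ)) :
    ∃ i Y, IsChain g i Y ∧ Y 1 = ξ ∧ window i 1 (ell g) = l := by
  have hell := ell_pos g
  have hlen := hl.length_eq_ell
  obtain ⟨v₀, -⟩ := exists_sigma_fixed g
  set L : ℤ := (ell g : ℤ) with hL
  let w : ℕ → Vertex g := fun n => l.getD n v₀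
  let H : ℕ → Vertex g → ℤ := fun n j => ξ j + 2 * dd g j * (l.take n).count j
  have hH0 : H 0 = ξ := by funext j; simp [H]
  have hHl : H (ell g) = twist g ξ := by
    funext j
    rw [hl.apply j, ← hlen]
    simp [H]
  have hH : ∀ n < ell g, HF g (H n) ∧ IsSink g (H n) (w n) ∧
      H (n + 1) = reflect g (w n) (H n) := by
    intro n hn
    have hn' : n < l.length := by omega
    have hw : w n = l[n] := by simp [w, hn']
    have hsplit := hl
    rw [← List.take_append_drop n l, List.drop_eq_getElem_cons hn'] at hsplit
    obtain ⟨η, h1, h2⟩ := path_append.1 hsplit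
    have hη : η = H n := by
      funext j
      rw [h1.apply j]
    rw [hη] at h1 h2
    refine ⟨(h1.compat h).right, hw ▸ h2.1, ?_⟩
    funext j
    have : l.take (n + 1) = l.take n ++ [l[n]] := by simp
    simp only [H, reflect, this, List.count_append, List.count_singleton, hw]
    by_cases hj : j = l[n]
    · subst hj; simp; ring
    · simp [hj, Ne.symm hj]
  -- The word occupies the indices 1, …, ℓ, hence the division of k - 1 by ℓ.
  let i : ℤ → Vertex g := fun k => starPow g ((k - 1) / L) (w ((k - 1) % L).toNat)
  let Y : ℤ → Vertex g → ℤ := fun k =>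
    move (starPow g ((k - 1) / L)) ((k - 1) / L * shiftLen g) (H ((k - 1) % L).toNat)
  have hLpos : 0 < L := by omega
  have key : ∀ (m : ℤ) (n : ℕ), n < ell g → (1 + n + L * m - 1) / L = m ∧
      ((1 + n + L * m - 1) % L).toNat = n := by
    intro m n hn
    have e : 1 + (n : ℤ) + L * m - 1 = n + L * m := by ring
    rw [e, Int.add_mul_ediv_left _ _ hLpos.ne', Int.add_mul_emod_self_left,
      Int.ediv_eq_zero_of_lt (by omega) (by omega), Int.emod_eq_of_lt (by omega) (by omega)]
    simp
  have hi : ∀ (m : ℤ) (n : ℕ), n < ell g → i (1 + n + L * m) = starPow g m (w n) := by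
    intro m n hn
    simp only [i, (key m n hn).1, (key m n hn).2]
  have hY : ∀ (m : ℤ) (n : ℕ), n < ell g →
      Y (1 + n + L * m) = move (starPow g m) (m * shiftLen g) (H n) := by
    intro m n hn
    simp only [Y, (key m n hn).1, (key m n hn).2]
  have hform : ∀ k : ℤ, ∃ (m : ℤ) (n : ℕ), n < ell g ∧ k = 1 + n + L * m := by
    intro k
    have h2 := Int.emod_add_mul_ediv (k - 1) L
    have h3 := Int.emod_nonneg (k - 1) hLpos.ne'
    have h4 := Int.emod_lt_of_pos (k - 1) hLpos
    refine ⟨(k - 1) / L, ((k - 1) % L).toNat, by omega, ?_⟩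
    rw [Int.toNat_of_nonneg h3]
    linarith
  refine ⟨i, Y, ⟨fun k => ?_, fun k => ?_, fun k => ?_, fun k => ?_⟩, ?_, ?_⟩
  · obtain ⟨m, n, hn, rfl⟩ := hform k
    rw [hY m n hn]
    exact (hH n hn).1.move (isAut_starPow m) _
  · obtain ⟨m, n, hn, rfl⟩ := hform k
    rw [hY m n hn, hi m n hn]
    exact (hH n hn).2.1.move (isAut_starPow m) _
  · obtain ⟨m, n, hn, rfl⟩ := hform k
    rw [hY m n hn, hi m n hn, ← move_reflect (isAut_starPow m), ← (hH n hn).2.2]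
    rcases Nat.lt_or_ge (n + 1) (ell g) with h1 | h1
    · rw [← hY m (n + 1) h1]
      congr 1
      push_cast; ring
    · have e : n + 1 = ell g := by omega
      have h2 := hY (m + 1) 0 hell
      rw [hH0] at h2
      rw [e, hHl, move_twist, ← h2]
      congr 1
      rw [hL, ← e]
      push_cast; ring
  · obtain ⟨m, n, hn, rfl⟩ := hform k
    rw [hY m n hn, ← move_starPow_succ, ← hY (m + 1) n hn]
    congr 1
    ring
  · have := hY 0 0 hell
    rw [hH0] at this
    simp only [Nat.cast_zero, add_zero, mul_zero] at this
    rw [this]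
    funext j
    simp [move, starPow]
    rfl
  · refine List.ext_getElem (by rw [length_window, hlen]) fun n h1 h2 => ?_
    rw [length_window] at h1
    have := hi 0 n h1
    simp only [mul_zero, add_zero] at this
    simp only [window, List.getElem_ofFn]
    rw [this]
    simp [starPow, w, h2]

end QData

namespace QData
variable {g : AffineType}

/-! ### Chains from admissible sequences -/

namespace IsAdmissible

variable {i : ℤ → Vertex g} {p : ℤ → ℤ}

/-- A window without the letter j would fix Λ_j, but its product w_0 sends Λ_j to -Λ_{j^*}. -/
theorem exists_occurrence (h : IsAdmissible g i p) (k : ℤ) (j : Vertex g) :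
    ∃ u, k ≤ u ∧ u < k + ell g ∧ i u = j := by
  by_contra! hc
  have h1 : j ∉ window i k (ell g) := fun hm => by
    obtain ⟨u, h1, h2, h3⟩ := mem_window hm
    exact hc u h1 h2 h3
  have h2 := wordProd_fundWeight h1
  rw [h.longest, w0_fundWeight] at h2
  exact fundWeight_ne_neg _ _ h2.symm

theorem exists_first (h : IsAdmissible g i p) (k : ℤ) (j : Vertex g) :
    ∃ u, IsLeast {u | k ≤ u ∧ i u = j} u := by
  obtain ⟨u, hu, -, huj⟩ := h.exists_occurrence k j
  obtain ⟨v, hv, hmin⟩ := Int.exists_least_of_bdd (P := fun u => k ≤ u ∧ i u = j)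
    ⟨k, fun z hz => hz.1⟩ ⟨u, hu, huj⟩
  exact ⟨v, hv, fun z hz => hmin z hz⟩

theorem exists_last (h : IsAdmissible g i p) (k : ℤ) (j : Vertex g) :
    ∃ u, IsGreatest {u | u < k ∧ i u = j} u := by
  obtain ⟨u, -, hu, huj⟩ := h.exists_occurrence (k - ell g) j
  obtain ⟨v, hv, hmax⟩ := Int.exists_greatest_of_bdd (P := fun u => u < k ∧ i u = j)
    ⟨k, fun z hz => hz.1.le⟩ ⟨u, by omega, huj⟩
  exact ⟨v, hv, fun z hz => hmax z hz⟩

/-- The first occurrence of `j` at or after `k`. -/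
noncomputable def first (h : IsAdmissible g i p) (k : ℤ) (j : Vertex g) : ℤ :=
  (h.exists_first k j).choose

theorem isLeast_first (h : IsAdmissible g i p) (k : ℤ) (j : Vertex g) :
    IsLeast {u | k ≤ u ∧ i u = j} (h.first k j) := (h.exists_first k j).choose_spec

theorem le_first (h : IsAdmissible g i p) (k : ℤ) (j : Vertex g) : k ≤ h.first k j :=
  (h.isLeast_first k j).1.1

theorem i_first (h : IsAdmissible g i p) (k : ℤ) (j : Vertex g) : i (h.first k j) = j :=
  (h.isLeast_first k j).1.2

theorem first_le (h : IsAdmissible g i p) {k u : ℤ} {j : Vertex g} (hk : k ≤ u) (hj : i u = j) :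
    h.first k j ≤ u := (h.isLeast_first k j).2 ⟨hk, hj⟩

theorem first_self (h : IsAdmissible g i p) (k : ℤ) : h.first k (i k) = k :=
  le_antisymm (h.first_le le_rfl rfl) (h.le_first _ _)

/-- The value at `j` of the height function before the `k`-th reflection. -/
noncomputable def height (h : IsAdmissible g i p) (k : ℤ) (j : Vertex g) : ℤ := p (h.first k j)

theorem height_self (h : IsAdmissible g i p) (k : ℤ) : h.height k (i k) = p k := by
  rw [height, first_self]

theorem p_eq_add (h : IsAdmissible g i p) (n : ℕ) : ∀ u v : ℤ, v - u < n → u ≤ v → i u = i v →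
    ∃ m : ℕ, p v = p u + 2 * dd g (i u) * m := by
  induction n with
  | zero => intro u v h1 h2; omega
  | succ n ih =>
    intro u v h1 h2 h3
    rcases h2.eq_or_lt with rfl | h4
    · exact ⟨0, by simp⟩
    · have h5 := h.i_first (u + 1) (i u)
      have h6 := h.le_first (u + 1) (i u)
      have h7 := h.first_le (k := u + 1) (j := i u) (u := v) (by omega) h3.symm
      have h8 := h.next u (h.first (u + 1) (i u))
        ⟨⟨by omega, h5⟩, fun z hz => h.first_le (by have := hz.1; omega) hz.2⟩
      obtain ⟨m, hm⟩ := ih (h.first (u + 1) (i u)) v (by omega) h7 (by rw [h5, h3])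
      refine ⟨m + 1, ?_⟩
      rw [hm, h8, h5]
      push_cast; ring

theorem p_le (h : IsAdmissible g i p) {u v : ℤ} (huv : u ≤ v) (hi : i u = i v) : p u ≤ p v := by
  obtain ⟨m, hm⟩ := h.p_eq_add (v - u + 1).toNat u v (by omega) huv hi
  rw [hm]
  have : (0 : ℤ) ≤ 2 * dd g (i u) * m := by positivity
  omega

/-- Admissibility compares v only with the last occurrence of the letter i_u before v; from u to
that occurrence p grows in steps of 2d. -/
theorem adj_eq_add (h : IsAdmissible g i p) {u v : ℤ} (hadj : Adj g (i u) (i v)) (huv : u < v)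
    (hprev : PrevLt i v u) : ∃ m : ℕ, p v = p u + 2 * dd g (i u) * m + edge g (i u) (i v) := by
  obtain ⟨u', ⟨h1, h2⟩, h3⟩ := h.exists_last v (i u)
  have h4 : u ≤ u' := h3 ⟨huv, rfl⟩
  have h5 := h.adj u' v (by rwa [h2]) (fun z h6 h7 => (hprev z h6 h7).trans_le h4) h1
    fun z h6 h7 => by
      by_contra! h8
      rcases h8.eq_or_lt with rfl | h9
      · exact hadj.1 (by rw [h7, h2])
      · have := h3 ⟨h9, h7.trans h2⟩
        omega
  obtain ⟨m, hm⟩ := h.p_eq_add (u' - u + 1).toNat u u' (by omega) h4 h2.symm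
  refine ⟨m, ?_⟩
  rw [h5, hm, h2, edge]

theorem first_prevLt (h : IsAdmissible g i p) {k : ℤ} {a b : Vertex g} :
    PrevLt i (h.first k b) (h.first k a) := by
  intro z h1 h2
  rw [h.i_first] at h2
  by_contra! h3
  have := h.first_le ((h.le_first k a).trans h3) h2
  omega

theorem height_adj (h : IsAdmissible g i p) {k : ℤ} {a b : Vertex g} (hab : Adj g a b)
    (hlt : h.first k a < h.first k b) :
    ∃ m : ℕ, h.height k b = h.height k a + 2 * dd g a * m + edge g a b := by
  have := h.adj_eq_add (u := h.first k a) (v := h.first k b)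
    (by rwa [h.i_first, h.i_first]) hlt h.first_prevLt
  rwa [h.i_first, h.i_first] at this

theorem first_ne (h : IsAdmissible g i p) (k : ℤ) {a b : Vertex g} (hab : a ≠ b) :
    h.first k a ≠ h.first k b := fun he => hab (by rw [← h.i_first k a, he, h.i_first])

/-- Compare with the last occurrence u of a before k: p at the next a is p_u + 2d_a, while the first
b after u already has p at least p_u plus the edge length, and later ones are no smaller. -/
theorem height_bound (h : IsAdmissible g i p) {k : ℤ} {a b : Vertex g} (hab : Adj g a b)
    (hlt : h.first k b < h.first k a) :
    h.height k a - h.height k b ≤ 2 * dd g a - edge g a b := by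
  obtain ⟨u, ⟨h1, h2⟩, h3⟩ := h.exists_last k a
  have ha := h.le_first k a
  have hb := h.le_first k b
  have hp := h.next u (h.first k a) ⟨⟨by omega, by rw [h.i_first, h2]⟩, fun z hz => by
    refine h.first_le ?_ (hz.2.trans h2)
    by_contra! h4
    have h5 := h3 ⟨h4, hz.2.trans h2⟩
    have := hz.1
    omega⟩
  have hv := h.le_first (u + 1) b
  have hvi := h.i_first (u + 1) b
  obtain ⟨m, hm⟩ := h.adj_eq_add (u := u) (v := h.first (u + 1) b) (by rwa [h2, hvi]) (by omega)
    fun z h4 h5 => by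
      rw [hvi] at h5
      by_contra! h6
      rcases h6.eq_or_lt with rfl | h7
      · exact hab.1 (by rw [← h2, h5])
      · have := h.first_le (k := u + 1) (by omega) h5
        omega
  have hle := h.p_le (h.first_le (k := u + 1) (u := h.first k b) (by omega) (h.i_first k b))
    (by rw [hvi, h.i_first])
  rw [h2, hvi] at hm
  rw [h2] at hp
  have : (0 : ℤ) ≤ 2 * dd g a * m := by positivity
  rw [height, height]
  omega

theorem height_hf (h : IsAdmissible g i p) (k : ℤ) : HF g (h.height k) where
  bound a b hab := by
    rcases lt_or_gt_of_ne (h.first_ne k hab.1) with hlt | hlt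
    · obtain ⟨m, hm⟩ := h.height_adj hab hlt
      have : (0 : ℤ) ≤ 2 * dd g a * m := by positivity
      have := two_dd_pos a
      omega
    · exact h.height_bound hab hlt
  cong a b hab := by
    rcases lt_or_gt_of_ne (h.first_ne k hab.1) with hlt | hlt
    · obtain ⟨m, hm⟩ := h.height_adj hab hlt
      have h1 := ((edge_dvd a b).mul_right m).neg_right.sub (dvd_refl (2 * edge g a b))
      rwa [show -(2 * (dd g a : ℤ) * m) - 2 * edge g a b =
        h.height k a - h.height k b - edge g a b by rw [hm]; ring] at h1
    · obtain ⟨m, hm⟩ := h.height_adj (adj_symm g hab) hlt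
      have h1 := (edge_dvd b a).mul_right m
      rw [edge_symm] at h1 hm
      rwa [show 2 * (dd g b : ℤ) * m = h.height k a - h.height k b - edge g a b by
        rw [hm]; ring] at h1
  sig a := by
    obtain ⟨m, hm⟩ := h.sigma (h.first k a) (h.first k (QData.sigma g a))
      (by rw [h.i_first, h.i_first])
    rw [h.i_first] at hm
    refine ⟨m, ?_⟩
    rw [← hm, height, height]
    ring

theorem height_sink (h : IsAdmissible g i p) (k : ℤ) : IsSink g (h.height k) (i k) := by
  intro j hj
  have h1 := h.first_ne k hj.1
  rw [first_self] at h1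
  obtain ⟨m, hm⟩ := h.height_adj (k := k) hj
    (by rw [first_self]; exact lt_of_le_of_ne (h.le_first k j) h1)
  rw [hm]
  have := edge_pos (i k) j
  have : (0 : ℤ) ≤ 2 * dd g (i k) * m := by positivity
  omega

theorem height_succ (h : IsAdmissible g i p) (k : ℤ) :
    h.height (k + 1) = reflect g (i k) (h.height k) := by
  funext j
  by_cases hj : j = i k
  · subst hj
    rw [reflect_self, height_self]
    have h1 := h.le_first (k + 1) (i k)
    exact h.next k _ ⟨⟨by omega, h.i_first _ _⟩, fun z hz =>
      h.first_le (by have := hz.1; omega) hz.2⟩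
  · rw [reflect_of_ne hj, height, height]
    congr 1
    have h1 := h.le_first (k + 1) j
    have h2 := h.le_first k j
    have h3 : h.first k j ≠ k := fun h4 => hj (by rw [← h.i_first k j, h4])
    exact le_antisymm (h.first_le (by omega) (h.i_first k j))
      (h.first_le (by omega) (h.i_first (k + 1) j))

theorem height_path (h : IsAdmissible g i p) (a : ℤ) (n : ℕ) :
    Path g (h.height a) (window i a n) (h.height (a + n)) := by
  induction n generalizing a with
  | zero => rw [Nat.cast_zero, add_zero]; rfl
  | succ n ih =>
    rw [window_succ]
    refine ⟨h.height_sink a, ?_⟩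
    rw [← h.height_succ, show a + ((n + 1 : ℕ) : ℤ) = a + 1 + n by push_cast; ring]
    exact ih (a + 1)

theorem _root_.QData.Path.eq_end {ξ ξ' ξ'' : Vertex g → ℤ} {l : List (Vertex g)}
    (h : Path g ξ l ξ') (h' : Path g ξ l ξ'') : ξ' = ξ'' := by
  funext j
  rw [h.apply j, h'.apply j]

/-- Every window of length ℓ is adapted and has product w_0, so it is reduced and must end at the
twist of its initial height function. -/
theorem isChain (h : IsAdmissible g i p) : IsChain g i h.height where
  hf := h.height_hf
  sink := h.height_sink
  step := h.height_succ
  twist k := by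
    have h1 := h.height_path k (ell g)
    exact h1.eq_end (path_twist_of_reduced (h.height_hf k) h1.adapted
      ⟨h.longest k, length_window i k _⟩)

end IsAdmissible

theorem IsChain.height_eq {i : ℤ → Vertex g} {Y : ℤ → Vertex g → ℤ} (h : IsChain g i Y) :
    h.isAdmissible.height = Y := by
  funext k j
  have h1 : ∀ u, k ≤ u → u < h.isAdmissible.first k j → i u ≠ j := fun u h2 h3 h4 => by
    have := h.isAdmissible.first_le h2 h4
    omega
  rw [← h.apply_eq (h.isAdmissible.le_first k j) h1, IsAdmissible.height, h.isAdmissible.i_first]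

/-! ### The bijection -/

theorem AdaptedPair.eq_of {x y : AdaptedPair g} (h1 : x.Q.ξ = y.Q.ξ) (h2 : x.word = y.word) :
    x = y := by
  obtain ⟨⟨ξ, _⟩, l, _, _⟩ := x
  obtain ⟨⟨ξ', _⟩, l', _, _⟩ := y
  obtain rfl : ξ = ξ' := h1
  obtain rfl : l = l' := h2
  rfl

theorem AdmissibleSeq.eq_of {x y : AdmissibleSeq g} (h1 : x.i = y.i) (h2 : x.p = y.p) :
    x = y := by
  cases x; cases y
  cases h1; cases h2
  rfl

namespace AdaptedPair

theorem path (x : AdaptedPair g) : Path g x.Q.ξ x.word (twist g x.Q.ξ) :=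
  path_twist_of_reduced x.Q.isHeight.hf x.adapted x.reduced

/-- The bi-infinite extension of the word. -/
noncomputable def letters (x : AdaptedPair g) : ℤ → Vertex g :=
  (exists_isChain x.Q.isHeight.hf x.path).choose

/-- The height functions along the bi-infinite extension of the word. -/
noncomputable def heights (x : AdaptedPair g) : ℤ → Vertex g → ℤ :=
  (exists_isChain x.Q.isHeight.hf x.path).choose_spec.choose

theorem isChain (x : AdaptedPair g) : IsChain g x.letters x.heights :=
  (exists_isChain x.Q.isHeight.hf x.path).choose_spec.choose_spec.1

theorem heights_one (x : AdaptedPair g) : x.heights 1 = x.Q.ξ :=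
  (exists_isChain x.Q.isHeight.hf x.path).choose_spec.choose_spec.2.1

theorem window_letters (x : AdaptedPair g) : window x.letters 1 (ell g) = x.word :=
  (exists_isChain x.Q.isHeight.hf x.path).choose_spec.choose_spec.2.2

end AdaptedPair

theorem IsChain.pair_eq {i : ℤ → Vertex g} {Y : ℤ → Vertex g → ℤ} (h : IsChain g i Y) :
    h.pair.letters = i ∧ h.pair.heights = Y :=
  h.pair.isChain.unique h h.pair.heights_one h.pair.window_letters

/-- The bijection between adapted reduced expressions of `w₀` and admissible sequences. -/
noncomputable def pairEquiv (g : AffineType) : AdaptedPair g ≃ AdmissibleSeq g where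
  toFun x := x.isChain.seq
  invFun h := h.admissible.isChain.pair
  left_inv x := by
    refine AdaptedPair.eq_of ?_ x.window_letters
    change x.isChain.isAdmissible.height 1 = _
    rw [x.isChain.height_eq, x.heights_one]
  right_inv h := by
    obtain ⟨h1, h2⟩ := h.admissible.isChain.pair_eq
    refine AdmissibleSeq.eq_of h1 ?_
    funext k
    change h.admissible.isChain.pair.heights k (h.admissible.isChain.pair.letters k) = _
    rw [h1, h2, h.admissible.height_self]

theorem IsChain.pairEquiv_pair {i : ℤ → Vertex g} {Y : ℤ → Vertex g → ℤ} (h : IsChain g i Y) :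
    pairEquiv g h.pair = h.seq := by
  obtain ⟨h1, h2⟩ := h.pair_eq
  refine AdmissibleSeq.eq_of h1 ?_
  funext k
  change h.pair.heights k (h.pair.letters k) = Y k (i k)
  rw [h1, h2]

/-! ### The indexing of Î_Q and the σ-neighbour property, read off from a chain -/

namespace IsChain

variable {i : ℤ → Vertex g} {Y : ℤ → Vertex g → ℤ}

theorem chainUp_eq (h : IsChain g i Y) (n : ℕ) : chainUp g (Y 1) i n = Y (n + 1) := by
  induction n with
  | zero => simp [chainUp]
  | succ n ih =>
    rw [chainUp, ih, ← h.step]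
    congr 1

theorem chainDown_eq (h : IsChain g i Y) (n : ℕ) : chainDown g (Y 1) i n = Y (1 - n) := by
  induction n with
  | zero => simp [chainDown]
  | succ n ih =>
    have h1 := h.step (-n)
    rw [chainDown, ih, show (1 : ℤ) - n = -n + 1 by ring, h1, reflectInv_reflect]
    congr 1
    push_cast; ring

theorem bijOn (h : IsChain g i Y) :
    Set.BijOn (fun k : ℤ => (i k, Y k (i k))) Set.univ (IHat g (Y 1)) := by
  refine ⟨fun k _ => ?_, fun a _ b _ hab => ?_, fun ⟨j, q⟩ hx => ?_⟩
  · obtain ⟨m, hm⟩ := (h.compat 1 k).dvd (i k)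
    exact ⟨m, hm⟩
  · simp only [Prod.mk.injEq] at hab
    rcases lt_trichotomy a b with hlt | heq | hlt
    · have := h.lt_of_lt hlt hab.1
      have := two_dd_pos (i a)
      omega
    · exact heq
    · have := h.lt_of_lt hlt hab.1.symm
      have := two_dd_pos (i b)
      omega
  · obtain ⟨m, hm⟩ := hx
    obtain ⟨k, hk1, hk2⟩ := h.exists_eq j (q := q) ⟨m, hm⟩
    refine ⟨k, Set.mem_univ k, ?_⟩
    simp only [hk1, hk2]

/-- The sink at b pins p_a = p_b + 1. The vertex σ(i_b) is reflected at height p_b + 2 at some time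
c. Being a sink then, it forces the height of i_a at time c to exceed p_a, so a < c; had i_a
recurred before c, the sink condition there would force σ(i_b) above p_b + 2. -/
theorem exists_next_sigma (h : IsChain g i Y) {a b : ℤ} (hprev : PrevLt i a b) (hba : b < a)
    (hadj : Adj g (i a) (i b)) (hd : dd g (i a) < dd g (i b)) :
    ∃ c, a < c ∧ LtNext i c a ∧ i c = sigma g (i b) := by
  have hda : dd g (i a) = 1 := by
    have := dd_le_ordSigma g (i b)
    rcases dd_eq_one_or g (i a) with h1 | h1 <;> omega
  have hσa := sigma_eq_of_dd g hda
  have hadj' : Adj g (i a) (sigma g (i b)) := by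
    have := (adj_sigma g).2 hadj
    rwa [hσa] at this
  have he : edge g (i a) (i b) = 1 := by
    rw [edge, hda]
    exact min_eq_left (by exact_mod_cast dd_pos g _)
  have he' : edge g (i a) (sigma g (i b)) = 1 := by
    rw [edge, hda]
    exact min_eq_left (by exact_mod_cast dd_pos g _)
  have hab : Y a (i a) = Y b (i a) := h.apply_eq hba.le fun u h1 h2 h3 => by
    have := hprev u h2 h3
    omega
  have hpa : Y a (i a) = Y b (i b) + 1 := by
    have h1 := (h.hf b).bound _ _ hadj
    have h2 := (h.hf b).lt_iff (adj_symm g hadj) |>.1 (h.sink b _ (adj_symm g hadj))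
    rw [he, hda] at h1
    rw [edge_symm, he] at h2
    push_cast at h1
    omega
  obtain ⟨c, hc, hcv⟩ := h.exists_eq (sigma g (i b)) (q := Y b (i b) + 2) (by
    have h1 := (h.hf b).sig (i b)
    have h2 := (h.compat 1 b).dvd (sigma g (i b))
    rw [dd_sigma] at h2 ⊢
    have := h2.sub h1
    rwa [show Y b (sigma g (i b)) - Y 1 (sigma g (i b)) - (Y b (sigma g (i b)) - Y b (i b) - 2) =
      Y b (i b) + 2 - Y 1 (sigma g (i b)) by ring] at this)
  have hsink : ∀ u, i u = i a → Y u (i a) + 1 ≤ Y u (sigma g (i b)) := by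
    intro u hu
    have h1 := (h.hf u).lt_iff hadj' |>.1 (by rw [← hu]; exact h.sink u _ (by rw [hu]; exact hadj'))
    rwa [he'] at h1
  have hcsink := (h.hf c).lt_iff (adj_symm g hadj') |>.1
    (by rw [← hc]; exact h.sink c _ (by rw [hc]; exact adj_symm g hadj'))
  rw [edge_symm, he', hcv] at hcsink
  have hne : ∀ u, i u = i a → u ≠ c := fun u hu huc => by
    rw [← huc, hu] at hc
    rw [hc, dd_sigma] at hd
    exact lt_irrefl _ hd
  refine ⟨c, ?_, fun u hau hu => ?_, hc⟩
  · by_contra! hca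
    have : Y c (i a) ≤ Y a (i a) := h.mono hca (i a)
    omega
  · by_contra! huc
    have h1 := h.lt_of_lt hau hu.symm
    have h2 := hsink u hu
    have h3 : Y u (sigma g (i b)) ≤ Y c (sigma g (i b)) := h.mono huc _
    rw [hu] at h1
    have := two_dd_pos (i a)
    omega

end IsChain

/-! ### The map `φ_Q` -/

theorem Path.exists_step {ξ ξ' : Vertex g → ℤ} {l : List (Vertex g)} (h : Path g ξ l ξ')
    {i : Vertex g} {p : ℤ} (hp : (2 * dd g i : ℤ) ∣ p - ξ i) (hle : ξ i ≤ p) (hlt : p < ξ' i) :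
    ∃ a b η, l = a ++ i :: b ∧ Path g ξ a η ∧ η i = p ∧ IsSink g η i := by
  induction l generalizing ξ with
  | nil =>
    rw [show ξ = ξ' from h] at hle
    omega
  | cons k l ih =>
    by_cases hk : k = i ∧ ξ i = p
    · obtain ⟨rfl, hp⟩ := hk
      exact ⟨[], l, ξ, rfl, rfl, hp, h.1⟩
    · have h1 : (2 * dd g i : ℤ) ∣ p - reflect g k ξ i ∧ reflect g k ξ i ≤ p := by
        by_cases hki : i = k
        · subst hki
          rw [reflect_self, ← sub_sub]
          refine ⟨hp.sub (dvd_refl _), ?_⟩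
          have h2 : ξ i ≠ p := fun h2 => hk ⟨rfl, h2⟩
          have := Int.le_of_dvd (by omega) hp
          omega
        · rw [reflect_of_ne hki]
          exact ⟨hp, hle⟩
      obtain ⟨a, b, η, rfl, h2, h3, h4⟩ := ih h.2 h1.1 h1.2
      exact ⟨k :: a, b, η, rfl, ⟨h.1, h2⟩, h3, h4⟩

/-- Below the twist, (i, p) is the position of a letter in an adapted reduced word of w_0, and the
difference is a prefix of that word applied to the next simple root. -/
theorem slot_sub_mem {ξ : Vertex g → ℤ} (h : HF g ξ) {i : Vertex g} {p : ℤ}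
    (hp : (2 * dd g i : ℤ) ∣ p - ξ i) (hle : ξ i ≤ p) (hlt : p < twist g ξ i) :
    slot g ξ i p - slot g ξ i (p + 2 * dd g i) ∈ posRoots g := by
  obtain ⟨l, hl⟩ := h.twist.exists_path h.le_twist
  obtain ⟨a, b, η, rfl, h1, h2, h3⟩ := hl.exists_step hp hle hlt
  have h4 := slot_sub_sink (h1.compat h) h3
  rw [h2, h1.tr_eq h] at h4
  rw [h4]
  refine (wordProd_reduced_iff _).1 ?_ a i b rfl
  have h5 := hl.isReducedExpr h
  rw [h5.1, h5.2, len_eq_inv (w0_mem g)]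

/-- Applying τ^{d_i} advances both weights by 2d_i in p. All differences met before the twist are
positive roots, so `stepUp` always takes its first branch and the second component stays 0. -/
theorem phi_eq (Q : QDatum g) {i : Vertex g} {p : ℤ} (hp : (2 * dd g i : ℤ) ∣ p - Q.ξ i)
    (hle : Q.ξ i ≤ p) (hlt : p < twist g Q.ξ i) :
    phi g Q (i, p) = (slot g Q.ξ i p - slot g Q.ξ i (p + 2 * dd g i), 0) := by
  have h := Q.isHeight.hf
  have hd := two_dd_pos i
  have hcox : ∀ q, (2 * dd g i : ℤ) ∣ q - Q.ξ i →
      (coxeter g Q ^ dd g i) (slot g Q.ξ i q) = slot g Q.ξ i (q + 2 * dd g i) := by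
    intro q hq
    rw [coxeter_eq, cox_pow_slot h hq, sigma_pow_dd]
  have hdvd : ∀ m : ℤ, (2 * dd g i : ℤ) ∣ Q.ξ i + 2 * dd g i * m - Q.ξ i := fun m =>
    ⟨m, by ring⟩
  have hgam : gam g Q i = slot g Q.ξ i (Q.ξ i) - slot g Q.ξ i (Q.ξ i + 2 * dd g i) := by
    rw [gam, ← slot_self h i, hcox _ (by simp)]
  have hiter : ∀ m : ℕ, Q.ξ i + 2 * dd g i * m < twist g Q.ξ i →
      (stepUp g Q i)^[m] (gam g Q i, 0) =
        (slot g Q.ξ i (Q.ξ i + 2 * dd g i * m) -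
          slot g Q.ξ i (Q.ξ i + 2 * dd g i * m + 2 * dd g i), 0) := by
    intro m
    induction m with
    | zero => intro _; rw [Function.iterate_zero, id, hgam, Nat.cast_zero, mul_zero, add_zero]
    | succ m ih =>
      intro hm
      have e : Q.ξ i + 2 * (dd g i : ℤ) * m + 2 * dd g i =
          Q.ξ i + 2 * dd g i * ((m + 1 : ℕ) : ℤ) := by push_cast; ring
      rw [Function.iterate_succ_apply', ih (by omega)]
      have h1 : (coxeter g Q ^ dd g i) (slot g Q.ξ i (Q.ξ i + 2 * dd g i * m) -
          slot g Q.ξ i (Q.ξ i + 2 * dd g i * m + 2 * dd g i)) =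
          slot g Q.ξ i (Q.ξ i + 2 * dd g i * ((m + 1 : ℕ) : ℤ)) -
          slot g Q.ξ i (Q.ξ i + 2 * dd g i * ((m + 1 : ℕ) : ℤ) + 2 * dd g i) := by
        rw [map_sub, hcox _ (hdvd _), e, hcox _ (hdvd _)]
      have h2 := slot_sub_mem h (hdvd ((m + 1 : ℕ) : ℤ))
        (le_add_of_nonneg_right (by positivity)) hm
      rw [stepUp]
      simp only
      rw [h1, if_pos ((mem_posRoots_iff _).1 h2)]
  obtain ⟨m, hm⟩ := hp
  have hm0 : 0 ≤ m := by
    by_contra! hc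
    nlinarith
  lift m to ℕ using hm0
  have hp : p = Q.ξ i + 2 * dd g i * m := by omega
  have hk : (p - Q.ξ i) / (2 * dd g i) = m := by
    rw [hm, Int.mul_ediv_cancel_left _ hd.ne']
  rw [phi]
  simp only [hk]
  rw [if_pos (by positivity), Int.toNat_natCast, hiter m (by omega), ← hp]

theorem IsChain.phi_eq {i : ℤ → Vertex g} {Y : ℤ → Vertex g → ℤ} (h : IsChain g i Y)
    {Q : QDatum g} (hQ : Y 1 = Q.ξ) {k : ℕ} (hk1 : 1 ≤ k) (hk2 : k ≤ ell g) :
    phi g Q (i k, Y k (i k)) =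
      (wordProd g (window i 1 (k - 1)) (simpleRoot g (i k)), 0) := by
  have hc := h.compat 1 k
  have h1 := h.mono (a := 1) (b := k) (by omega) (i k)
  have h2 := h.mono (a := k + 1) (b := 1 + ell g) (by omega) (i k)
  rw [h.apply_succ_self, h.twist] at h2
  have hd := two_dd_pos (i k)
  have hp := h.path 1 (k - 1)
  rw [show (1 : ℤ) + (k - 1 : ℕ) = k by omega] at hp
  have hs := slot_sub_sink hc (h.sink k)
  rw [hp.tr_eq (h.hf 1)] at hs
  rw [hQ] at hc h1 h2 hs
  rw [QData.phi_eq Q (hc.dvd _) h1 (by linarith), hs]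

end QData

/-! ### The proposition, assembled from the chain attached to an adapted pair -/

theorem mainTheorem9 (g : QData.AffineType) :
    -- the Coxeter elements `τ_Q` are well defined
    (∃! τ, QData.IsCoxeterFamily g τ) ∧
    ∃ ρ : QData.AdaptedPair g ≃ QData.AdmissibleSeq g,
      -- (1) the description of `ρ`
      (∀ x : QData.AdaptedPair g,
        (∀ (t : Fin x.word.length) (m : ℤ),
          (ρ x).i ((t : ℤ) + 1 + m * QData.ell g) =
            if Even m then x.word.get t else QData.star g (x.word.get t)) ∧
        (∀ n : ℕ,
          QData.IsHeight g (QData.chainUp g x.Q.ξ (ρ x).i n) ∧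
          QData.IsSink g (QData.chainUp g x.Q.ξ (ρ x).i n) ((ρ x).i (n + 1)) ∧
          (ρ x).p (n + 1) = QData.chainUp g x.Q.ξ (ρ x).i n ((ρ x).i (n + 1))) ∧
        (∀ n : ℕ,
          QData.IsHeight g (QData.chainDown g x.Q.ξ (ρ x).i n) ∧
          QData.IsSource g (QData.chainDown g x.Q.ξ (ρ x).i n) ((ρ x).i (-n)) ∧
          (ρ x).p (-n) = QData.chainDown g x.Q.ξ (ρ x).i (n + 1) ((ρ x).i (-n)))) ∧
      -- (2) the description of the inverse of `ρ`
      (∀ h : QData.AdmissibleSeq g,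
        (ρ.symm h).word = QData.window h.i 1 (QData.ell g) ∧
        ∀ i : QData.Vertex g, ∃ k : ℤ, IsLeast {k : ℤ | 1 ≤ k ∧ h.i k = i} k ∧
          (ρ.symm h).Q.ξ i = h.p k) ∧
      ∀ x : QData.AdaptedPair g,
        -- (i)
        Set.BijOn (fun k : ℤ => ((ρ x).i k, (ρ x).p k)) Set.univ (QData.IHat g x.Q.ξ) ∧
        -- (ii)
        (∀ k : ℕ, 1 ≤ k → k ≤ QData.ell g →
          QData.phi g x.Q ((ρ x).i k, (ρ x).p k) =
            (QData.wordProd g (QData.window (ρ x).i 1 (k - 1))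
              (QData.simpleRoot g ((ρ x).i k)), 0)) ∧
        -- (iii)
        (∀ k : ℤ, (ρ x).i (k + QData.ell g) = QData.star g ((ρ x).i k) ∧
          (ρ x).p (k + QData.ell g) =
            (ρ x).p k + QData.ordSigma g * QData.dualCoxeter g) ∧
        -- (iv)
        (QData.IsSink g x.Q.ξ ((ρ x).i 1) ∧
          ∃ y : QData.AdaptedPair g, y.Q.ξ = QData.reflect g ((ρ x).i 1) x.Q.ξ ∧
            y.word = QData.window (ρ x).i 2 (QData.ell g) ∧
            ∀ k : ℤ, (ρ y).i k = (ρ x).i (k + 1) ∧ (ρ y).p k = (ρ x).p (k + 1)) ∧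
        -- (v)
        (∀ a b : ℤ, QData.PrevLt (ρ x).i a b → b < a →
          QData.Adj g ((ρ x).i a) ((ρ x).i b) →
          QData.dd g ((ρ x).i a) < QData.dd g ((ρ x).i b) →
          ∃ c : ℤ, a < c ∧ QData.LtNext (ρ x).i c a ∧
            (ρ x).i c = QData.sigma g ((ρ x).i b)) := by
  refine ⟨QData.existsUnique_coxeterFamily g, QData.pairEquiv g, fun x => ?_, fun h => ?_,
    fun x => ?_⟩
  · have C := x.isChain
    refine ⟨fun t m => ?_, fun n => ?_, fun n => ?_⟩
    · have h1 := C.apply_mul (t + 1) m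
      have h2 : x.letters (t + 1) = x.word.get t := by
        have h3 : ∀ l, l = QData.window x.letters 1 (QData.ell g) → ∀ (n : ℕ) (hn : n < l.length),
            x.letters (n + 1) = l[n] := by
          rintro _ rfl n hn
          simp [QData.window, add_comm]
        exact h3 _ x.window_letters.symm t t.2
      rw [← h2]
      exact h1
    · change QData.IsHeight g (QData.chainUp g x.Q.ξ x.letters n) ∧
        QData.IsSink g (QData.chainUp g x.Q.ξ x.letters n) (x.letters (n + 1)) ∧
        x.heights (n + 1) (x.letters (n + 1)) =
          QData.chainUp g x.Q.ξ x.letters n (x.letters (n + 1))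
      rw [← x.heights_one, C.chainUp_eq]
      exact ⟨(C.hf _).isHeight, C.sink _, rfl⟩
    · change QData.IsHeight g (QData.chainDown g x.Q.ξ x.letters n) ∧
        QData.IsSource g (QData.chainDown g x.Q.ξ x.letters n) (x.letters (-n)) ∧
        x.heights (-n) (x.letters (-n)) =
          QData.chainDown g x.Q.ξ x.letters (n + 1) (x.letters (-n))
      rw [← x.heights_one, C.chainDown_eq, C.chainDown_eq]
      refine ⟨(C.hf _).isHeight, ?_, ?_⟩
      -- The height function at time 1 - n has just been produced by the reflection at i_{-n}, which
      -- makes that vertex a source.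
      · rw [show (1 : ℤ) - n = -n + 1 by ring, C.step]
        exact (C.hf _).source_reflect _
      · congr 1
        push_cast
        ring
  · exact ⟨rfl, fun i => ⟨h.admissible.first 1 i, h.admissible.isLeast_first 1 i, rfl⟩⟩
  · have C := x.isChain
    have h1 := x.heights_one
    refine ⟨?_, fun k hk1 hk2 => C.phi_eq h1 hk1 hk2, fun k => ⟨C.star k, ?_⟩,
      ⟨?_, (C.shift 1).pair, ?_, ?_, fun k => ?_⟩, fun a b => C.exists_next_sigma⟩
    · rw [← h1]
      exact C.bijOn
    · change x.heights (k + QData.ell g) (x.letters (k + QData.ell g)) = _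
      rw [C.twist, C.star, QData.twist_apply, QData.star_star]
      rfl
    · rw [← h1]
      exact C.sink 1
    · change x.heights (1 + 1) = _
      rw [C.step, h1]
      rfl
    · change QData.window (fun k => x.letters (k + 1)) 1 _ = QData.window x.letters 2 _
      simp only [QData.window]
      congr 1
      funext j
      congr 1
      ring
    · rw [(C.shift 1).pairEquiv_pair]
      exact ⟨rfl, rfl⟩
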